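/- **Setting.** Let $K$ be a field of characteristic $0$ and let $q\in K$ be non-zero and not a root of unity; assume that $K$ contains a root $q^{1/4}$ (for instance $K=\mathbb C$), and put $q^{1/2}=(q^{1/4})^2$. For $n\ge 1$ let $N=2n$, $i'=N+1-i$, $\xi=q^{1-n}$, $\xi^{-1/2}=(q^{1/2})^{n-1}$, and $\bar\imath=n-\frac12-i$ for $i<n$, $\bar\imath=0$ for $i=n,n+1$, $\bar\imath=n+\frac32-i$ for $i>n+1$. Let $$f(u,v)=\frac{uq-vq^{-1}}{u-v},\quad g(u,v)=\frac{(q-q^{-1})u}{u-v},\quad \tilde g(u,v)=\frac{(q-q^{-1})v}{u-v},$$ let ${\sf p}_{ij}(u,v)$ be $f(u,v)-1$ for $i=j$, $\tilde g(u,v)$ for $i<j$, $g(u,v)$ for $i>j$, and let ${\sf q}_{ij}(u,v)=q^{\bar\imath-\bar\jmath}\,{\sf p}_{ji}(v\xi,u)-(q-2+q^{-1})\,\delta_{\bar\imath,\overline{i'}}\,\delta_{ij}$. With the matrix units ${\sf e}_{ij}$ of size $N$ put $$\mathbb P(u,v)=\sum_{i,j}{\sf p}_{ij}(u,v)\,{\sf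 e}_{ji}\otimes{\sf e}_{ij},\qquad \mathbb Q(u,v)=\sum_{i,j}{\sf q}_{ij}(u,v)\,{\sf e}_{i'j'}\otimes{\sf e}_{ij}.$$ Let $U$ be the permutation matrix exchanging the basis vectors $n$ and $n+1$. Let $\mathbb U$ be the matrix which is the identity outside of the rows and columns $n,n+1$ and whose block in the rows and columns $n,n+1$ is $\begin{pmatrix}a_+&a_-\\a_-&a_+\end{pmatrix}$, $a_\pm=\frac{1\pm\xi^{-1/2}}{2q^{1/4}}$. The twisted R-matrix is $$R^{(n)}(u,v)=(\mathbb U\otimes\mathbb U)\,R^{\rm J}(u,v)\,(\mathbb U^{-1}\otimes\mathbb U^{-1}),$$ $$R^{\rm J}(u,v)=\tfrac12\big(1+\mathbb P(u,v)+\mathbb Q(u,v)\big)+\tfrac12\,(U\otimes1)\big(1+\mathbb P(-u,v)+\mathbb Q(-u,v)\big)(U\otimes1).$$ Let $A$ be a unital associative $K$-algebra. Consider matrices $L^\pm(u)=\sum_{i,j=1}^{2n}{\sf e}_{ij}\otimes L^\pm_{ij}(u)$ with $L^\pm_{ij}(u)=\sum_{m\ge0}L^\pm_{ij}[\pm m]\,u^{\mp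 m}$, $L^\pm_{ij}[\pm m]\in A$. We say that $L^\pm$ satisfy the *relations of $U_q(D_n^{(2)})$* if 1. (zero modes) $L^+_{ji}[0]=L^-_{ij}[0]=0$ for $i<j$, and $L^+_{ii}[0]L^-_{ii}[0]=L^-_{ii}[0]L^+_{ii}[0]=1$ for all $i$; 2. (RLL) for all $\mu,\rho\in\{+,-\}$ $$R^{(n)}(u,v)\,(L^\mu(u)\otimes 1)\,(1\otimes L^\rho(v))=(1\otimes L^\rho(v))\,(L^\mu(u)\otimes1)\,R^{(n)}(u,v),$$ where $R^{(n)}(u,v)$ is expanded in powers of $v/u$ for $(\mu,\rho)=(+,-)$, in powers of $u/v$ for $(\mu,\rho)=(-,+)$, and in either way for $\mu=\rho$ (both relations are required). $U_q(D_n^{(2)})$ is the unital associative $K$-algebra with generators $L^\pm_{ij}[\pm m]$ ($1\le i,j\le 2n$, $m\ge0$) and these defining relations. **Theorem.** Let $n\ge2$. (a) Let $A$ be a unital associative $K$-algebra and let $L^\pm(u)$, of size $2n$ and with entries over $A$, satisfy the relations of $U_q(D_n^{(2)})$. Then the series $L^\pm_{11}(u)$ are invertible, and the matrices $M^\pm(u)$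 of size $2n-2$ with the entries $$M^\pm_{ij}(u)=L^\pm_{ij}(u)-L^\pm_{1j}(u)\,L^\pm_{11}(u)^{-1}\,L^\pm_{i1}(u),\qquad 1<i,j<2n,$$ after renumbering the indices $2,\dots,2n-1$ as $1,\dots,2n-2$, satisfy the relations of $U_q(D_{n-1}^{(2)})$; in particular, for all $\mu,\rho=\pm$, $$R^{(n-1)}(u,v)\,(M^\mu(u)\otimes1)\,(1\otimes M^\rho(v))=(1\otimes M^\rho(v))\,(M^\mu(u)\otimes1)\,R^{(n-1)}(u,v).$$ (b) Consequently there is a unique homomorphism of unital $K$-algebras $U_q(D_{n-1}^{(2)})\to U_q(D_n^{(2)})$ which maps, coefficient by coefficient, the fundamental L-operators of $U_q(D_{n-1}^{(2)})$ to the matrices $M^\pm(u)$ built from the fundamental L-operators of $U_q(D_n^{(2)})$. -/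

import Mathlib

open scoped Kronecker PowerSeries

namespace TwistedD

/-! ## The R-matrix

`F` is a field and `p` stands for `q^{1/4}`, so `q = p ^ 4` and `q^{1/2} = p ^ 2`.  The index set
`{1, …, 2n}` is `Fin (2 * n)`, the `Fin` element `i` being the index `i + 1`; the involution
`i' = 2n + 1 - i` is `Fin.rev`. -/

section RMatrix

variable {F : Type*} [Field F]

/-- The two middle indices `n` and `n + 1`. -/
def Mid (n : ℕ) (i : Fin (2 * n)) : Prop := (i : ℕ) + 1 = n ∨ (i : ℕ) + 1 = n + 1

instance (n : ℕ) (i : Fin (2 * n)) : Decidable (Mid n i) := by unfold Mid; infer_instance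

/-- Twice the (half-integral) number `i ↦ ī`: it is `n - 1/2 - i` for `i < n`, `0` for
`i = n, n + 1`, and `n + 3/2 - i` for `i > n + 1`. -/
def twoBar (n : ℕ) (i : Fin (2 * n)) : ℤ :=
  if (i : ℕ) + 1 < n then 2 * n - 1 - 2 * ((i : ℤ) + 1)
  else if (i : ℕ) + 1 ≤ n + 1 then 0
  else 2 * n + 3 - 2 * ((i : ℤ) + 1)

/-- `ξ = q ^ (1 - n)`. -/
def xi (n : ℕ) (p : F) : F := (p ^ 4) ^ (1 - n : ℤ)

/-- `f(u,v) = (u q - v q⁻¹) / (u - v)`. -/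
def fFun (q u v : F) : F := (u * q - v * q⁻¹) / (u - v)

/-- `g(u,v) = (q - q⁻¹) u / (u - v)`. -/
def gFun (q u v : F) : F := (q - q⁻¹) * u / (u - v)

/-- `g̃(u,v) = (q - q⁻¹) v / (u - v)`. -/
def gtFun (q u v : F) : F := (q - q⁻¹) * v / (u - v)

/-- The functions `p_{ij}(u,v)`. -/
def pFun {N : ℕ} (q : F) (i j : Fin N) (u v : F) : F :=
  if i = j then fFun q u v - 1 else if i < j then gtFun q u v else gFun q u v

/-- The functions `q_{ij}(u,v|ξ) = q^{ī - j̄} p_{ji}(vξ,u) - (q - 2 + q⁻¹) δ_{ī,ī'} δ_{ij}`. -/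
def qFun (n : ℕ) (p : F) (i j : Fin (2 * n)) (u v : F) : F :=
  (p ^ 2) ^ (twoBar n i - twoBar n j) * pFun (p ^ 4) j i (v * xi n p) u -
    if twoBar n i = twoBar n i.rev ∧ i = j then p ^ 4 - 2 + (p ^ 4)⁻¹ else 0

/-- Endomorphisms of `F^N ⊗ F^N`, `N = 2n`, as matrices indexed by pairs. -/
abbrev Mat2 (n : ℕ) (A : Type*) :=
  Matrix (Fin (2 * n) × Fin (2 * n)) (Fin (2 * n) × Fin (2 * n)) A

/-- `ℙ(u,v) = ∑ p_{ij}(u,v) e_{ji} ⊗ e_{ij}`. -/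
def PMat (n : ℕ) (p u v : F) : Mat2 n F :=
  ∑ i : Fin (2 * n), ∑ j : Fin (2 * n),
    pFun (p ^ 4) i j u v • (Matrix.single j i (1 : F) ⊗ₖ Matrix.single i j (1 : F))

/-- `ℚᴶ(u,v|ξ) = ∑ q_{ij}(u,v|ξ) e_{i'j'} ⊗ e_{ij}`. -/
def QMat (n : ℕ) (p u v : F) : Mat2 n F :=
  ∑ i : Fin (2 * n), ∑ j : Fin (2 * n),
    qFun n p i j u v • (Matrix.single i.rev j.rev (1 : F) ⊗ₖ Matrix.single i j (1 : F))

/-- The matrix `U`: the identity, except that it exchanges the basis vectors `n` and `n + 1`. -/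
def UMat (n : ℕ) (F : Type*) [Field F] : Matrix (Fin (2 * n)) (Fin (2 * n)) F :=
  Matrix.of fun i j =>
    (if i = j ∧ ¬ Mid n i ∧ ¬ Mid n j then 1 else 0) +
      (if i = j.rev ∧ Mid n i ∧ Mid n j then 1 else 0)

/-- Jimbo's R-matrix
`Rᴶ(u,v) = ½ (1 + ℙ(u,v) + ℚᴶ(u,v)) + ½ (U ⊗ 1) (1 + ℙ(-u,v) + ℚᴶ(-u,v)) (U ⊗ 1)`. -/
def RJimbo (n : ℕ) (p u v : F) : Mat2 n F :=
  (1 / 2 : F) • (1 + PMat n p u v + QMat n p u v) +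
    (1 / 2 : F) • ((UMat n F ⊗ₖ 1) * (1 + PMat n p (-u) v + QMat n p (-u) v) * (UMat n F ⊗ₖ 1))

/-- `a_± = (1 ± ξ^{-1/2}) / (2 q^{1/4})`, where `ξ^{-1/2} = (q^{1/2}) ^ (n - 1)`; here `ε = ±1`. -/
def aCoeff (n : ℕ) (p ε : F) : F := (1 + ε * (p ^ 2) ^ (n - 1 : ℤ)) / (2 * p)

/-- The twisting matrix `𝕌`. -/
def twist (n : ℕ) (p : F) : Matrix (Fin (2 * n)) (Fin (2 * n)) F :=
  Matrix.of fun i j =>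
    (if i = j ∧ ¬ Mid n i ∧ ¬ Mid n j then 1 else 0) +
      (if Mid n i ∧ Mid n j then
        (if i = j then aCoeff n p 1 else 0) + (if i = j.rev then aCoeff n p (-1) else 0)
      else 0)

/-- The twisted R-matrix `R^{(n)}(u,v) = (𝕌 ⊗ 𝕌) Rᴶ(u,v) (𝕌⁻¹ ⊗ 𝕌⁻¹)`. -/
noncomputable def RMat (n : ℕ) (p u v : F) : Mat2 n F :=
  (twist n p ⊗ₖ twist n p) * RJimbo n p u v * ((twist n p)⁻¹ ⊗ₖ (twist n p)⁻¹)

end RMatrix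

/-! ## Expansions of the R-matrix and the RLL relations -/

/-- The two ways of expanding the rational functions of the R-matrix. -/
inductive Dir where
  /-- as power series in `v / u` -/
  | vOverU : Dir
  /-- as power series in `u / v` -/
  | uOverV : Dir

/-- The superscripts of the L-operators. -/
inductive Sgn where
  | plus : Sgn
  | minus : Sgn

section RLL

variable {K : Type*} [Field K]

/-- The matrix `R_k` in the expansion `R(u,v) = ∑_{k ≥ 0} R_k x^k`, where `x = v/u` or `x = u/v`.
The entries of `R(u,v)` are homogeneous of degree `0` in `(u,v)`, so that this is the expansion of
`R(1,x)`, respectively `R(x,1)`; they have no pole at `x = 0`. It is computed in the field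
`K((x))`. -/
noncomputable def RCoeff (n : ℕ) (p : K) (d : Dir) (k : ℕ) : Mat2 n K :=
  let x : LaurentSeries K := HahnSeries.single 1 1
  let R : Mat2 n (LaurentSeries K) :=
    match d with
    | .vOverU => RMat n (HahnSeries.C p) 1 x
    | .uOverV => RMat n (HahnSeries.C p) x 1
  R.map fun y => y.coeff (k : ℤ)

/-- The term `R_k x^k` of the expansion carries the monomial `u^{-e} v^{e}` with `e = ± k`. -/
def Dir.exponent (d : Dir) (k : ℕ) : ℤ :=
  match d with
  | .vOverU => k
  | .uOverV => -k

/-- Which expansions are used for the relation between `L^μ(u)` and `L^ρ(v)`: powers of `v/u` for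
`(+,-)`, powers of `u/v` for `(-,+)`, and either of them for `μ = ρ`. -/
def Dir.Admissible : Dir → Sgn → Sgn → Prop
  | .vOverU, .minus, .plus => False
  | .uOverV, .plus, .minus => False
  | _, _, _ => True

variable {A : Type*} [Ring A] [Algebra K A]

/-- An L-operator `L^±(u)`: an `N × N` matrix, `N = 2n`, of power series over `A`, where the formal
variable `X` stands for `u⁻¹` if the sign is `+`, and for `u` if the sign is `-`. -/
abbrev LOp (n : ℕ) (A : Type*) := Sgn → Matrix (Fin (2 * n)) (Fin (2 * n)) A⟦X⟧

/-- The matrix coefficient of `u ^ a`, `a ∈ ℤ`, in `L^μ(u)`. -/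
noncomputable def LOp.mode {n : ℕ} (L : LOp n A) (μ : Sgn) (a : ℤ) : Matrix (Fin (2 * n)) (Fin (2 * n)) A :=
  (L μ).map fun s =>
    match μ with
    | .plus => if a ≤ 0 then PowerSeries.coeff (-a).toNat s else 0
    | .minus => if 0 ≤ a then PowerSeries.coeff a.toNat s else 0

/-- The coefficient of `u ^ a v ^ b` in `R(u,v) (L^μ(u) ⊗ 1) (1 ⊗ L^ρ(v))`.  For an admissible
expansion the terms with `k > |a|` and `k > |b|` vanish, so the sum over `k ≤ |a| + |b|` is the sum
over all `k ≥ 0`. -/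
noncomputable def rllLeft {n : ℕ} (p : K) (d : Dir) (L : LOp n A) (μ ρ : Sgn) (a b : ℤ) :
    Mat2 n A :=
  ∑ k ∈ Finset.range (a.natAbs + b.natAbs + 1),
    (RCoeff n p d k).map (algebraMap K A) * (L.mode μ (a + d.exponent k) ⊗ₖ 1) *
      (1 ⊗ₖ L.mode ρ (b - d.exponent k))

/-- The coefficient of `u ^ a v ^ b` in `(1 ⊗ L^ρ(v)) (L^μ(u) ⊗ 1) R(u,v)`. -/
noncomputable def rllRight {n : ℕ} (p : K) (d : Dir) (L : LOp n A) (μ ρ : Sgn) (a b : ℤ) :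
    Mat2 n A :=
  ∑ k ∈ Finset.range (a.natAbs + b.natAbs + 1),
    (1 ⊗ₖ L.mode ρ (b - d.exponent k)) * (L.mode μ (a + d.exponent k) ⊗ₖ 1) *
      (RCoeff n p d k).map (algebraMap K A)

/-- The RLL relations
`R(u,v) (L^μ(u) ⊗ 1) (1 ⊗ L^ρ(v)) = (1 ⊗ L^ρ(v)) (L^μ(u) ⊗ 1) R(u,v)`, `μ, ρ = ±`,
with the R-matrix `R^{(n)}`. -/
def RLL {n : ℕ} (p : K) (L : LOp n A) : Prop :=
  ∀ (d : Dir) (μ ρ : Sgn), d.Admissible μ ρ →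
    ∀ a b : ℤ, rllLeft p d L μ ρ a b = rllRight p d L μ ρ a b

/-- The relations on the zero modes `L^±_{ij}[0]`. -/
structure ZeroModes {n : ℕ} (L : LOp n A) : Prop where
  plus : ∀ i j, i < j → PowerSeries.constantCoeff (L .plus j i) = 0
  minus : ∀ i j, i < j → PowerSeries.constantCoeff (L .minus i j) = 0
  plus_mul_minus : ∀ i,
    PowerSeries.constantCoeff (L .plus i i) * PowerSeries.constantCoeff (L .minus i i) = 1
  minus_mul_plus : ∀ i,
    PowerSeries.constantCoeff (L .minus i i) * PowerSeries.constantCoeff (L .plus i i) = 1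

/-! ## The algebra `U_q(D_n^{(2)})` -/

/-- The generators `L^±_{ij}[±m]`, `m ≥ 0`, are labelled by `(±, i, j, m)`. -/
abbrev Gen (n : ℕ) := Sgn × Fin (2 * n) × Fin (2 * n) × ℕ

/-- The L-operators of free generators. -/
noncomputable def freeL (K : Type*) [Field K] (n : ℕ) : LOp n (FreeAlgebra K (Gen n)) :=
  fun μ => Matrix.of fun i j => PowerSeries.mk fun m => FreeAlgebra.ι K (μ, i, j, m)

/-- The defining relations of `U_q(D_n^{(2)})`: the zero mode relations and the RLL relations. -/
inductive Rel (n : ℕ) (p : K) : FreeAlgebra K (Gen n) → FreeAlgebra K (Gen n) → Prop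
  | plus (i j : Fin (2 * n)) (h : i < j) : Rel n p (FreeAlgebra.ι K (.plus, j, i, 0)) 0
  | minus (i j : Fin (2 * n)) (h : i < j) : Rel n p (FreeAlgebra.ι K (.minus, i, j, 0)) 0
  | plus_mul_minus (i : Fin (2 * n)) :
      Rel n p (FreeAlgebra.ι K (.plus, i, i, 0) * FreeAlgebra.ι K (.minus, i, i, 0)) 1
  | minus_mul_plus (i : Fin (2 * n)) :
      Rel n p (FreeAlgebra.ι K (.minus, i, i, 0) * FreeAlgebra.ι K (.plus, i, i, 0)) 1
  | rll (d : Dir) (μ ρ : Sgn) (h : d.Admissible μ ρ) (a b : ℤ)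
      (r s : Fin (2 * n) × Fin (2 * n)) :
      Rel n p (rllLeft p d (freeL K n) μ ρ a b r s) (rllRight p d (freeL K n) μ ρ a b r s)

/-- The algebra `U_q(D_n^{(2)})`, `q = p ^ 4`. -/
abbrev Uq (n : ℕ) (p : K) := RingQuot (Rel n p)

/-- The fundamental L-operators of `U_q(D_n^{(2)})`. -/
noncomputable def Uq.L (n : ℕ) (p : K) : LOp n (Uq n p) :=
  fun μ => Matrix.of fun i j => PowerSeries.mk fun m =>
    RingQuot.mkAlgHom K (Rel n p) (FreeAlgebra.ι K (μ, i, j, m))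

/-! ## The reduced L-operators -/

/-- The index `1` of `{1, …, 2(n+1)}`. -/
def firstIdx (n : ℕ) : Fin (2 * (n + 1)) := ⟨0, by omega⟩

/-- The identification of `{1, …, 2n}` with the set of indices `1 < i < 2(n+1)`. -/
def innerIdx (n : ℕ) (i : Fin (2 * n)) : Fin (2 * (n + 1)) := ⟨i + 1, by omega⟩

/-- `M^±_{ij}(u) = L^±_{ij}(u) - L^±_{1j}(u) L^±_{11}(u)⁻¹ L^±_{i1}(u)` for `1 < i, j < 2(n+1)`. -/
noncomputable def reducedL {n : ℕ} (L : LOp (n + 1) A) : LOp n A :=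
  fun μ => Matrix.of fun i j =>
    L μ (innerIdx n i) (innerIdx n j) -
      L μ (firstIdx n) (innerIdx n j) * Ring.inverse (L μ (firstIdx n) (firstIdx n)) *
        L μ (innerIdx n i) (firstIdx n)

end RLL

end TwistedD

open TwistedD

/-! Write n + 1 for the larger rank. Give the first, the inner and the last basis vectors the
degrees 1, 0, -1. The R-matrix preserves the total degree on the tensor square, and its part of
total degree zero lives on e_1 ⊗ e_{1'}, on the inner e_i ⊗ e_j and on e_{1'} ⊗ e_1. Factor each
L-operator as F D E, with block unitriangular F and E and block diagonal D; the middle block of D is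
M. Suitable row and column combinations turn the degree-zero part of the RLL relation into a system
that is triangular with respect to the inner block b and the line c spanned by e_{1'} ⊗ e_1.
Eliminating c leaves the RLL relation for M, with R replaced by the Schur complement R_bb - R_bc
R_cc⁻¹ R_cb (`gauss_intertwine`). The order of the factors in M is that of a Schur complement over
the opposite ring, so the elimination is carried out there (`RLLEntries.reduced`).

It remains to see that this Schur complement is the R-matrix of rank n. Put w = vξ/u. If u, v, w are
treated as independent, the inner entries of Jimbo's matrix do not depend on the rank, and its Schur
complement is Jimbo's matrix at q w conjugated by T ⊗ T, where T = `rankTwist` is the identity off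
the middle and has the eigenvalues 1 and q^{-1/2} on e_n ± e_{n+1} (`schurPar_mul`). Lowering the
rank multiplies ξ by q, so q w is the parameter of rank n; and the twists 𝕌 of the two ranks differ
exactly by T. Hence for the twisted matrices the conjugation disappears (`schurR_RMat`).

The formal series are handled by embedding R and both L-operators, for each admissible expansion,
into one ring of double power series (`exists_expansion`, `rll_iff`), so that RLL becomes a matrix
identity over a ring. The zero mode relations make the constant terms of L and M triangular with
invertible diagonal, which supplies the inverses needed for the Gauss factorisation. Part (b) is the
universal property of the presentation, applied to M. -/

namespace TwistedD

/-! ### Gauss factorisation and elimination in an abstract ring with idempotents. -/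

section GaussRing

variable {S : Type*} [Ring S]

/-- Three orthogonal idempotents with sum `1`. -/
structure IdemTriple (ep ez em : S) : Prop where
  sum_eq : ep + ez + em = 1
  pp : ep * ep = ep
  zz : ez * ez = ez
  mm : em * em = em
  pz : ep * ez = 0
  zp : ez * ep = 0
  pm : ep * em = 0
  mp : em * ep = 0
  zm : ez * em = 0
  mz : em * ez = 0

/-- A factorisation `L = F D E` into a lower unitriangular, a diagonal and an upper unitriangular
factor with respect to three idempotents; `F'` and `E'` are the inverses of `F` and `E`, and `m` is
the inverse of the middle diagonal block. -/
structure GaussFact (ep ez em L F F' D E E' m : S) : Prop where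
  eq : L = F * D * E
  inv_F : F' * F = 1
  E_inv : E * E' = 1
  pF : ep * F = ep
  Fm : F * em = em
  zFz : ez * F * ez = ez
  pF' : ep * F' = ep
  F'm : F' * em = em
  zF'z : ez * F' * ez = ez
  Ep : E * ep = ep
  mE : em * E = em
  zEz : ez * E * ez = ez
  E'p : E' * ep = ep
  mE' : em * E' = em
  zE'z : ez * E' * ez = ez
  pD : ep * D = D * ep
  zD : ez * D = D * ez
  mD : em * D = D * em
  m_D : m * D = ez
  D_m : D * m = ez
  z_m : ez * m = m
  m_z : m * ez = m

theorem IdemTriple.split_right {ep ez em : S} (h : IdemTriple ep ez em) (x : S) :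
    x = x * ep + x * ez + x * em := by
  rw [← mul_add, ← mul_add, h.sum_eq, mul_one]

/-- One step of Gauss elimination with respect to an idempotent. -/
theorem gauss_step {e L k : S} (he : e * e = e) (hek : e * k = k) (hke : k * e = k)
    (hkL : k * L * e = e) (hLk : e * L * k = e) :
    L = (1 + (1 - e) * L * k) * (e * L * e + (1 - e) * (L - L * k * L) * (1 - e)) *
      (1 + k * L * (1 - e)) := by
  have h1 : (1 + (1 - e) * L * k) * (e * L * e) = L * e := by
    have : L * k * e * L * e = L * e := by
      rw [mul_assoc L k e, hke, mul_assoc L k L, mul_assoc L, hkL]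
    have h2 : e * L * k * e * L * e = e * L * e := by
      rw [hLk, he]
    calc (1 + (1 - e) * L * k) * (e * L * e)
        = e * L * e + L * k * e * L * e - e * L * k * e * L * e := by noncomm_ring
      _ = L * e := by rw [this, h2]; abel
  have h3 : (1 + (1 - e) * L * k) * ((1 - e) * (L - L * k * L) * (1 - e)) =
      (1 - e) * (L - L * k * L) * (1 - e) := by
    have : k * (1 - e) = 0 := by rw [mul_sub, hke, mul_one, sub_self]
    calc _ = (1 - e) * (L - L * k * L) * (1 - e) +
          (1 - e) * L * (k * (1 - e)) * (L - L * k * L) * (1 - e) := by noncomm_ring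
      _ = _ := by rw [this]; noncomm_ring
  have h4 : (1 - e) * (L - L * k * L) * (1 - e) = (L - L * k * L) * (1 - e) := by
    have : e * L * k * L = e * L := by rw [hLk]
    calc _ = (L - L * k * L) * (1 - e) - (e * L - e * L * k * L) * (1 - e) := by noncomm_ring
      _ = _ := by rw [this]; noncomm_ring
  have h5 : (1 - e) * k = 0 := by rw [sub_mul, hek, one_mul, sub_self]
  rw [mul_add (1 + (1 - e) * L * k), h1, h3, h4]
  calc L = L * e + (L - L * k * L) * (1 - e) + L * k * L * (1 - e) := by noncomm_ring
    _ = L * e + (L - L * k * L) * (1 - e) + L * (e * k) * L * (1 - e) +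
        (L - L * k * L) * ((1 - e) * k) * L * (1 - e) := by rw [h5, hek]; noncomm_ring
    _ = _ := by noncomm_ring

/-- The factor x starts at `ep`, while y starts at `ez` and does not reach `ep`; hence x y = 0 and
the product is 1 + x + y with x + y strictly lower. The three companions below treat the upper
factors and the inverses in the same way. -/
theorem lower_unip {ep ez em x y : S} (h : IdemTriple ep ez em) (px : ep * x = 0)
    (xp : x * ep = x) (zy : ez * y = 0) (yz : y * ez = y) (py : ep * y = 0) :
    ep * ((1 + x) * (1 + y)) = ep ∧ (1 + x) * (1 + y) * em = em ∧
    ez * ((1 + x) * (1 + y)) * ez = ez := by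
  have xy : x * y = 0 := by linear_combination (norm := noncomm_ring) x * py - xp * y
  refine ⟨?_, ?_, ?_⟩
  · linear_combination (norm := noncomm_ring) px * (1 + y) + py
  · have : x * em = 0 := by linear_combination (norm := noncomm_ring) x * h.pm - xp * em
    have : y * em = 0 := by linear_combination (norm := noncomm_ring) y * h.zm - yz * em
    linear_combination (norm := noncomm_ring) (1 + x) * this + ‹x * em = 0›
  · have : x * ez = 0 := by linear_combination (norm := noncomm_ring) x * h.pz - xp * ez
    linear_combination (norm := noncomm_ring) h.zz + zy * ez + ez * this + ez * xy * ez

theorem upper_unip {ep ez em u v : S} (h : IdemTriple ep ez em) (pu : u * ep = 0)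
    (up : ep * u = u) (zv : v * ez = 0) (vz : ez * v = v) (pv : v * ep = 0) :
    (1 + v) * (1 + u) * ep = ep ∧ em * ((1 + v) * (1 + u)) = em ∧
    ez * ((1 + v) * (1 + u)) * ez = ez := by
  have vu : v * u = 0 := by linear_combination (norm := noncomm_ring) pv * u - v * up
  refine ⟨?_, ?_, ?_⟩
  · linear_combination (norm := noncomm_ring) (1 + v) * pu + pv
  · have : em * u = 0 := by linear_combination (norm := noncomm_ring) h.mp * u - em * up
    have : em * v = 0 := by linear_combination (norm := noncomm_ring) h.mz * v - em * vz
    linear_combination (norm := noncomm_ring) this * (1 + u) + ‹em * u = 0›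
  · have : ez * u = 0 := by linear_combination (norm := noncomm_ring) h.zp * u - ez * up
    linear_combination (norm := noncomm_ring) h.zz + ez * zv + this * ez + ez * vu * ez

theorem lower_unip_inv {ep ez em x y : S} (h : IdemTriple ep ez em) (px : ep * x = 0)
    (xp : x * ep = x) (zy : ez * y = 0) (yz : y * ez = y) (py : ep * y = 0) :
    ep * ((1 - y) * (1 - x)) = ep ∧ (1 - y) * (1 - x) * em = em ∧
    ez * ((1 - y) * (1 - x)) * ez = ez := by
  refine ⟨?_, ?_, ?_⟩
  · linear_combination (norm := noncomm_ring) - px - py * (1 - x)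
  · have : x * em = 0 := by linear_combination (norm := noncomm_ring) x * h.pm - xp * em
    have : y * em = 0 := by linear_combination (norm := noncomm_ring) y * h.zm - yz * em
    linear_combination (norm := noncomm_ring) - this - (1 - y) * ‹x * em = 0›
  · have : x * ez = 0 := by linear_combination (norm := noncomm_ring) x * h.pz - xp * ez
    linear_combination (norm := noncomm_ring) h.zz - zy * ez - ez * (1 - y) * this

theorem upper_unip_inv {ep ez em u v : S} (h : IdemTriple ep ez em) (pu : u * ep = 0)
    (up : ep * u = u) (zv : v * ez = 0) (vz : ez * v = v) (pv : v * ep = 0) :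
    (1 - u) * (1 - v) * ep = ep ∧ em * ((1 - u) * (1 - v)) = em ∧
    ez * ((1 - u) * (1 - v)) * ez = ez := by
  refine ⟨?_, ?_, ?_⟩
  · linear_combination (norm := noncomm_ring) - pu - (1 - u) * pv
  · have : em * u = 0 := by linear_combination (norm := noncomm_ring) h.mp * u - em * up
    have : em * v = 0 := by linear_combination (norm := noncomm_ring) h.mz * v - em * vz
    linear_combination (norm := noncomm_ring) - this - ‹em * u = 0› * (1 - v)
  · have : ez * u = 0 := by linear_combination (norm := noncomm_ring) h.zp * u - ez * up
    linear_combination (norm := noncomm_ring) h.zz - ez * zv - this * (1 - v) * ez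

/-- Existence of the Gauss factorisation; the middle block is the Schur complement. -/
theorem exists_gaussFact {ep ez em L k m : S} (h : IdemTriple ep ez em)
    (pk : ep * k = k) (kp : k * ep = k) (kL : k * L * ep = ep) (Lk : ep * L * k = ep)
    (zm : ez * m = m) (mz : m * ez = m)
    (mN : m * (L - L * k * L) * ez = ez) (Nm : ez * (L - L * k * L) * m = ez) :
    ∃ F F' D E E' : S, GaussFact ep ez em L F F' D E E' m ∧
      ez * D * ez = ez * (L - L * k * L) * ez := by
  obtain ⟨N, hN⟩ : ∃ N, N = L - L * k * L := ⟨_, rfl⟩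
  rw [← hN] at mN Nm ⊢
  have mp : m * ep = 0 := by linear_combination (norm := noncomm_ring) m * h.zp - mz * ep
  have pm : ep * m = 0 := by linear_combination (norm := noncomm_ring) h.pz * m - ep * zm
  have g1 := gauss_step h.pp pk kp kL Lk
  rw [← hN] at g1
  obtain ⟨L1, hL1⟩ : ∃ L1, L1 = ep * L * ep + (1 - ep) * N * (1 - ep) := ⟨_, rfl⟩
  rw [← hL1] at g1
  have pL1 : ep * L1 = ep * L * ep := by
    rw [hL1]
    linear_combination (norm := noncomm_ring) h.pp * L * ep - h.pp * N * (1 - ep)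
  have L1p : L1 * ep = ep * L * ep := by
    rw [hL1]
    linear_combination (norm := noncomm_ring) ep * L * h.pp - (1 - ep) * N * h.pp
  have mL1 : m * L1 * ez = ez := by
    rw [hL1]
    linear_combination (norm := noncomm_ring) mN + m * ep * L * h.pz - mp * N * (1 - ep) * ez -
      m * N * h.pz
  have L1m : ez * L1 * m = ez := by
    rw [hL1]
    linear_combination (norm := noncomm_ring) Nm + h.zp * L * ep * m - h.zp * N * (1 - ep) * m -
      ez * N * pm
  have pLm : ep * L1 * m = 0 := by
    linear_combination (norm := noncomm_ring) pL1 * m + ep * L * pm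
  have mLp : m * L1 * ep = 0 := by
    linear_combination (norm := noncomm_ring) m * L1p + mp * L * ep
  -- After `ep` has been split off, a second elimination at `ez` makes the matrix block diagonal for
  -- all three idempotents. The last block is never inverted.
  have g2 := gauss_step h.zz zm mz mL1 L1m
  obtain ⟨D, hD⟩ : ∃ D, D = ez * L1 * ez + (1 - ez) * (L1 - L1 * m * L1) * (1 - ez) := ⟨_, rfl⟩
  rw [← hD] at g2
  obtain ⟨x, hx⟩ : ∃ x, x = (1 - ep) * L * k := ⟨_, rfl⟩
  obtain ⟨u, hu⟩ : ∃ u, u = k * L * (1 - ep) := ⟨_, rfl⟩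
  obtain ⟨y, hy⟩ : ∃ y, y = (1 - ez) * L1 * m := ⟨_, rfl⟩
  obtain ⟨v, hv⟩ : ∃ v, v = m * L1 * (1 - ez) := ⟨_, rfl⟩
  rw [← hx, ← hu] at g1
  rw [← hy, ← hv] at g2
  have px : ep * x = 0 := by
    rw [hx]; linear_combination (norm := noncomm_ring) - h.pp * L * k
  have xp : x * ep = x := by
    rw [hx]; linear_combination (norm := noncomm_ring) (1 - ep) * L * kp
  have zy : ez * y = 0 := by
    rw [hy]; linear_combination (norm := noncomm_ring) - h.zz * L1 * m
  have yz : y * ez = y := by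
    rw [hy]; linear_combination (norm := noncomm_ring) (1 - ez) * L1 * mz
  have py : ep * y = 0 := by
    rw [hy]; linear_combination (norm := noncomm_ring) pLm - h.pz * L1 * m
  have up : u * ep = 0 := by
    rw [hu]; linear_combination (norm := noncomm_ring) - k * L * h.pp
  have pu : ep * u = u := by
    rw [hu]; linear_combination (norm := noncomm_ring) pk * L * (1 - ep)
  have vz : v * ez = 0 := by
    rw [hv]; linear_combination (norm := noncomm_ring) - m * L1 * h.zz
  have zv : ez * v = v := by
    rw [hv]; linear_combination (norm := noncomm_ring) zm * L1 * (1 - ez)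
  have vp : v * ep = 0 := by
    rw [hv]; linear_combination (norm := noncomm_ring) mLp - m * L1 * h.zp
  have xx : x * x = 0 := by linear_combination (norm := noncomm_ring) x * px - xp * x
  have yy : y * y = 0 := by linear_combination (norm := noncomm_ring) y * zy - yz * y
  have uu : u * u = 0 := by linear_combination (norm := noncomm_ring) up * u - u * pu
  have vv : v * v = 0 := by linear_combination (norm := noncomm_ring) vz * v - v * zv
  have pD : ep * D = ep * L * ep := by
    rw [hD]
    linear_combination (norm := noncomm_ring) pL1 * (1 - ez) + h.pz * L1 * ez
      - h.pz * (L1 - L1 * m * L1) * (1 - ez) - pLm * L1 * (1 - ez) - ep * L * h.pz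
  have Dp : D * ep = ep * L * ep := by
    rw [hD]
    linear_combination (norm := noncomm_ring) (1 - ez) * L1p + ez * L1 * h.zp
      - (1 - ez) * (L1 - L1 * m * L1) * h.zp - (1 - ez) * L1 * mLp - h.zp * L * ep
  have zD : ez * D = ez * L1 * ez := by
    rw [hD]
    linear_combination (norm := noncomm_ring)
      h.zz * L1 * ez - h.zz * (L1 - L1 * m * L1) * (1 - ez)
  have Dz : D * ez = ez * L1 * ez := by
    rw [hD]
    linear_combination (norm := noncomm_ring)
      ez * L1 * h.zz - (1 - ez) * (L1 - L1 * m * L1) * h.zz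
  obtain ⟨a1, a2, a3⟩ := lower_unip h px xp zy yz py
  obtain ⟨b1, b2, b3⟩ := lower_unip_inv h px xp zy yz py
  obtain ⟨c1, c2, c3⟩ := upper_unip h up pu vz zv vp
  obtain ⟨d1, d2, d3⟩ := upper_unip_inv h up pu vz zv vp
  refine ⟨(1 + x) * (1 + y), (1 - y) * (1 - x), D, (1 + v) * (1 + u), (1 - u) * (1 - v),
    ⟨?_, ?_, ?_, a1, a2, a3, b1, b2, b3, c1, c2, c3, d1, d2, d3, by rw [pD, Dp], by rw [zD, Dz],
      ?_, ?_, ?_, zm, mz⟩, ?_⟩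
  · linear_combination (norm := noncomm_ring) g1 + (1 + x) * g2 * (1 + u)
  · linear_combination (norm := noncomm_ring) - (1 - y) * xx * (1 + y) - yy
  · linear_combination (norm := noncomm_ring) - (1 + v) * uu * (1 - v) - vv
  · linear_combination (norm := noncomm_ring) h.sum_eq * D - D * h.sum_eq - pD + Dp - zD + Dz
  · linear_combination (norm := noncomm_ring) - mz * D + m * zD + mz * L1 * ez + mL1
  · linear_combination (norm := noncomm_ring) - D * zm + Dz * m + ez * L1 * zm + L1m
  · rw [zD, hL1]
    linear_combination (norm := noncomm_ring) ez * (ep * L * ep + (1 - ep) * N * (1 - ep)) * h.zz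
      + h.zp * L * ep * ez - h.zp * N * (1 - ep) * ez - ez * N * h.pz

theorem GaussFact.map {T : Type*} [Ring T] (φ : S →+* T) {ep ez em L F F' D E E' m : S}
    (g : GaussFact ep ez em L F F' D E E' m) :
    GaussFact (φ ep) (φ ez) (φ em) (φ L) (φ F) (φ F') (φ D) (φ E) (φ E') (φ m) := by
  constructor <;> simp only [← map_mul, ← map_one φ, g.eq, g.inv_F, g.E_inv, g.pF, g.Fm, g.zFz,
    g.pF', g.F'm, g.zF'z, g.Ep, g.mE, g.zEz, g.E'p, g.mE', g.zE'z, g.pD, g.zD, g.mD, g.m_D, g.D_m,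
    g.z_m, g.m_z]

theorem IdemTriple.map {T : Type*} [Ring T] (φ : S →+* T) {ep ez em : S}
    (h : IdemTriple ep ez em) : IdemTriple (φ ep) (φ ez) (φ em) := by
  constructor <;> simp only [← map_mul, ← map_add, ← map_one φ, ← map_zero φ, h.sum_eq, h.pp, h.zz,
    h.mm, h.pz, h.zp, h.pm, h.mp, h.zm, h.mz]

/-- An intertwining relation `G R = R G'` with `R` block diagonal restricts to the middle block for
row and column combinations that clear the off-diagonal blocks. -/
theorem intertwine_restrict {P Z M G G' R θ ξ : S} (h : IdemTriple P Z M)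
    (hZ : Z * R = R * Z) (hP : P * R = R * P)
    (hR : G * R = R * G') (h1 : θ * M = 0) (h2 : θ * G * P = 0) (h3 : M * ξ = 0)
    (h4 : P * (G' * ξ) = 0) :
    (θ * G * Z) * R * (Z * ξ) = (θ * Z) * R * (Z * (G' * ξ)) := by
  -- In θ G R ξ the P-part dies by θ G P = 0 and the M-part by M ξ = 0, since R respects the blocks.
  -- On the other side θ M = 0 and P G' ξ = 0 play these roles.
  have l : (θ * G * Z) * R * (Z * ξ) = θ * (G * R) * ξ := by
    linear_combination (norm := noncomm_ring) θ * G * hZ * Z * ξ + θ * G * R * h.zz * ξ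
      + θ * G * R * h.sum_eq * ξ - θ * G * R * h3 - θ * G * R * h.zz * ξ + θ * G * R * h.zz * ξ
      - h2 * R * ξ + θ * G * hP * ξ
  have r : (θ * Z) * R * (Z * (G' * ξ)) = θ * (R * G') * ξ := by
    linear_combination (norm := noncomm_ring) - θ * Z * hZ * G' * ξ + θ * h.zz * R * G' * ξ
      + θ * h.sum_eq * R * G' * ξ - h1 * R * G' * ξ - θ * R * h4 - θ * hP * G' * ξ
  rw [l, r, hR]

/-- The elements of a ring that are built from two commuting idempotent triples: the block of
positive, zero and negative total degree. -/
theorem IdemTriple.total {ep ez em fp fz fm : S} (he : IdemTriple ep ez em)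
    (hf : IdemTriple fp fz fm) (h : ∀ e ∈ ({ep, ez, em} : Set S), ∀ f ∈ ({fp, fz, fm} : Set S),
      f * e = e * f) :
    IdemTriple (ep * fp + ep * fz + ez * fp) (ep * fm + ez * fz + em * fp)
      (em * fm + em * fz + ez * fm) := by
  have key : ∀ e ∈ ({ep, ez, em} : Set S), ∀ f ∈ ({fp, fz, fm} : Set S), ∀ x,
      f * (e * x) = e * (f * x) := by
    intro e he f hf x
    rw [← mul_assoc, h e he f hf, mul_assoc]
  have ra : ∀ {a b c : S}, a * b = c → ∀ x, a * (b * x) = c * x := by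
    intro a b c h x; rw [← mul_assoc, h]
  have hh1 := key ep (by simp) fp (by simp)
  have hh2 := key ep (by simp) fz (by simp)
  have hh3 := key ep (by simp) fm (by simp)
  have hh4 := key ez (by simp) fp (by simp)
  have hh5 := key ez (by simp) fz (by simp)
  have hh6 := key ez (by simp) fm (by simp)
  have hh7 := key em (by simp) fp (by simp)
  have hh8 := key em (by simp) fz (by simp)
  have hh9 := key em (by simp) fm (by simp)
  refine ⟨by linear_combination (norm := noncomm_ring) he.sum_eq * (fp + fz + fm) + hf.sum_eq,
    ?_, ?_, ?_, ?_, ?_, ?_, ?_, ?_, ?_⟩ <;>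
  simp only [mul_add, add_mul, mul_assoc, hh1, hh2, hh3, hh4, hh5, hh6, hh7, hh8, hh9, ra he.pp,
    ra he.zz, ra he.mm, ra he.pz, ra he.zp, ra he.pm, ra he.mp, ra he.zm, ra he.mz,
    hf.pp, hf.zz, hf.mm, hf.pz, hf.zp, hf.pm, hf.mp, hf.zm, hf.mz, zero_mul, mul_zero, add_zero,
    zero_add]

/-- Left combinations adapted to a product `L₁ L₂` of two factorised elements, for the middle
block. -/
theorem row_mid {ep ez em fp fz fm L1 F1 F1' D1 E1 E1' m1 L2 F2 F2' D2 E2 E2' m2 : S}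
    (he : IdemTriple ep ez em) (hf : IdemTriple fp fz fm)
    (g1 : GaussFact ep ez em L1 F1 F1' D1 E1 E1' m1)
    (g2 : GaussFact fp fz fm L2 F2 F2' D2 E2 E2' m2)
    (fe : ∀ e ∈ ({ep, ez, em} : Set S), ∀ f ∈ ({fp, fz, fm} : Set S), f * e = e * f)
    (f1 : ∀ f ∈ ({fp, fz, fm} : Set S), f * F1' = F1' * f ∧ f * D1 = D1 * f ∧ f * m1 = m1 * f)
    (e2 : ∀ e ∈ ({ep, ez, em} : Set S), e * F2' = F2' * e ∧ e * D2 = D2 * e ∧ e * E2 = E2 * e ∧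
      e * L2 = L2 * e) :
    ∃ θ Q, θ * (em * fm + em * fz + ez * fm) = 0 ∧
      θ * (ep * fm + ez * fz + em * fp) = ez * fz ∧
      θ * (L1 * L2) * (ep * fp + ep * fz + ez * fp) = 0 ∧
      θ * (L1 * L2) * (ep * fm + ez * fz + em * fp) = D1 * (ez * fz) * D2 + Q * (em * fp) := by
  -- `F1'` and `F2'` cancel the lower factors of `L1` and `L2`, `m1` cancels the middle block of
  -- `D1`, and the leading `D1` restores it, so that the inner component of θ is exactly `ez * fz`.
  obtain ⟨θ, hθ⟩ : ∃ θ, θ = D1 * fz * F2' * m1 * F1' := ⟨_, rfl⟩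
  have θm : θ * em = 0 := by
    rw [hθ]
    linear_combination (norm := noncomm_ring) D1 * fz * F2' * m1 * g1.F'm
      - D1 * fz * F2' * g1.m_z * em + D1 * fz * F2' * m1 * he.zm
  have F2'z : fz * F2' * fm = 0 := by
    linear_combination (norm := noncomm_ring) fz * g2.F'm + hf.zm
  have θfm : θ * fm = 0 := by
    obtain ⟨h1, -, h3⟩ := f1 fm (by simp)
    rw [hθ]
    linear_combination (norm := noncomm_ring) - D1 * fz * F2' * m1 * h1
      - D1 * fz * F2' * h3 * F1' + D1 * F2'z * m1 * F1'
  have θb : θ * (ez * fz) = ez * fz := by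
    obtain ⟨h1, h2, h3⟩ := f1 fz (by simp)
    have h4 := fe ez (by simp) fz (by simp)
    have : m1 * F1' * ez = m1 := by
      linear_combination (norm := noncomm_ring) m1 * g1.zF'z + g1.m_z - g1.m_z * F1' * ez
    calc θ * (ez * fz) = D1 * (fz * F2') * (m1 * F1' * ez) * fz := by
          rw [hθ]; noncomm_ring
      _ = D1 * (fz * F2' * fz) * m1 := by rw [this]; simp only [mul_assoc, h3]
      _ = D1 * m1 * fz := by rw [g2.zF'z, mul_assoc, h3, ← mul_assoc]
      _ = ez * fz := by rw [g1.D_m]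
  -- The upper factor `E1` leaves one uncontrolled term ending in `em`. In total degree zero `em`
  -- only meets `fp`, so it becomes the summand `Q * (em * fp)`.
  have θG : θ * (L1 * L2) = D1 * ez * fz * D2 * E2 + D1 * fz * F2' * ez * E1 * L2 * em := by
    have zE : ez * E1 = ez + ez * E1 * em := by
      linear_combination (norm := noncomm_ring) he.split_right (ez * E1) + ez * g1.Ep + he.zp
        + g1.zEz
    obtain ⟨h1, -, -, -⟩ := e2 ez (by simp)
    obtain ⟨-, -, -, h2⟩ := e2 em (by simp)
    have h3 := fe ez (by simp) fz (by simp)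
    have h5 : F2' * L2 = D2 * E2 := by
      rw [g2.eq]
      linear_combination (norm := noncomm_ring) g2.inv_F * D2 * E2
    calc θ * (L1 * L2) = D1 * fz * F2' * (m1 * ((F1' * F1) * D1)) * E1 * L2 := by
          rw [hθ, g1.eq]; noncomm_ring
      _ = D1 * fz * F2' * (ez * E1) * L2 := by
          rw [g1.inv_F, one_mul, g1.m_D]; noncomm_ring
      _ = D1 * fz * (F2' * ez) * L2 + D1 * fz * F2' * ez * E1 * (em * L2) := by
          rw [zE]; noncomm_ring
      _ = D1 * (fz * ez) * (F2' * L2) + D1 * fz * F2' * ez * E1 * (em * L2) := by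
          rw [← h1]; noncomm_ring
      _ = _ := by rw [h3, h5, h2]; noncomm_ring
  have zE2p : fz * (D2 * E2) * fp = 0 := by
    linear_combination (norm := noncomm_ring) fz * D2 * g2.Ep + g2.zD * fp + D2 * hf.zp
  have zE2z : fz * (D2 * E2) * fz = fz * D2 := by
    linear_combination (norm := noncomm_ring) g2.zD * E2 * fz + D2 * g2.zEz - g2.zD
  have edE : ∀ e ∈ ({ep, ez, em} : Set S), D2 * E2 * e = e * (D2 * E2) := by
    intro e h
    obtain ⟨-, h1, h2, -⟩ := e2 e h
    linear_combination (norm := noncomm_ring) - h1 * E2 - D2 * h2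
  refine ⟨θ, D1 * fz * F2' * ez * E1 * L2, ?_, ?_, ?_, ?_⟩
  · have h2 := fe ez (by simp) fm (by simp)
    linear_combination (norm := noncomm_ring) θm * fm + θm * fz - θ * h2 + θfm * ez
  · have h2 := fe ep (by simp) fm (by simp)
    linear_combination (norm := noncomm_ring) θm * fp + θb - θ * h2 + θfm * ep
  · have h1 := fe ep (by simp) fz (by simp)
    have h2 := fe ep (by simp) fp (by simp)
    have h3 := fe ez (by simp) fp (by simp)
    have h1' := fe ez (by simp) fz (by simp)
    have h4 := edE ep (by simp)
    have h5 := edE ez (by simp)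
    rw [θG]
    calc _ = D1 * ez * fz * (D2 * E2 * ep) * (fp + fz) + D1 * ez * fz * (D2 * E2 * ez) * fp +
          D1 * fz * F2' * ez * E1 * L2 * (em * ep * (fp + fz) + em * ez * fp) := by noncomm_ring
      _ = D1 * ez * (fz * ep) * (D2 * E2) * (fp + fz) +
          D1 * ez * (fz * ez) * (D2 * E2) * fp := by
          rw [h4, h5, he.mp, he.mz]; noncomm_ring
      _ = D1 * (ez * ep) * fz * (D2 * E2) * (fp + fz) +
          D1 * ez * ez * (fz * (D2 * E2) * fp) := by
          rw [h1, h1']; noncomm_ring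
      _ = 0 := by rw [he.zp, zE2p]; noncomm_ring
  · have h1 := fe ep (by simp) fz (by simp)
    have h1' := fe ez (by simp) fz (by simp)
    have h1'' := fe em (by simp) fz (by simp)
    rw [θG]
    calc _ = D1 * ez * fz * (D2 * E2 * ep) * fm + D1 * ez * fz * (D2 * E2 * ez) * fz +
          D1 * ez * fz * (D2 * E2 * em) * fp +
          D1 * fz * F2' * ez * E1 * L2 * (em * ep * fm + em * ez * fz + em * em * fp) := by
            noncomm_ring
      _ = D1 * ez * (fz * ep) * (D2 * E2) * fm + D1 * ez * (fz * ez) * (D2 * E2) * fz +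
          D1 * ez * (fz * em) * (D2 * E2) * fp +
          D1 * fz * F2' * ez * E1 * L2 * (em * fp) := by
          rw [edE ep (by simp), edE ez (by simp), edE em (by simp), he.mp, he.mz, he.mm]
          noncomm_ring
      _ = D1 * (ez * ep) * fz * (D2 * E2) * fm + D1 * (ez * ez) * (fz * (D2 * E2) * fz) +
          D1 * (ez * em) * fz * (D2 * E2) * fp +
          D1 * fz * F2' * ez * E1 * L2 * (em * fp) := by
          rw [h1, h1', h1'']; noncomm_ring
      _ = _ := by rw [he.zp, he.zz, he.zm, zE2z]; noncomm_ring

/-- On the component `em * fp` the factor `E1` acts trivially from the `em` side and `F2` from the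
`fp` side; clearing `F1` is enough, and no error term like the `Q` of `row_mid` arises. -/
theorem row_low {ep ez em fp fz fm L1 F1 F1' D1 E1 E1' m1 L2 F2 F2' D2 E2 E2' m2 : S}
    (he : IdemTriple ep ez em) (hf : IdemTriple fp fz fm)
    (g1 : GaussFact ep ez em L1 F1 F1' D1 E1 E1' m1)
    (g2 : GaussFact fp fz fm L2 F2 F2' D2 E2 E2' m2)
    (fe : ∀ e ∈ ({ep, ez, em} : Set S), ∀ f ∈ ({fp, fz, fm} : Set S), f * e = e * f)
    (f1 : ∀ f ∈ ({fp, fz, fm} : Set S), f * F1' = F1' * f ∧ f * D1 = D1 * f)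
    (e2 : ∀ e ∈ ({ep, ez, em} : Set S), e * D2 = D2 * e ∧ e * E2 = E2 * e ∧ e * L2 = L2 * e) :
    ∃ θ, θ * (em * fm + em * fz + ez * fm) = 0 ∧
      θ * (ep * fm + ez * fz + em * fp) = em * fp ∧
      θ * (L1 * L2) * (ep * fp + ep * fz + ez * fp) = 0 ∧
      θ * (L1 * L2) * (ep * fm + ez * fz + em * fp) = D1 * D2 * (em * fp) := by
  obtain ⟨θ, hθ⟩ : ∃ θ, θ = em * fp * F1' := ⟨_, rfl⟩
  have θf : θ * fz = 0 ∧ θ * fm = 0 := by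
    constructor
    · rw [hθ]
      linear_combination (norm := noncomm_ring) - em * fp * (f1 fz (by simp)).1
        + em * hf.pz * F1'
    · rw [hθ]
      linear_combination (norm := noncomm_ring) - em * fp * (f1 fm (by simp)).1
        + em * hf.pm * F1'
  have θe : θ * em = fp * em := by
    rw [hθ]
    linear_combination (norm := noncomm_ring) em * fp * g1.F'm - fe em (by simp) fp (by simp) * em
      + fp * he.mm
  have θG : θ * (L1 * L2) = D1 * D2 * em * fp * E2 := by
    have pL2 : fp * L2 = D2 * fp * E2 := by
      rw [g2.eq]
      linear_combination (norm := noncomm_ring) g2.pF * D2 * E2 + g2.pD * E2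
    calc θ * (L1 * L2) = em * fp * ((F1' * F1) * D1) * E1 * L2 := by
          rw [hθ, g1.eq]; noncomm_ring
      _ = em * (fp * D1) * E1 * L2 := by rw [g1.inv_F, one_mul]; noncomm_ring
      _ = (em * D1) * fp * E1 * L2 := by rw [(f1 fp (by simp)).2]; noncomm_ring
      _ = D1 * (fp * em) * E1 * L2 := by rw [g1.mD, fe em (by simp) fp (by simp)]; noncomm_ring
      _ = D1 * fp * (em * E1) * L2 := by noncomm_ring
      _ = D1 * fp * (em * L2) := by rw [g1.mE]; noncomm_ring
      _ = D1 * (fp * L2) * em := by rw [(e2 em (by simp)).2.2]; noncomm_ring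
      _ = D1 * D2 * fp * (E2 * em) := by rw [pL2]; noncomm_ring
      _ = D1 * D2 * (fp * em) * E2 := by rw [← (e2 em (by simp)).2.1]; noncomm_ring
      _ = _ := by rw [fe em (by simp) fp (by simp)]; noncomm_ring
  have θGe : θ * (L1 * L2) * ep = 0 ∧ θ * (L1 * L2) * ez = 0 ∧
      θ * (L1 * L2) * em = θ * (L1 * L2) := by
    have key : ∀ e ∈ ({ep, ez, em} : Set S), θ * (L1 * L2) * e = D1 * D2 * (em * e) * fp * E2 := by
      intro e h
      calc θ * (L1 * L2) * e = D1 * D2 * em * fp * (E2 * e) := by rw [θG]; noncomm_ring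
        _ = D1 * D2 * em * (fp * e) * E2 := by rw [← (e2 e h).2.1]; noncomm_ring
        _ = _ := by rw [fe e h fp (by simp)]; noncomm_ring
    refine ⟨?_, ?_, ?_⟩
    · rw [key ep (by simp), he.mp]; noncomm_ring
    · rw [key ez (by simp), he.mz]; noncomm_ring
    · rw [key em (by simp), he.mm, θG]
  obtain ⟨θGp, θGz, θGm⟩ := θGe
  refine ⟨θ, ?_, ?_, ?_, ?_⟩
  · have h1 := fe em (by simp) fm (by simp)
    have h2 := fe em (by simp) fz (by simp)
    have h3 := fe ez (by simp) fm (by simp)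
    linear_combination (norm := noncomm_ring) - θ * h1 - θ * h2 - θ * h3 + θf.2 * (em + ez) +
      θf.1 * em
  · have h1 := fe ep (by simp) fm (by simp)
    have h2 := fe ez (by simp) fz (by simp)
    have h3 := fe em (by simp) fp (by simp)
    linear_combination (norm := noncomm_ring) - θ * h1 - θ * h2 + θf.2 * ep + θf.1 * ez
      + θe * fp + h3 * fp + em * hf.pp
  · linear_combination (norm := noncomm_ring) θGp * (fp + fz) + θGz * fp
  · rw [mul_add, mul_add, ← mul_assoc, ← mul_assoc _ ez, ← mul_assoc _ em, θGp, θGz, θGm, θG]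
    linear_combination (norm := noncomm_ring) D1 * D2 * em * fp * g2.Ep + D1 * D2 * em * hf.pp

open MulOpposite in
-- Reversing the multiplication exchanges the lower and the upper factor. The one-sided conditions
-- F' F = 1 and E E' = 1 are exchanged as well, so the structure is self-dual and statements about
-- columns follow from those about rows.
theorem GaussFact.op {ep ez em L F F' D E E' m : S} (g : GaussFact ep ez em L F F' D E E' m) :
    GaussFact (op ep) (op ez) (op em) (op L) (op E) (op E') (op D) (op F) (op F') (op m) := by
  constructor <;> simp only [← op_mul, ← op_one, g.eq, g.inv_F, g.E_inv, g.pF, g.Fm,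
    g.pF', g.F'm, g.Ep, g.mE, g.E'p, g.mE', g.pD, g.zD, g.mD, g.m_D, g.D_m,
    g.z_m, g.m_z, mul_assoc]
  · rw [← mul_assoc, g.zEz]
  · rw [← mul_assoc, g.zE'z]
  · rw [← mul_assoc, g.zFz]
  · rw [← mul_assoc, g.zF'z]

open MulOpposite in
theorem IdemTriple.op {ep ez em : S} (h : IdemTriple ep ez em) :
    IdemTriple (op ep) (op ez) (op em) := by
  constructor <;> simp only [← op_mul, ← op_add, ← op_one, ← op_zero, h.sum_eq, h.pp, h.zz,
    h.mm, h.pz, h.zp, h.pm, h.mp, h.zm, h.mz]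

open MulOpposite in
/-- Right combinations adapted to a product `L₂ L₁`, for the middle block. -/
theorem col_mid {ep ez em fp fz fm L1 F1 F1' D1 E1 E1' m1 L2 F2 F2' D2 E2 E2' m2 : S}
    (he : IdemTriple ep ez em) (hf : IdemTriple fp fz fm)
    (g1 : GaussFact ep ez em L1 F1 F1' D1 E1 E1' m1)
    (g2 : GaussFact fp fz fm L2 F2 F2' D2 E2 E2' m2)
    (fe : ∀ e ∈ ({ep, ez, em} : Set S), ∀ f ∈ ({fp, fz, fm} : Set S), f * e = e * f)
    (f1 : ∀ f ∈ ({fp, fz, fm} : Set S), f * E1' = E1' * f ∧ f * D1 = D1 * f ∧ f * m1 = m1 * f)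
    (e2 : ∀ e ∈ ({ep, ez, em} : Set S), e * E2' = E2' * e ∧ e * D2 = D2 * e ∧ e * F2 = F2 * e ∧
      e * L2 = L2 * e) :
    ∃ ξ Q, (em * fm + em * fz + ez * fm) * ξ = 0 ∧
      (ep * fm + ez * fz + em * fp) * ξ = ez * fz ∧
      (ep * fp + ep * fz + ez * fp) * (L2 * L1 * ξ) = 0 ∧
      (ep * fm + ez * fz + em * fp) * (L2 * L1 * ξ) = D2 * (ez * fz) * D1 + (em * fp) * Q := by
  have fe' := fe
  have f1' := f1
  have e2' := e2
  simp only [Set.mem_insert_iff, Set.mem_singleton_iff, forall_eq_or_imp, forall_eq] at fe' f1' e2'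
  obtain ⟨θ, Q, h1, h2, h3, h4⟩ := row_mid he.op hf.op g1.op g2.op
    (by simpa [← op_mul, eq_comm] using fe') (by simpa [← op_mul, eq_comm] using f1')
    (by simpa [← op_mul, eq_comm] using e2')
  refine ⟨θ.unop, Q.unop, ?_, ?_, ?_, ?_⟩
  all_goals simp only [fe ep (by simp) fp (by simp), fe ep (by simp) fz (by simp),
    fe ep (by simp) fm (by simp), fe ez (by simp) fp (by simp), fe ez (by simp) fz (by simp),
    fe ez (by simp) fm (by simp), fe em (by simp) fp (by simp), fe em (by simp) fz (by simp),
    fe em (by simp) fm (by simp), ← op_mul, ← op_add, ← op_zero] at *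
  · exact congrArg unop h1
  · exact congrArg unop h2
  · exact congrArg unop h3
  · simpa [mul_assoc] using congrArg unop h4

open MulOpposite in
-- This is `row_low` in the opposite ring.
theorem col_low {ep ez em fp fz fm L1 F1 F1' D1 E1 E1' m1 L2 F2 F2' D2 E2 E2' m2 : S}
    (he : IdemTriple ep ez em) (hf : IdemTriple fp fz fm)
    (g1 : GaussFact ep ez em L1 F1 F1' D1 E1 E1' m1)
    (g2 : GaussFact fp fz fm L2 F2 F2' D2 E2 E2' m2)
    (fe : ∀ e ∈ ({ep, ez, em} : Set S), ∀ f ∈ ({fp, fz, fm} : Set S), f * e = e * f)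
    (f1 : ∀ f ∈ ({fp, fz, fm} : Set S), f * E1' = E1' * f ∧ f * D1 = D1 * f)
    (e2 : ∀ e ∈ ({ep, ez, em} : Set S), e * D2 = D2 * e ∧ e * F2 = F2 * e ∧ e * L2 = L2 * e) :
    ∃ ξ, (em * fm + em * fz + ez * fm) * ξ = 0 ∧
      (ep * fm + ez * fz + em * fp) * ξ = em * fp ∧
      (ep * fp + ep * fz + ez * fp) * (L2 * L1 * ξ) = 0 ∧
      (ep * fm + ez * fz + em * fp) * (L2 * L1 * ξ) = (em * fp) * (D2 * D1) := by
  have fe' := fe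
  have f1' := f1
  have e2' := e2
  simp only [Set.mem_insert_iff, Set.mem_singleton_iff, forall_eq_or_imp, forall_eq] at fe' f1' e2'
  obtain ⟨θ, h1, h2, h3, h4⟩ := row_low he.op hf.op g1.op g2.op
    (by simpa [← op_mul, eq_comm] using fe') (by simpa [← op_mul, eq_comm] using f1')
    (by simpa [← op_mul, eq_comm] using e2')
  refine ⟨θ.unop, ?_, ?_, ?_, ?_⟩
  all_goals simp only [fe ep (by simp) fp (by simp), fe ep (by simp) fz (by simp),
    fe ep (by simp) fm (by simp), fe ez (by simp) fp (by simp), fe ez (by simp) fz (by simp),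
    fe ez (by simp) fm (by simp), fe em (by simp) fp (by simp), fe em (by simp) fz (by simp),
    fe em (by simp) fm (by simp), ← op_mul, ← op_add, ← op_zero] at *
  · exact congrArg unop h1
  · exact congrArg unop h2
  · exact congrArg unop h3
  · simpa [mul_assoc] using congrArg unop h4

/-- If `L₁ L₂ R = R L₂ L₁` and `R` preserves the total degree, then the middle diagonal blocks of
the Gauss factorisations of `L₁` and `L₂` satisfy the same relation with the Schur complement
of `R`. -/
theorem gauss_intertwine {ep ez em fp fz fm : S}
    (he : IdemTriple ep ez em) (hf : IdemTriple fp fz fm)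
    {L₁ F₁ F₁' D₁ E₁ E₁' m₁ L₂ F₂ F₂' D₂ E₂ E₂' m₂ : S}
    (g₁ : GaussFact ep ez em L₁ F₁ F₁' D₁ E₁ E₁' m₁)
    (g₂ : GaussFact fp fz fm L₂ F₂ F₂' D₂ E₂ E₂' m₂)
    (fe : ∀ e ∈ ({ep, ez, em} : Set S), ∀ f ∈ ({fp, fz, fm} : Set S), f * e = e * f)
    (f1 : ∀ x ∈ ({F₁', D₁, E₁', m₁} : Set S), ∀ f ∈ ({fp, fz, fm} : Set S), f * x = x * f)
    (e2 : ∀ x ∈ ({L₂, F₂, F₂', D₂, E₂, E₂'} : Set S), ∀ e ∈ ({ep, ez, em} : Set S),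
      e * x = x * e) {R σ b c : S}
    (hb : b = ez * fz) (hc : c = em * fp)
    (hRp : (ep * fp + ep * fz + ez * fp) * R = R * (ep * fp + ep * fz + ez * fp))
    (hRz : (ep * fm + ez * fz + em * fp) * R = R * (ep * fm + ez * fz + em * fp))
    (hσc : σ * c = σ) (hcσ : c * σ = σ) (hRσ : c * R * σ = c) (hσR : σ * R * c = c)
    (h : L₁ * L₂ * R = R * (L₂ * L₁)) :
    D₁ * D₂ * (b * (R - R * σ * R) * b) = b * (R - R * σ * R) * b * (D₂ * D₁) := by
  have ht := he.total hf fe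
  obtain ⟨θ, Q, t1, t2, t3, t4⟩ := row_mid he hf g₁ g₂ fe
    (fun f hf => ⟨f1 _ (by simp) f hf, f1 _ (by simp) f hf, f1 _ (by simp) f hf⟩)
    (fun e he => ⟨e2 _ (by simp) e he, e2 _ (by simp) e he, e2 _ (by simp) e he, e2 _ (by simp) e he⟩)
  obtain ⟨θ', t1', t2', t3', t4'⟩ := row_low he hf g₁ g₂ fe
    (fun f hf => ⟨f1 _ (by simp) f hf, f1 _ (by simp) f hf⟩) (fun e he => ⟨e2 _ (by simp) e he, e2 _ (by simp) e he, e2 _ (by simp) e he⟩)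
  obtain ⟨ξ, Q', x1, x2, x3, x4⟩ := col_mid he hf g₁ g₂ fe
    (fun f hf => ⟨f1 _ (by simp) f hf, f1 _ (by simp) f hf, f1 _ (by simp) f hf⟩)
    (fun e he => ⟨e2 _ (by simp) e he, e2 _ (by simp) e he, e2 _ (by simp) e he, e2 _ (by simp) e he⟩)
  obtain ⟨ξ', x1', x2', x3', x4'⟩ := col_low he hf g₁ g₂ fe
    (fun f hf => ⟨f1 _ (by simp) f hf, f1 _ (by simp) f hf⟩) (fun e he => ⟨e2 _ (by simp) e he, e2 _ (by simp) e he, e2 _ (by simp) e he⟩)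
  -- The four relations are the blocks of the intertwining identity between the inner block b and
  -- the corner c.
  have bb := intertwine_restrict ht hRz hRp h t1 t3 x1 x3
  have bc := intertwine_restrict ht hRz hRp h t1 t3 x1' x3'
  have cb := intertwine_restrict ht hRz hRp h t1' t3' x1 x3
  have cc := intertwine_restrict ht hRz hRp h t1' t3' x1' x3'
  rw [t2, t4, x2, x4, ← hb, ← hc] at bb
  rw [t2, t4, x2', x4', ← hb, ← hc] at bc
  rw [t2', t4', x2, x4, ← hb, ← hc] at cb
  rw [t2', t4', x2', x4', ← hc] at cc
  have comm : ∀ {e x f : S}, e * x = x * e → f * x = x * f → e * f * x = x * (e * f) := by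
    intro e x f h1 h2
    rw [mul_assoc, h2, ← mul_assoc, h1, mul_assoc]
  have b2 : b * D₂ = D₂ * b := by
    rw [hb]; exact comm (e2 _ (by simp) _ (by simp)) g₂.zD
  have c1 : c * D₁ = D₁ * c := by
    rw [hc]; exact comm g₁.mD (f1 _ (by simp) _ (by simp))
  have c2 : c * D₂ = D₂ * c := by
    rw [hc]; exact comm (e2 _ (by simp) _ (by simp)) g₂.pD
  -- The corner relation, multiplied by σ from both sides: σ intertwines in the direction opposite
  -- to R.
  have cc' : σ * D₁ * D₂ = D₂ * D₁ * σ := by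
    linear_combination (norm := noncomm_ring) - hσc * D₁ * D₂ + σ * c1 * D₂ + σ * D₁ * c2
      - σ * D₁ * D₂ * hRσ - σ * D₁ * D₂ * c * R * hcσ + σ * cc * σ + hσc * R * c * D₂ * D₁ * σ
      + hσR * D₂ * D₁ * σ + c2 * D₁ * σ + D₂ * c1 * σ + D₂ * D₁ * hcσ
  -- The unknown Q' enters `bb` only through c Q', which `cb` determines because σ inverts the
  -- corner. The unknown Q is removed by subtracting `bc * σ * R * b` from `bb`, as c R σ = c.
  have cQ : c * Q' = D₂ * D₁ * σ * R * b - σ * R * b * D₂ * D₁ := by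
    linear_combination (norm := noncomm_ring) - hσR * Q' - hσc * R * c * Q' - σ * cb
      + cc' * c * R * b + D₂ * D₁ * hσc * R * b - hσc * R * D₂ * b * D₁ + σ * R * b2 * D₁
  linear_combination (norm := noncomm_ring) bb - bc * σ * R * b
    + (D₁ * b * D₂ * R + Q * c * R) * hcσ * R * b + Q * hRσ * R * b + b * R * cQ
    - b * R * c2 * D₁ * σ * R * b - b * R * D₂ * c1 * σ * R * b - b * R * D₂ * D₁ * hcσ * R * b
    - D₁ * b2 * (R - R * σ * R) * b - b * R * b2 * D₁

end GaussRing

/-! ### The grading of the indices. -/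

/-- The index `2(n+1)`. -/
def lastIdx (n : ℕ) : Fin (2 * (n + 1)) := ⟨2 * n + 1, by omega⟩

/-- The degree of an index: `1`, `0`, `-1` for the first, the inner and the last ones. -/
def idxDeg (n : ℕ) (i : Fin (2 * (n + 1))) : ℤ :=
  if (i : ℕ) = 0 then 1 else if (i : ℕ) = 2 * n + 1 then -1 else 0

@[simp] theorem idxDeg_first (n : ℕ) : idxDeg n (firstIdx n) = 1 := by simp [idxDeg, firstIdx]

@[simp] theorem idxDeg_last (n : ℕ) : idxDeg n (lastIdx n) = -1 := by simp [idxDeg, lastIdx]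

@[simp] theorem idxDeg_inner (n : ℕ) (i : Fin (2 * n)) : idxDeg n (innerIdx n i) = 0 := by
  have h : (i : ℕ) ≠ 2 * n := by omega
  simp [idxDeg, innerIdx, h]

theorem idx_cases {n : ℕ} (i : Fin (2 * (n + 1))) :
    i = firstIdx n ∨ i = lastIdx n ∨ ∃ a, i = innerIdx n a := by
  by_cases h0 : (i : ℕ) = 0
  · left; ext; simpa [firstIdx] using h0
  · by_cases h1 : (i : ℕ) = 2 * n + 1
    · right; left; ext; simpa [lastIdx] using h1
    · right; right
      refine ⟨⟨(i : ℕ) - 1, by omega⟩, ?_⟩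
      ext; simp only [innerIdx]; omega

@[simp] theorem innerIdx_inj {n : ℕ} {a b : Fin (2 * n)} : innerIdx n a = innerIdx n b ↔ a = b := by
  simp [innerIdx, Fin.ext_iff]

theorem first_ne_last (n : ℕ) : firstIdx n ≠ lastIdx n := by
  simp [firstIdx, lastIdx, Fin.ext_iff]

theorem inner_ne_first (n : ℕ) (a : Fin (2 * n)) : innerIdx n a ≠ firstIdx n := by
  simp [innerIdx, firstIdx, Fin.ext_iff]

theorem inner_ne_last (n : ℕ) (a : Fin (2 * n)) : innerIdx n a ≠ lastIdx n := by
  simp [innerIdx, lastIdx, Fin.ext_iff]; omega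

theorem sum_idx {n : ℕ} {M : Type*} [AddCommMonoid M] (g : Fin (2 * (n + 1)) → M) :
    ∑ i, g i = g (firstIdx n) + ∑ a, g (innerIdx n a) + g (lastIdx n) := by
  have : ∀ g : Fin (2 * n + 1 + 1) → M,
      ∑ i, g i = g 0 + ∑ a : Fin (2 * n), g a.castSucc.succ + g (Fin.last _) := by
    intro g
    rw [Fin.sum_univ_succ, Fin.sum_univ_castSucc, ← add_assoc]; rfl
  exact this g

/-! ### The two tensor embeddings over a non-commutative ring. -/

section Tensor

variable {I : Type*} [Fintype I] [DecidableEq I] {S : Type*} [Ring S]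

/-- `X ↦ X ⊗ 1`. -/
def tensorLeft (I S : Type*) [Fintype I] [DecidableEq I] [Ring S] :
    Matrix I I S →+* Matrix (I × I) (I × I) S where
  toFun X := X ⊗ₖ 1
  map_one' := Matrix.one_kronecker_one
  map_zero' := Matrix.zero_kronecker _
  map_add' X Y := Matrix.add_kronecker X Y 1
  map_mul' X Y := by
    ext ⟨i, j⟩ ⟨k, l⟩
    simp [Matrix.mul_apply, Fintype.sum_prod_type, Matrix.one_apply]

/-- `X ↦ 1 ⊗ X`. -/
def tensorRight (I S : Type*) [Fintype I] [DecidableEq I] [Ring S] :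
    Matrix I I S →+* Matrix (I × I) (I × I) S where
  toFun X := 1 ⊗ₖ X
  map_one' := Matrix.one_kronecker_one
  map_zero' := Matrix.kronecker_zero _
  map_add' X Y := Matrix.kronecker_add 1 X Y
  map_mul' X Y := by
    ext ⟨i, j⟩ ⟨k, l⟩
    simp [Matrix.mul_apply, Fintype.sum_prod_type, Matrix.one_apply]

theorem tensorLeft_apply (X : Matrix I I S) (x y : I × I) :
    tensorLeft I S X x y = if x.2 = y.2 then X x.1 y.1 else 0 := by
  simp [tensorLeft, Matrix.one_apply]

theorem tensorRight_apply (X : Matrix I I S) (x y : I × I) :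
    tensorRight I S X x y = if x.1 = y.1 then X x.2 y.2 else 0 := by
  simp [tensorRight, Matrix.one_apply]

/-- Over a non-commutative ring the two embeddings do not commute: the order of the tensor factors
in the product is the order of the entries. This is how the two sides of RLL differ. -/
theorem tensorLeft_mul_tensorRight_apply (X Y : Matrix I I S) (x y : I × I) :
    (tensorLeft I S X * tensorRight I S Y) x y = X x.1 y.1 * Y x.2 y.2 := by
  simp [Matrix.mul_apply, tensorLeft_apply, tensorRight_apply, Fintype.sum_prod_type]

theorem tensorRight_mul_tensorLeft_apply (X Y : Matrix I I S) (x y : I × I) :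
    (tensorRight I S Y * tensorLeft I S X) x y = Y x.2 y.2 * X x.1 y.1 := by
  simp [Matrix.mul_apply, tensorLeft_apply, tensorRight_apply, Fintype.sum_prod_type]

end Tensor

/-! ### Schur complements of matrices satisfying an intertwining relation. -/

section Schur

variable {n : ℕ} {S : Type*} [Ring S]

/-- The projection to the indices of degree `k`. -/
def degProj (n : ℕ) (S : Type*) [Ring S] (k : ℤ) :
    Matrix (Fin (2 * (n + 1))) (Fin (2 * (n + 1))) S :=
  Matrix.diagonal fun i => if idxDeg n i = k then 1 else 0

theorem degProj_triple (n : ℕ) (S : Type*) [Ring S] :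
    IdemTriple (degProj n S 1) (degProj n S 0) (degProj n S (-1)) := by
  constructor <;>
  simp only [degProj, Matrix.diagonal_mul_diagonal, Matrix.diagonal_add, ← Matrix.diagonal_one,
    ← Matrix.diagonal_zero] <;> congr 1 <;> funext i <;>
  rcases idx_cases i with h | h | ⟨a, h⟩ <;> simp [h]

theorem degProj_one (n : ℕ) : degProj n S 1 = Matrix.single (firstIdx n) (firstIdx n) 1 := by
  rw [degProj, ← Matrix.diagonal_single]
  congr 1; funext i
  rcases idx_cases i with h | h | ⟨a, h⟩ <;>
    simp [h, (first_ne_last n).symm, inner_ne_first]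

/-- The inclusion of the inner basis vectors. -/
def innerIncl (n : ℕ) (S : Type*) [Ring S] : Matrix (Fin (2 * (n + 1))) (Fin (2 * n)) S :=
  Matrix.of fun i a => if i = innerIdx n a then 1 else 0

theorem innerIncl_transpose_mul :
    (innerIncl n S).transpose * innerIncl n S = 1 := by
  ext a b
  simp [Matrix.mul_apply, innerIncl, Matrix.one_apply, eq_comm]

theorem innerIncl_mul_transpose : innerIncl n S * (innerIncl n S).transpose = degProj n S 0 := by
  ext i j
  rcases idx_cases i with h | h | ⟨a, h⟩ <;> rcases idx_cases j with h' | h' | ⟨b, h'⟩ <;>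
    simp [h, h', Matrix.mul_apply, innerIncl, degProj, Matrix.diagonal_apply,
      inner_ne_last, (inner_ne_first n _).symm, (inner_ne_last n _).symm, eq_comm]

theorem innerIncl_conj (X : Matrix (Fin (2 * (n + 1))) (Fin (2 * (n + 1))) S) :
    (innerIncl n S).transpose * X * innerIncl n S = X.submatrix (innerIdx n) (innerIdx n) := by
  ext a b
  simp [Matrix.mul_apply, innerIncl]

/-- The Schur complement of the first diagonal entry, restricted to the inner indices; `u` stands
for the inverse of this entry. -/
def schurInner (L : Matrix (Fin (2 * (n + 1))) (Fin (2 * (n + 1))) S) (u : S) :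
    Matrix (Fin (2 * n)) (Fin (2 * n)) S :=
  Matrix.of fun i j => L (innerIdx n i) (innerIdx n j) -
    L (innerIdx n i) (firstIdx n) * u * L (firstIdx n) (innerIdx n j)

/-- The two pivots of the abstract factorisation are the first entry, inverted by u, and the Schur
complement, whose inverse W is extended by zero to J W Jᵀ along the inclusion J of the inner basis
vectors. -/
theorem exists_gaussFact_matrix (L : Matrix (Fin (2 * (n + 1))) (Fin (2 * (n + 1))) S) {u : S}
    (uL : u * L (firstIdx n) (firstIdx n) = 1) (Lu : L (firstIdx n) (firstIdx n) * u = 1)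
    (hM : IsUnit (schurInner L u)) :
    ∃ F F' D E E' m, GaussFact (degProj n S 1) (degProj n S 0) (degProj n S (-1))
      L F F' D E E' m ∧ D.submatrix (innerIdx n) (innerIdx n) = schurInner L u := by
  obtain ⟨⟨_, W, hW, hW'⟩, rfl⟩ := hM
  obtain ⟨k, hk⟩ : ∃ k, k = Matrix.single (firstIdx n) (firstIdx n) u := ⟨_, rfl⟩
  obtain ⟨J, hJ⟩ : ∃ J, J = innerIncl n S := ⟨_, rfl⟩
  have JJ : J.transpose * J = 1 := hJ ▸ innerIncl_transpose_mul
  have JJ' : J * J.transpose = degProj n S 0 := hJ ▸ innerIncl_mul_transpose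
  have hN : J.transpose * (L - L * k * L) * J = schurInner L u := by
    rw [hJ, innerIncl_conj]
    ext a b
    simp [hk, schurInner, Matrix.mul_apply, Matrix.single_apply, ite_and]
  rw [← hN] at hW hW'
  obtain ⟨F, F', D, E, E', g, hD⟩ := exists_gaussFact (L := L) (k := k)
    (m := J * W * J.transpose) (degProj_triple n S)
    (by rw [hk, degProj_one]; simp) (by rw [hk, degProj_one]; simp)
    (by
      rw [hk, degProj_one]
      ext i j
      simp [Matrix.mul_apply, Matrix.single_apply, ite_and, uL]
      split_ifs <;> rfl)
    (by
      rw [hk, degProj_one]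
      ext i j
      simp [Matrix.mul_apply, Matrix.single_apply, ite_and, Lu]
      split_ifs <;> rfl)
    (by rw [← JJ', Matrix.mul_assoc J, ← Matrix.mul_assoc _ _ J.transpose,
      ← Matrix.mul_assoc _ J, JJ, Matrix.one_mul, ← Matrix.mul_assoc])
    (by rw [← JJ', ← Matrix.mul_assoc, Matrix.mul_assoc _ _ J, JJ, Matrix.mul_one])
    (by
      rw [← JJ']
      calc _ = J * (W * (J.transpose * (L - L * k * L) * J)) * J.transpose := by
            simp only [Matrix.mul_assoc]
        _ = _ := by rw [hW', Matrix.mul_one])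
    (by
      rw [← JJ']
      calc _ = J * ((J.transpose * (L - L * k * L) * J) * W) * J.transpose := by
            simp only [Matrix.mul_assoc]
        _ = _ := by rw [hW, Matrix.mul_one])
  refine ⟨F, F', D, E, E', _, g, ?_⟩
  have conj : ∀ X, J.transpose * (degProj n S 0 * X * degProj n S 0) * J =
      J.transpose * X * J := by
    intro X
    rw [← JJ']
    calc _ = (J.transpose * J) * J.transpose * X * J * (J.transpose * J) := by
          simp only [Matrix.mul_assoc]
      _ = _ := by rw [JJ, Matrix.one_mul, Matrix.mul_one]
  rw [← innerIncl_conj, ← hN, ← hJ, ← conj, hD, conj]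

/-- The Schur complement of an R-matrix with respect to the vector `e_{1'} ⊗ e_1`; here `s` stands
for the inverse of the corresponding diagonal entry. -/
def schurR {S : Type*} [Ring S]
    (R : Mat2 (n + 1) S) (s : S) : Mat2 n S :=
  Matrix.of fun x y => R (innerIdx n x.1, innerIdx n x.2) (innerIdx n y.1, innerIdx n y.2) -
    R (innerIdx n x.1, innerIdx n x.2) (lastIdx n, firstIdx n) * s *
      R (lastIdx n, firstIdx n) (innerIdx n y.1, innerIdx n y.2)

theorem degProj_tensor_comm (k : ℤ) (x : Matrix (Fin (2 * (n + 1))) (Fin (2 * (n + 1))) S) :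
    tensorRight _ S (degProj n S k) * tensorLeft _ S x =
      tensorLeft _ S x * tensorRight _ S (degProj n S k) := by
  ext y z
  rw [tensorLeft_mul_tensorRight_apply, tensorRight_mul_tensorLeft_apply]
  simp only [degProj, Matrix.diagonal_apply]
  split_ifs <;> simp

theorem tensor_degProj_comm (k : ℤ) (x : Matrix (Fin (2 * (n + 1))) (Fin (2 * (n + 1))) S) :
    tensorLeft _ S (degProj n S k) * tensorRight _ S x =
      tensorRight _ S x * tensorLeft _ S (degProj n S k) := by
  ext y z
  rw [tensorLeft_mul_tensorRight_apply, tensorRight_mul_tensorLeft_apply]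
  simp only [degProj, Matrix.diagonal_apply]
  split_ifs <;> simp

theorem degProj_tensor_degProj (k l : ℤ) :
    tensorLeft _ S (degProj n S k) * tensorRight _ S (degProj n S l) =
      Matrix.diagonal fun x : Fin (2 * (n + 1)) × Fin (2 * (n + 1)) =>
        if idxDeg n x.1 = k ∧ idxDeg n x.2 = l then 1 else 0 := by
  ext ⟨i, j⟩ ⟨i', j'⟩
  rw [tensorLeft_mul_tensorRight_apply]
  simp only [degProj, Matrix.diagonal_apply, Prod.mk.injEq, ite_and]
  split_ifs <;> simp

theorem idxDeg_cases (i : Fin (2 * (n + 1))) :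
    idxDeg n i = 1 ∨ idxDeg n i = 0 ∨ idxDeg n i = -1 := by
  rcases idx_cases i with h | h | ⟨a, h⟩ <;> simp [h]

/-- R is block diagonal for the total degree, hence commutes with every central-valued function of
it. The functions needed are the indicators of positive and of zero degree. -/
theorem diagonal_comm_of_deg {R : Matrix (Fin (2 * (n + 1)) × Fin (2 * (n + 1))) (Fin (2 * (n + 1)) × Fin (2 * (n + 1))) S}
    (hdeg : ∀ x y, idxDeg n x.1 + idxDeg n x.2 ≠ idxDeg n y.1 + idxDeg n y.2 → R x y = 0)
    (g : ℤ → S) (hg : ∀ k s, g k * s = s * g k) :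
    Matrix.diagonal (fun x : Fin (2 * (n + 1)) × Fin (2 * (n + 1)) =>
      g (idxDeg n x.1 + idxDeg n x.2)) * R = R * Matrix.diagonal (fun x =>
      g (idxDeg n x.1 + idxDeg n x.2)) := by
  ext x y
  rw [Matrix.diagonal_mul, Matrix.mul_diagonal, hg]
  by_cases h : idxDeg n x.1 + idxDeg n x.2 = idxDeg n y.1 + idxDeg n y.2
  · rw [h]
  · rw [hdeg x y h]; simp

theorem pos_proj_comm {R : Matrix (Fin (2 * (n + 1)) × Fin (2 * (n + 1))) (Fin (2 * (n + 1)) × Fin (2 * (n + 1))) S}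
    (hdeg : ∀ x y, idxDeg n x.1 + idxDeg n x.2 ≠ idxDeg n y.1 + idxDeg n y.2 → R x y = 0) :
    (tensorLeft _ S (degProj n S 1) * tensorRight _ S (degProj n S 1) +
      tensorLeft _ S (degProj n S 1) * tensorRight _ S (degProj n S 0) +
      tensorLeft _ S (degProj n S 0) * tensorRight _ S (degProj n S 1)) * R =
    R * (tensorLeft _ S (degProj n S 1) * tensorRight _ S (degProj n S 1) +
      tensorLeft _ S (degProj n S 1) * tensorRight _ S (degProj n S 0) +
      tensorLeft _ S (degProj n S 0) * tensorRight _ S (degProj n S 1)) := by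
  have := diagonal_comm_of_deg hdeg (fun k => if 0 < k then 1 else 0)
    (by intro k s; split_ifs <;> simp)
  simp only [degProj_tensor_degProj, Matrix.diagonal_add]
  rw [show (fun x : Fin (2 * (n + 1)) × Fin (2 * (n + 1)) =>
    (if idxDeg n x.1 = 1 ∧ idxDeg n x.2 = 1 then (1 : S) else 0) +
    (if idxDeg n x.1 = 1 ∧ idxDeg n x.2 = 0 then 1 else 0) +
    (if idxDeg n x.1 = 0 ∧ idxDeg n x.2 = 1 then 1 else 0)) =
    fun x => if 0 < idxDeg n x.1 + idxDeg n x.2 then 1 else 0 from ?_]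
  · exact this
  · funext x
    rcases idxDeg_cases x.1 with h | h | h <;> rcases idxDeg_cases x.2 with h' | h' | h' <;>
      simp [h, h']

theorem zero_proj_comm {R : Matrix (Fin (2 * (n + 1)) × Fin (2 * (n + 1))) (Fin (2 * (n + 1)) × Fin (2 * (n + 1))) S}
    (hdeg : ∀ x y, idxDeg n x.1 + idxDeg n x.2 ≠ idxDeg n y.1 + idxDeg n y.2 → R x y = 0) :
    (tensorLeft _ S (degProj n S 1) * tensorRight _ S (degProj n S (-1)) +
      tensorLeft _ S (degProj n S 0) * tensorRight _ S (degProj n S 0) +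
      tensorLeft _ S (degProj n S (-1)) * tensorRight _ S (degProj n S 1)) * R =
    R * (tensorLeft _ S (degProj n S 1) * tensorRight _ S (degProj n S (-1)) +
      tensorLeft _ S (degProj n S 0) * tensorRight _ S (degProj n S 0) +
      tensorLeft _ S (degProj n S (-1)) * tensorRight _ S (degProj n S 1)) := by
  have := diagonal_comm_of_deg hdeg (fun k => if 0 = k then 1 else 0)
    (by intro k s; split_ifs <;> simp)
  simp only [degProj_tensor_degProj, Matrix.diagonal_add]
  rw [show (fun x : Fin (2 * (n + 1)) × Fin (2 * (n + 1)) =>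
    (if idxDeg n x.1 = 1 ∧ idxDeg n x.2 = -1 then (1 : S) else 0) +
    (if idxDeg n x.1 = 0 ∧ idxDeg n x.2 = 0 then 1 else 0) +
    (if idxDeg n x.1 = -1 ∧ idxDeg n x.2 = 1 then 1 else 0)) =
    fun x => if 0 = idxDeg n x.1 + idxDeg n x.2 then 1 else 0 from ?_]
  · exact this
  · funext x
    rcases idxDeg_cases x.1 with h | h | h <;> rcases idxDeg_cases x.2 with h' | h' | h' <;>
      simp [h, h']

theorem low_proj_eq :
    tensorLeft _ S (degProj n S (-1)) * tensorRight _ S (degProj n S 1) =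
      Matrix.single (lastIdx n, firstIdx n) (lastIdx n, firstIdx n) 1 := by
  rw [degProj_tensor_degProj, ← Matrix.diagonal_single]
  congr 1
  funext ⟨i, j⟩
  rcases idx_cases i with h | h | ⟨a, h⟩ <;> rcases idx_cases j with h' | h' | ⟨b, h'⟩ <;>
    simp [h, h', first_ne_last, (first_ne_last n).symm, inner_ne_first, inner_ne_last]

/-- An instance of `gauss_intertwine`: the projections in one tensor factor have entries 0 and 1, so
they commute with everything in the other factor, and the corner `em * fp` has rank one, spanned by
e_{1'} ⊗ e_1, so inverting it means inverting a single entry of R. -/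
theorem schur_intertwine {L₁ L₂ : Matrix (Fin (2 * (n + 1))) (Fin (2 * (n + 1))) S}
    {R : Matrix (Fin (2 * (n + 1)) × Fin (2 * (n + 1))) (Fin (2 * (n + 1)) × Fin (2 * (n + 1))) S} {s u₁ u₂ : S}
    (uL₁ : u₁ * L₁ (firstIdx n) (firstIdx n) = 1) (Lu₁ : L₁ (firstIdx n) (firstIdx n) * u₁ = 1)
    (uL₂ : u₂ * L₂ (firstIdx n) (firstIdx n) = 1) (Lu₂ : L₂ (firstIdx n) (firstIdx n) * u₂ = 1)
    (hM₁ : IsUnit (schurInner L₁ u₁)) (hM₂ : IsUnit (schurInner L₂ u₂))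
    (hdeg : ∀ x y, idxDeg n x.1 + idxDeg n x.2 ≠ idxDeg n y.1 + idxDeg n y.2 → R x y = 0)
    (sR : s * R (lastIdx n, firstIdx n) (lastIdx n, firstIdx n) = 1)
    (Rs : R (lastIdx n, firstIdx n) (lastIdx n, firstIdx n) * s = 1)
    (h : tensorLeft _ S L₁ * tensorRight _ S L₂ * R =
      R * (tensorRight _ S L₂ * tensorLeft _ S L₁)) :
    tensorLeft _ S (schurInner L₁ u₁) * tensorRight _ S (schurInner L₂ u₂) * schurR R s =
      schurR R s *
        (tensorRight _ S (schurInner L₂ u₂) * tensorLeft _ S (schurInner L₁ u₁)) := by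
  obtain ⟨F₁, F₁', D₁, E₁, E₁', m₁, g₁, hD₁⟩ := exists_gaussFact_matrix L₁ uL₁ Lu₁ hM₁
  obtain ⟨F₂, F₂', D₂, E₂, E₂', m₂, g₂, hD₂⟩ := exists_gaussFact_matrix L₂ uL₂ Lu₂ hM₂
  obtain ⟨c, hc⟩ : ∃ c : Fin (2 * (n + 1)) × Fin (2 * (n + 1)), c = (lastIdx n, firstIdx n) :=
    ⟨_, rfl⟩
  rw [← hc] at sR Rs
  have hcP : tensorLeft _ S (degProj n S (-1)) * tensorRight _ S (degProj n S 1) =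
      Matrix.single c c 1 := hc ▸ low_proj_eq
  obtain ⟨b, hb⟩ : ∃ b, b = tensorLeft _ S (degProj n S 0) * tensorRight _ S (degProj n S 0) :=
    ⟨_, rfl⟩
  have G₁ : GaussFact (tensorLeft _ S (degProj n S 1)) (tensorLeft _ S (degProj n S 0))
    (tensorLeft _ S (degProj n S (-1))) (tensorLeft _ S L₁) (tensorLeft _ S F₁)
    (tensorLeft _ S F₁') (tensorLeft _ S D₁) (tensorLeft _ S E₁) (tensorLeft _ S E₁')
    (tensorLeft _ S m₁) := g₁.map (tensorLeft _ S)
  have G₂ : GaussFact (tensorRight _ S (degProj n S 1)) (tensorRight _ S (degProj n S 0))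
    (tensorRight _ S (degProj n S (-1))) (tensorRight _ S L₂) (tensorRight _ S F₂)
    (tensorRight _ S F₂') (tensorRight _ S D₂) (tensorRight _ S E₂) (tensorRight _ S E₂')
    (tensorRight _ S m₂) := g₂.map (tensorRight _ S)
  have he : IdemTriple (tensorLeft _ S (degProj n S 1)) (tensorLeft _ S (degProj n S 0))
    (tensorLeft _ S (degProj n S (-1))) := (degProj_triple n S).map (tensorLeft _ S)
  have hf : IdemTriple (tensorRight _ S (degProj n S 1)) (tensorRight _ S (degProj n S 0))
    (tensorRight _ S (degProj n S (-1))) := (degProj_triple n S).map (tensorRight _ S)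
  have key := gauss_intertwine he hf G₁ G₂
    (by
      rintro e (rfl | rfl | rfl) f (rfl | rfl | rfl) <;> exact degProj_tensor_comm _ _)
    (by
      rintro x (rfl | rfl | rfl | rfl) f (rfl | rfl | rfl) <;> exact degProj_tensor_comm _ _)
    (by
      rintro x (rfl | rfl | rfl | rfl | rfl | rfl) e (rfl | rfl | rfl) <;>
        exact tensor_degProj_comm _ _)
    (R := R) (σ := Matrix.single c c s) hb hcP.symm (pos_proj_comm hdeg) (zero_proj_comm hdeg)
    (by simp) (by simp) (by simp [Rs])
    (by simp [sR]) h
  -- The compressed matrix is supported on pairs of inner indices, so in the sums below only the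
  -- inner indices survive.
  have hB : ∀ x y, (b * (R - R * Matrix.single c c s * R) * b) x y =
      if (idxDeg n x.1 = 0 ∧ idxDeg n x.2 = 0) ∧ (idxDeg n y.1 = 0 ∧ idxDeg n y.2 = 0) then
        R x y - R x c * s * R c y else 0 := by
    intro x y
    rw [hb, degProj_tensor_degProj, Matrix.mul_diagonal, Matrix.diagonal_mul]
    have : (R * Matrix.single c c s * R) x y = R x c * s * R c y := by
      simp [Matrix.mul_apply, Matrix.single_apply, ite_and]
    rw [Matrix.sub_apply, this]
    split_ifs <;> simp_all
  generalize b * (R - R * Matrix.single c c s * R) * b = B at key hB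
  ext ⟨i, j⟩ ⟨k, l⟩
  have := congrFun (congrFun key (innerIdx n i, innerIdx n j)) (innerIdx n k, innerIdx n l)
  rw [Matrix.mul_apply, Matrix.mul_apply, Fintype.sum_prod_type, Fintype.sum_prod_type] at this
  simp only [sum_idx, tensorLeft_mul_tensorRight_apply, tensorRight_mul_tensorLeft_apply, hB,
    idxDeg_first, idxDeg_last, idxDeg_inner] at this
  rw [Matrix.mul_apply, Matrix.mul_apply, Fintype.sum_prod_type, Fintype.sum_prod_type]
  simp only [tensorLeft_mul_tensorRight_apply, tensorRight_mul_tensorLeft_apply, ← hD₁, ← hD₂,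
    schurR, Matrix.of_apply, Matrix.submatrix_apply, ← hc]
  simpa using this

end Schur

/-! ### Passage to the opposite ring. -/

section Reduction

variable {n : ℕ} {E T : Type*} [CommRing E] [Ring T]

/-- The relation `R L₁ L₂ = L₂ L₁ R`, written in terms of the matrix entries, with the entries of
`R` in a commutative ring acting through `ψ`. -/
def RLLEntries (ψ : E →+* T) (r : Mat2 n E) (L₁ L₂ : Matrix (Fin (2 * n)) (Fin (2 * n)) T) :
    Prop :=
  ∀ x y, ∑ z, ψ (r x z) * (L₁ z.1 y.1 * L₂ z.2 y.2) =
    ∑ z, ψ (r z y) * (L₂ x.2 z.2 * L₁ x.1 z.1)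

/-- The reduced matrix; `u` stands for the inverse of the first diagonal entry. -/
def reducedMat (L : Matrix (Fin (2 * (n + 1))) (Fin (2 * (n + 1))) T) (u : T) :
    Matrix (Fin (2 * n)) (Fin (2 * n)) T :=
  Matrix.of fun i j => L (innerIdx n i) (innerIdx n j) -
    L (firstIdx n) (innerIdx n j) * u * L (innerIdx n i) (firstIdx n)

open MulOpposite in
-- Transposition identifies matrices over the opposite ring with the opposite of the matrix ring;
-- this is why transposes appear in the invertibility conditions.
theorem isUnit_map_op {ι : Type*} [Fintype ι] [DecidableEq ι] {X : Matrix ι ι T}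
    (h : IsUnit X.transpose) : IsUnit (X.map op) := by
  obtain ⟨⟨V, W, hW, hW'⟩, rfl : V = X.transpose⟩ := h
  refine ⟨⟨X.map op, W.transpose.map op, ?_, ?_⟩, rfl⟩
  · ext i k
    have := congrFun (congrFun hW' k) i
    simp only [Matrix.mul_apply, Matrix.map_apply, Matrix.transpose_apply, Matrix.one_apply,
      ← op_mul, ← Finset.op_sum] at this ⊢
    rw [this]
    by_cases h : i = k
    · simp [h]
    · rw [if_neg h, if_neg (Ne.symm h), op_zero]
  · ext i k
    have := congrFun (congrFun hW k) i
    simp only [Matrix.mul_apply, Matrix.map_apply, Matrix.transpose_apply, Matrix.one_apply,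
      ← op_mul, ← Finset.op_sum] at this ⊢
    rw [this]
    by_cases h : i = k
    · simp [h]
    · rw [if_neg h, if_neg (Ne.symm h), op_zero]

open MulOpposite in
-- The order L_{1j} L_{11}⁻¹ L_{i1} is not that of a matrix product over the given ring, but it is
-- over the opposite one.
theorem schurInner_map_op (L : Matrix (Fin (2 * (n + 1))) (Fin (2 * (n + 1))) T) (u : T) :
    schurInner (L.map op) (op u) = (reducedMat L u).map op := by
  ext i j
  simp [schurInner, reducedMat, mul_assoc]

open MulOpposite in
-- Over the opposite ring the products of entries are reversed, so the two sides of RLL change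
-- places and R moves across: R L₁ L₂ = L₂ L₁ R takes the form L₁ L₂ R = R L₂ L₁ used for the
-- elimination. Centrality of the image of ψ allows R to stand on either side.
theorem RLLEntries_iff {ψ : E →+* T} (hψ : ∀ e t, ψ e * t = t * ψ e) {r : Mat2 n E}
    {L₁ L₂ : Matrix (Fin (2 * n)) (Fin (2 * n)) T} :
    RLLEntries ψ r L₁ L₂ ↔
      tensorLeft _ _ (L₁.map op) * tensorRight _ _ (L₂.map op) * r.map (fun e => op (ψ e)) =
      r.map (fun e => op (ψ e)) * (tensorRight _ _ (L₂.map op) * tensorLeft _ _ (L₁.map op)) := by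
  have h1 : ∀ x y, (tensorLeft _ _ (L₁.map op) * tensorRight _ _ (L₂.map op) *
      r.map (fun e => op (ψ e))) x y = op (∑ z, ψ (r z y) * (L₂ x.2 z.2 * L₁ x.1 z.1)) := by
    intro x y
    rw [Matrix.mul_apply, Finset.op_sum]
    refine Finset.sum_congr rfl fun z _ => ?_
    rw [tensorLeft_mul_tensorRight_apply]
    simp
  have h2 : ∀ x y, (r.map (fun e => op (ψ e)) * (tensorRight _ _ (L₂.map op) *
      tensorLeft _ _ (L₁.map op))) x y = op (∑ z, ψ (r x z) * (L₁ z.1 y.1 * L₂ z.2 y.2)) := by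
    intro x y
    rw [Matrix.mul_apply, Finset.op_sum]
    refine Finset.sum_congr rfl fun z _ => ?_
    rw [tensorRight_mul_tensorLeft_apply, hψ]
    simp
  constructor
  · intro h
    ext x y
    rw [h1, h2, h x y]
  · intro h x y
    have := congrFun (congrFun h x) y
    rw [h1, h2] at this
    exact (op_injective this).symm

open MulOpposite in
/-- The reduction theorem for matrices with entries in an arbitrary ring. -/
theorem RLLEntries.reduced {ψ : E →+* T} (hψ : ∀ e t, ψ e * t = t * ψ e) {r : Mat2 (n + 1) E}
    {s : E} (hs : s * r (lastIdx n, firstIdx n) (lastIdx n, firstIdx n) = 1)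
    (hdeg : ∀ x y, idxDeg n x.1 + idxDeg n x.2 ≠ idxDeg n y.1 + idxDeg n y.2 → r x y = 0)
    {L₁ L₂ : Matrix (Fin (2 * (n + 1))) (Fin (2 * (n + 1))) T} {u₁ u₂ : T}
    (uL₁ : u₁ * L₁ (firstIdx n) (firstIdx n) = 1) (Lu₁ : L₁ (firstIdx n) (firstIdx n) * u₁ = 1)
    (uL₂ : u₂ * L₂ (firstIdx n) (firstIdx n) = 1) (Lu₂ : L₂ (firstIdx n) (firstIdx n) * u₂ = 1)
    (hM₁ : IsUnit (reducedMat L₁ u₁).transpose) (hM₂ : IsUnit (reducedMat L₂ u₂).transpose)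
    (h : RLLEntries ψ r L₁ L₂) :
    RLLEntries ψ (schurR r s) (reducedMat L₁ u₁) (reducedMat L₂ u₂) := by
  rw [RLLEntries_iff hψ] at h ⊢
  have hR : (schurR r s).map (fun e => op (ψ e)) =
      schurR (r.map (fun e => op (ψ e))) (op (ψ s)) := by
    ext x y
    simp only [schurR, Matrix.map_apply, Matrix.of_apply, ← op_mul, ← op_sub, ← map_mul,
      ← map_sub]
    congr 3
    ring
  rw [hR, ← schurInner_map_op, ← schurInner_map_op]
  refine schur_intertwine (L₁ := L₁.map op) (L₂ := L₂.map op) ?_ ?_ ?_ ?_ ?_ ?_ ?_ ?_ ?_ h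
  · simp [← op_mul, Lu₁]
  · simp [← op_mul, uL₁]
  · simp [← op_mul, Lu₂]
  · simp [← op_mul, uL₂]
  · rw [schurInner_map_op]; exact isUnit_map_op hM₁
  · rw [schurInner_map_op]; exact isUnit_map_op hM₂
  · intro x y hxy
    simp [hdeg x y hxy]
  · simp only [Matrix.map_apply, ← op_mul, ← map_mul, mul_comm _ s, hs, map_one, op_one]
  · simp only [Matrix.map_apply, ← op_mul, ← map_mul, hs, map_one, op_one]

end Reduction

/-! ### Coefficients of simple and double power series at integer exponents. -/

section Series

variable {A : Type*} [Ring A]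

/-- The coefficient of a power series at an integer exponent. -/
noncomputable def extCoeff (m : ℤ) : A⟦X⟧ →+ A where
  toFun f := if 0 ≤ m then PowerSeries.coeff m.toNat f else 0
  map_zero' := by simp
  map_add' x y := by split_ifs <;> simp

theorem extCoeff_apply (f : A⟦X⟧) (m : ℤ) :
    extCoeff m f = if 0 ≤ m then PowerSeries.coeff m.toNat f else 0 := rfl

@[simp] theorem extCoeff_natCast (f : A⟦X⟧) (m : ℕ) :
    extCoeff (m : ℤ) f = PowerSeries.coeff m f := by
  simp [extCoeff_apply]

theorem extCoeff_of_neg (f : A⟦X⟧) {m : ℤ} (h : m < 0) : extCoeff m f = 0 := by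
  rw [extCoeff_apply, if_neg (by omega)]

/-- The coefficients of a double power series at integer exponents. -/
noncomputable def extCoeff₂ (i j : ℤ) : A⟦X⟧⟦X⟧ →+ A :=
  (extCoeff i).comp (extCoeff j)

theorem extCoeff₂_apply (h : A⟦X⟧⟦X⟧) (i j : ℤ) :
    extCoeff₂ i j h = extCoeff i (extCoeff j h) := rfl

theorem extCoeff₂_natCast (h : A⟦X⟧⟦X⟧) (i j : ℕ) :
    extCoeff₂ (i : ℤ) (j : ℤ) h = PowerSeries.coeff i (PowerSeries.coeff j h) := by
  simp [extCoeff₂_apply]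

theorem ext_of_extCoeff₂ {f g : A⟦X⟧⟦X⟧} (h : ∀ i j : ℕ, extCoeff₂ i j f = extCoeff₂ i j g) :
    f = g := by
  ext j i
  simpa [extCoeff₂_natCast] using h i j

/-- The substitution `f(X) ↦ f(XY)`. -/
noncomputable def diagHom (A : Type*) [Ring A] : A⟦X⟧ →+* A⟦X⟧⟦X⟧ where
  toFun f := PowerSeries.mk fun k => PowerSeries.monomial k (PowerSeries.coeff k f)
  map_one' := by
    ext k i
    simp only [PowerSeries.coeff_mk, PowerSeries.coeff_one, PowerSeries.coeff_monomial]
    split_ifs <;> simp_all [PowerSeries.coeff_one]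
  map_zero' := by ext k i; simp
  map_add' f g := by ext k i; simp
  map_mul' f g := by
    ext1 k
    rw [PowerSeries.coeff_mk, PowerSeries.coeff_mul, PowerSeries.coeff_mul, map_sum]
    refine Finset.sum_congr rfl fun x hx => ?_
    rw [Finset.HasAntidiagonal.mem_antidiagonal] at hx
    rw [PowerSeries.coeff_mk, PowerSeries.coeff_mk, PowerSeries.monomial_mul_monomial, hx]

theorem coeff_diagHom (f : A⟦X⟧) (k : ℕ) : PowerSeries.coeff k (diagHom A f) =
    PowerSeries.monomial k (PowerSeries.coeff k f) := by
  simp [diagHom]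

theorem commute_of_coeff {f : A⟦X⟧} (h : ∀ k t, PowerSeries.coeff k f * t =
    t * PowerSeries.coeff k f) (g : A⟦X⟧) : f * g = g * f := by
  ext k
  rw [PowerSeries.coeff_mul, PowerSeries.coeff_mul, ← Finset.Nat.sum_antidiagonal_swap]
  exact Finset.sum_congr rfl fun x _ => h _ _

/-- Coefficients at negative exponents are zero, so every sufficiently long range gives the same
sum. This freedom lets the single bound |a| + |b| + 1 serve all expansions. -/
theorem extCoeff_mul (f g : A⟦X⟧) {m : ℤ} {N : ℕ} (h : m < N) :
    extCoeff m (f * g) = ∑ k ∈ Finset.range N, PowerSeries.coeff k f * extCoeff (m - k) g := by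
  rcases lt_or_ge m 0 with hm | hm
  · rw [extCoeff_of_neg _ hm]
    exact (Finset.sum_eq_zero fun k _ => by rw [extCoeff_of_neg _ (by omega), mul_zero]).symm
  · obtain ⟨m, rfl⟩ := Int.eq_ofNat_of_zero_le hm
    rw [extCoeff_natCast, PowerSeries.coeff_mul, Finset.Nat.sum_antidiagonal_eq_sum_range_succ_mk]
    refine Finset.sum_subset_zero_on_sdiff (Finset.range_mono (by omega)) ?_ ?_
    · intro k hk
      simp only [Finset.mem_sdiff, Finset.mem_range] at hk
      rw [extCoeff_of_neg _ (by omega), mul_zero]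
    · intro k hk
      rw [Finset.mem_range] at hk
      rw [← Nat.cast_sub (by omega), extCoeff_natCast]

theorem extCoeff_mul' (f g : A⟦X⟧) {m : ℤ} {N : ℕ} (h : m < N) :
    extCoeff m (g * f) = ∑ k ∈ Finset.range N, extCoeff (m - k) g * PowerSeries.coeff k f := by
  rcases lt_or_ge m 0 with hm | hm
  · rw [extCoeff_of_neg _ hm]
    exact (Finset.sum_eq_zero fun k _ => by rw [extCoeff_of_neg _ (by omega), zero_mul]).symm
  · obtain ⟨m, rfl⟩ := Int.eq_ofNat_of_zero_le hm
    rw [extCoeff_natCast, PowerSeries.coeff_mul, ← Finset.Nat.sum_antidiagonal_swap,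
      Finset.Nat.sum_antidiagonal_eq_sum_range_succ_mk]
    refine Finset.sum_subset_zero_on_sdiff (Finset.range_mono (by omega)) ?_ ?_
    · intro k hk
      simp only [Finset.mem_sdiff, Finset.mem_range] at hk
      rw [extCoeff_of_neg _ (by omega), zero_mul]
    · intro k hk
      rw [Finset.mem_range] at hk
      rw [← Nat.cast_sub (by omega), extCoeff_natCast]
      rfl

theorem extCoeff_monomial_mul (k : ℕ) (a : A) (g : A⟦X⟧) (m : ℤ) :
    extCoeff m (PowerSeries.monomial k a * g) = a * extCoeff (m - k) g := by
  rw [extCoeff_mul (N := m.toNat + k + 1) _ _ (by omega), Finset.sum_eq_single k]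
  · simp
  · intro l _ hl
    rw [PowerSeries.coeff_monomial, if_neg hl, zero_mul]
  · intro h
    exact absurd (Finset.mem_range.2 (by omega)) h

theorem extCoeff_mul_monomial (k : ℕ) (a : A) (g : A⟦X⟧) (m : ℤ) :
    extCoeff m (g * PowerSeries.monomial k a) = extCoeff (m - k) g * a := by
  rw [extCoeff_mul' (N := m.toNat + k + 1) _ _ (by omega), Finset.sum_eq_single k]
  · simp
  · intro l _ hl
    rw [PowerSeries.coeff_monomial, if_neg hl, mul_zero]
  · intro h
    exact absurd (Finset.mem_range.2 (by omega)) h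

/-- The k-th term of r(XY) lowers both exponents by k, so a bound on one of them is enough. -/
theorem extCoeff₂_diagHom_mul (r : A⟦X⟧) (h : A⟦X⟧⟦X⟧) (i : ℤ) {j : ℤ} {N : ℕ} (hj : j < N) :
    extCoeff₂ i j (diagHom A r * h) =
      ∑ k ∈ Finset.range N, PowerSeries.coeff k r * extCoeff₂ (i - k) (j - k) h := by
  rw [extCoeff₂_apply, extCoeff_mul _ _ hj, map_sum]
  refine Finset.sum_congr rfl fun k _ => ?_
  rw [coeff_diagHom, extCoeff_monomial_mul, extCoeff₂_apply]

theorem extCoeff₂_mul_diagHom (r : A⟦X⟧) (h : A⟦X⟧⟦X⟧) (i : ℤ) {j : ℤ} {N : ℕ} (hj : j < N) :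
    extCoeff₂ i j (h * diagHom A r) =
      ∑ k ∈ Finset.range N, extCoeff₂ (i - k) (j - k) h * PowerSeries.coeff k r := by
  rw [extCoeff₂_apply, extCoeff_mul' _ _ hj, map_sum]
  refine Finset.sum_congr rfl fun k _ => ?_
  rw [coeff_diagHom, extCoeff_mul_monomial, extCoeff₂_apply]

theorem extCoeff_C_mul {B : Type*} [Ring B] (r : B) (h : B⟦X⟧) (j : ℤ) :
    extCoeff j (PowerSeries.C r * h) = r * extCoeff j h := by
  simp only [extCoeff_apply, PowerSeries.coeff_C_mul]
  split_ifs <;> simp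

theorem extCoeff_mul_C {B : Type*} [Ring B] (r : B) (h : B⟦X⟧) (j : ℤ) :
    extCoeff j (h * PowerSeries.C r) = extCoeff j h * r := by
  simp only [extCoeff_apply, PowerSeries.coeff_mul_C]
  split_ifs <;> simp

theorem extCoeff₂_C_mul (r : A⟦X⟧) (h : A⟦X⟧⟦X⟧) {i : ℤ} (j : ℤ) {N : ℕ} (hi : i < N) :
    extCoeff₂ i j (PowerSeries.C r * h) =
      ∑ k ∈ Finset.range N, PowerSeries.coeff k r * extCoeff₂ (i - k) j h := by
  rw [extCoeff₂_apply, extCoeff_C_mul, extCoeff_mul _ _ hi]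
  rfl

theorem extCoeff_map_C (g : A⟦X⟧) (j : ℤ) :
    extCoeff j (PowerSeries.map PowerSeries.C g : A⟦X⟧⟦X⟧) = PowerSeries.C (extCoeff j g) := by
  simp only [extCoeff_apply, PowerSeries.coeff_map]
  split_ifs <;> simp

theorem extCoeff_C (a : A) (i : ℤ) :
    extCoeff i (PowerSeries.C a) = if i = 0 then a else 0 := by
  rw [extCoeff_apply]
  split_ifs with h1 h2 h2
  · simp [h2]
  · rw [PowerSeries.coeff_C, if_neg (by omega)]
  · omega
  · rfl

theorem extCoeff₂_C_mul_map_C (f g : A⟦X⟧) (i j : ℤ) :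
    extCoeff₂ i j (PowerSeries.C f * PowerSeries.map PowerSeries.C g) =
      extCoeff i f * extCoeff j g := by
  rw [extCoeff₂_apply, extCoeff_C_mul, extCoeff_map_C, extCoeff_mul_C]

theorem extCoeff₂_map_C_mul_C (f g : A⟦X⟧) (i j : ℤ) :
    extCoeff₂ i j (PowerSeries.map PowerSeries.C g * PowerSeries.C f) =
      extCoeff j g * extCoeff i f := by
  rw [extCoeff₂_apply, extCoeff_mul_C, extCoeff_map_C, extCoeff_C_mul]

theorem extCoeff₂_map_C (g : A⟦X⟧) (i j : ℤ) :
    extCoeff₂ i j (PowerSeries.map PowerSeries.C g) = if i = 0 then extCoeff j g else 0 := by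
  rw [extCoeff₂_apply, extCoeff_map_C, extCoeff_C]

theorem extCoeff₂_diagHom_mul_map_C (f g : A⟦X⟧) (i j : ℤ) :
    extCoeff₂ i j (diagHom A f * PowerSeries.map PowerSeries.C g) =
      extCoeff i f * extCoeff (j - i) g := by
  rw [extCoeff₂_diagHom_mul (N := i.toNat + j.toNat + 1) _ _ _ (by omega)]
  simp only [extCoeff₂_map_C]
  rcases lt_or_ge i 0 with hi | hi
  · rw [extCoeff_of_neg _ hi, zero_mul]
    exact Finset.sum_eq_zero fun k _ => by rw [if_neg (by omega), mul_zero]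
  · obtain ⟨i, rfl⟩ := Int.eq_ofNat_of_zero_le hi
    rw [Finset.sum_eq_single i]
    · simp
    · intro k _ hk
      rw [if_neg (by omega), mul_zero]
    · intro h
      exact absurd (Finset.mem_range.2 (by omega)) h

theorem extCoeff₂_map_C_mul_diagHom (f g : A⟦X⟧) (i j : ℤ) :
    extCoeff₂ i j (PowerSeries.map PowerSeries.C g * diagHom A f) =
      extCoeff (j - i) g * extCoeff i f := by
  rw [extCoeff₂_mul_diagHom (N := i.toNat + j.toNat + 1) _ _ _ (by omega)]
  simp only [extCoeff₂_map_C]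
  rcases lt_or_ge i 0 with hi | hi
  · rw [extCoeff_of_neg _ hi, mul_zero]
    exact Finset.sum_eq_zero fun k _ => by rw [if_neg (by omega), zero_mul]
  · obtain ⟨i, rfl⟩ := Int.eq_ofNat_of_zero_le hi
    rw [Finset.sum_eq_single i]
    · simp
    · intro k _ hk
      rw [if_neg (by omega), zero_mul]
    · intro h
      exact absurd (Finset.mem_range.2 (by omega)) h

end Series

/-! ### The RLL relations as identities over double power series. -/

/-- The sign of the exponents of `u` in `L^±(u)`. -/
def Sgn.toInt : Sgn → ℤ
  | .plus => -1
  | .minus => 1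

section Expansion

variable {K A : Type*} [Field K] [Ring A] [Algebra K A]

theorem LOp.mode_apply {n : ℕ} (L : LOp n A) (μ : Sgn) (a : ℤ) (i j : Fin (2 * n)) :
    L.mode μ a i j = extCoeff (μ.toInt * a) (L μ i j) := by
  cases μ <;> simp [LOp.mode, extCoeff_apply, Sgn.toInt]

theorem C_map_algebraMap_central (r : K⟦X⟧) (t : A⟦X⟧⟦X⟧) :
    PowerSeries.C (PowerSeries.map (algebraMap K A) r) * t =
      t * PowerSeries.C (PowerSeries.map (algebraMap K A) r) := by
  refine commute_of_coeff (fun k t => ?_) t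
  rw [PowerSeries.coeff_C]
  split_ifs
  · refine commute_of_coeff (fun k t => ?_) t
    rw [PowerSeries.coeff_map]
    exact Algebra.commutes _ _
  · simp

theorem diagHom_map_algebraMap_central (r : K⟦X⟧) (t : A⟦X⟧⟦X⟧) :
    diagHom A (PowerSeries.map (algebraMap K A) r) * t =
      t * diagHom A (PowerSeries.map (algebraMap K A) r) := by
  refine commute_of_coeff (fun k t => ?_) t
  rw [coeff_diagHom]
  refine commute_of_coeff (fun l t => ?_) t
  rw [PowerSeries.coeff_monomial, PowerSeries.coeff_map]
  split_ifs
  · exact Algebra.commutes _ _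
  · simp

theorem extCoeff_congr {i j : ℤ} (h : i = j) (f : A⟦X⟧) : extCoeff i f = extCoeff j f := by
  rw [h]

/-- For every admissible expansion the two-variable series of the RLL relation live in a ring of
double power series. -/
theorem exists_expansion (K A : Type*) [Field K] [Ring A] [Algebra K A] (d : Dir) (μ ρ : Sgn)
    (h : d.Admissible μ ρ) :
    ∃ (γ : K⟦X⟧ →+* A⟦X⟧⟦X⟧) (α β : A⟦X⟧ →+* A⟦X⟧⟦X⟧) (e₁ e₂ : ℤ → ℤ → ℤ),
      (∀ r t, γ r * t = t * γ r) ∧ (∀ i j : ℕ, ∃ a b, e₁ a b = i ∧ e₂ a b = j) ∧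
      (∀ r f g a b, extCoeff₂ (e₁ a b) (e₂ a b) (γ r * (α f * β g)) =
        ∑ k ∈ Finset.range (a.natAbs + b.natAbs + 1), algebraMap K A (PowerSeries.coeff k r) *
          (extCoeff (μ.toInt * (a + d.exponent k)) f *
            extCoeff (ρ.toInt * (b - d.exponent k)) g)) ∧
      (∀ r f g a b, extCoeff₂ (e₁ a b) (e₂ a b) (γ r * (β g * α f)) =
        ∑ k ∈ Finset.range (a.natAbs + b.natAbs + 1), algebraMap K A (PowerSeries.coeff k r) *
          (extCoeff (ρ.toInt * (b - d.exponent k)) g *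
            extCoeff (μ.toInt * (a + d.exponent k)) f)) := by
  cases d <;> cases μ <;> cases ρ <;> simp only [Dir.Admissible] at h
  -- Let X be the inner and Y the outer variable; `PowerSeries.C` puts a series into X,
  -- `PowerSeries.map PowerSeries.C` into Y, and `diagHom` into XY. For (+,+) in powers of v/u: X =
  -- v/u and Y = v⁻¹, so u⁻¹ = XY and u^a v^b = X^{-a} Y^{-a-b}.
  · refine ⟨PowerSeries.C.comp (PowerSeries.map (algebraMap K A)), diagHom A, PowerSeries.map PowerSeries.C,
      fun a b => -a, fun a b => -a - b, C_map_algebraMap_central,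
      fun i j => ⟨-i, i - j, by simp, by simp⟩, ?_, ?_⟩
    · intro r f g a b
      rw [RingHom.comp_apply, extCoeff₂_C_mul (N := a.natAbs + b.natAbs + 1) _ _ _
        (by beta_reduce; omega)]
      refine Finset.sum_congr rfl fun k _ => ?_
      rw [extCoeff₂_diagHom_mul_map_C, PowerSeries.coeff_map]
      refine congrArg _ (congrArg₂ _ (extCoeff_congr ?_ _) (extCoeff_congr ?_ _)) <;>
        simp only [Sgn.toInt, Dir.exponent] <;> ring
    · intro r f g a b
      rw [RingHom.comp_apply, extCoeff₂_C_mul (N := a.natAbs + b.natAbs + 1) _ _ _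
        (by beta_reduce; omega)]
      refine Finset.sum_congr rfl fun k _ => ?_
      rw [extCoeff₂_map_C_mul_diagHom, PowerSeries.coeff_map]
      refine congrArg _ (congrArg₂ _ (extCoeff_congr ?_ _) (extCoeff_congr ?_ _)) <;>
        simp only [Sgn.toInt, Dir.exponent] <;> ring
  -- For (+,-): X = u⁻¹ and Y = v, so v/u = XY.
  · refine ⟨(diagHom A).comp (PowerSeries.map (algebraMap K A)), PowerSeries.C, PowerSeries.map PowerSeries.C,
      fun a b => -a, fun a b => b, diagHom_map_algebraMap_central,
      fun i j => ⟨-i, j, by simp, by simp⟩, ?_, ?_⟩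
    · intro r f g a b
      rw [RingHom.comp_apply, extCoeff₂_diagHom_mul (N := a.natAbs + b.natAbs + 1) _ _ _
        (by beta_reduce; omega)]
      refine Finset.sum_congr rfl fun k _ => ?_
      rw [extCoeff₂_C_mul_map_C, PowerSeries.coeff_map]
      refine congrArg _ (congrArg₂ _ (extCoeff_congr ?_ _) (extCoeff_congr ?_ _)) <;>
        simp only [Sgn.toInt, Dir.exponent] <;> ring
    · intro r f g a b
      rw [RingHom.comp_apply, extCoeff₂_diagHom_mul (N := a.natAbs + b.natAbs + 1) _ _ _
        (by beta_reduce; omega)]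
      refine Finset.sum_congr rfl fun k _ => ?_
      rw [extCoeff₂_map_C_mul_C, PowerSeries.coeff_map]
      refine congrArg _ (congrArg₂ _ (extCoeff_congr ?_ _) (extCoeff_congr ?_ _)) <;>
        simp only [Sgn.toInt, Dir.exponent] <;> ring
  -- For (-,-) in powers of v/u: X = v/u and Y = u, so v = XY.
  · refine ⟨PowerSeries.C.comp (PowerSeries.map (algebraMap K A)), PowerSeries.map PowerSeries.C, diagHom A,
      fun a b => b, fun a b => a + b, C_map_algebraMap_central,
      fun i j => ⟨j - i, i, by simp, by simp⟩, ?_, ?_⟩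
    · intro r f g a b
      rw [RingHom.comp_apply, extCoeff₂_C_mul (N := a.natAbs + b.natAbs + 1) _ _ _
        (by beta_reduce; omega)]
      refine Finset.sum_congr rfl fun k _ => ?_
      rw [extCoeff₂_map_C_mul_diagHom, PowerSeries.coeff_map]
      refine congrArg _ (congrArg₂ _ (extCoeff_congr ?_ _) (extCoeff_congr ?_ _)) <;>
        simp only [Sgn.toInt, Dir.exponent] <;> ring
    · intro r f g a b
      rw [RingHom.comp_apply, extCoeff₂_C_mul (N := a.natAbs + b.natAbs + 1) _ _ _
        (by beta_reduce; omega)]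
      refine Finset.sum_congr rfl fun k _ => ?_
      rw [extCoeff₂_diagHom_mul_map_C, PowerSeries.coeff_map]
      refine congrArg _ (congrArg₂ _ (extCoeff_congr ?_ _) (extCoeff_congr ?_ _)) <;>
        simp only [Sgn.toInt, Dir.exponent] <;> ring
  -- For (+,+) in powers of u/v: X = u/v and Y = u⁻¹, so v⁻¹ = XY.
  · refine ⟨PowerSeries.C.comp (PowerSeries.map (algebraMap K A)), PowerSeries.map PowerSeries.C, diagHom A,
      fun a b => -b, fun a b => -a - b, C_map_algebraMap_central,
      fun i j => ⟨i - j, -i, by simp, by simp⟩, ?_, ?_⟩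
    · intro r f g a b
      rw [RingHom.comp_apply, extCoeff₂_C_mul (N := a.natAbs + b.natAbs + 1) _ _ _
        (by beta_reduce; omega)]
      refine Finset.sum_congr rfl fun k _ => ?_
      rw [extCoeff₂_map_C_mul_diagHom, PowerSeries.coeff_map]
      refine congrArg _ (congrArg₂ _ (extCoeff_congr ?_ _) (extCoeff_congr ?_ _)) <;>
        simp only [Sgn.toInt, Dir.exponent] <;> ring
    · intro r f g a b
      rw [RingHom.comp_apply, extCoeff₂_C_mul (N := a.natAbs + b.natAbs + 1) _ _ _
        (by beta_reduce; omega)]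
      refine Finset.sum_congr rfl fun k _ => ?_
      rw [extCoeff₂_diagHom_mul_map_C, PowerSeries.coeff_map]
      refine congrArg _ (congrArg₂ _ (extCoeff_congr ?_ _) (extCoeff_congr ?_ _)) <;>
        simp only [Sgn.toInt, Dir.exponent] <;> ring
  -- For (-,+): X = u and Y = v⁻¹, so u/v = XY.
  · refine ⟨(diagHom A).comp (PowerSeries.map (algebraMap K A)), PowerSeries.C, PowerSeries.map PowerSeries.C,
      fun a b => a, fun a b => -b, diagHom_map_algebraMap_central,
      fun i j => ⟨i, -j, by simp, by simp⟩, ?_, ?_⟩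
    · intro r f g a b
      rw [RingHom.comp_apply, extCoeff₂_diagHom_mul (N := a.natAbs + b.natAbs + 1) _ _ _
        (by beta_reduce; omega)]
      refine Finset.sum_congr rfl fun k _ => ?_
      rw [extCoeff₂_C_mul_map_C, PowerSeries.coeff_map]
      refine congrArg _ (congrArg₂ _ (extCoeff_congr ?_ _) (extCoeff_congr ?_ _)) <;>
        simp only [Sgn.toInt, Dir.exponent] <;> ring
    · intro r f g a b
      rw [RingHom.comp_apply, extCoeff₂_diagHom_mul (N := a.natAbs + b.natAbs + 1) _ _ _
        (by beta_reduce; omega)]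
      refine Finset.sum_congr rfl fun k _ => ?_
      rw [extCoeff₂_map_C_mul_C, PowerSeries.coeff_map]
      refine congrArg _ (congrArg₂ _ (extCoeff_congr ?_ _) (extCoeff_congr ?_ _)) <;>
        simp only [Sgn.toInt, Dir.exponent] <;> ring
  -- For (-,-) in powers of u/v: X = u/v and Y = v, so u = XY.
  · refine ⟨PowerSeries.C.comp (PowerSeries.map (algebraMap K A)), diagHom A, PowerSeries.map PowerSeries.C,
      fun a b => a, fun a b => a + b, C_map_algebraMap_central,
      fun i j => ⟨i, j - i, by simp, by simp⟩, ?_, ?_⟩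
    · intro r f g a b
      rw [RingHom.comp_apply, extCoeff₂_C_mul (N := a.natAbs + b.natAbs + 1) _ _ _
        (by beta_reduce; omega)]
      refine Finset.sum_congr rfl fun k _ => ?_
      rw [extCoeff₂_diagHom_mul_map_C, PowerSeries.coeff_map]
      refine congrArg _ (congrArg₂ _ (extCoeff_congr ?_ _) (extCoeff_congr ?_ _)) <;>
        simp only [Sgn.toInt, Dir.exponent] <;> ring
    · intro r f g a b
      rw [RingHom.comp_apply, extCoeff₂_C_mul (N := a.natAbs + b.natAbs + 1) _ _ _
        (by beta_reduce; omega)]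
      refine Finset.sum_congr rfl fun k _ => ?_
      rw [extCoeff₂_map_C_mul_diagHom, PowerSeries.coeff_map]
      refine congrArg _ (congrArg₂ _ (extCoeff_congr ?_ _) (extCoeff_congr ?_ _)) <;>
        simp only [Sgn.toInt, Dir.exponent] <;> ring

/-- The embeddings γ, α, β are chosen before n and L, so the same ones serve for L and for the
reduced operator of lower rank. -/
theorem rll_iff {d : Dir} {μ ρ : Sgn} (h : d.Admissible μ ρ) :
    ∃ (γ : K⟦X⟧ →+* A⟦X⟧⟦X⟧) (α β : A⟦X⟧ →+* A⟦X⟧⟦X⟧), (∀ r t, γ r * t = t * γ r) ∧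
      ∀ (n : ℕ) (p : K) (r : Mat2 n K⟦X⟧) (L : LOp n A),
        (∀ k x y, RCoeff n p d k x y = PowerSeries.coeff k (r x y)) →
        ((∀ a b, rllLeft p d L μ ρ a b = rllRight p d L μ ρ a b) ↔
          RLLEntries γ r ((L μ).map α) ((L ρ).map β)) := by
  obtain ⟨γ, α, β, e₁, e₂, hγ, he, hl, hr⟩ := exists_expansion K A d μ ρ h
  refine ⟨γ, α, β, hγ, fun n p r L hc => ?_⟩
  have left : ∀ a b x y, rllLeft p d L μ ρ a b x y = extCoeff₂ (e₁ a b) (e₂ a b)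
      (∑ z, γ (r x z) * ((L μ).map α z.1 y.1 * (L ρ).map β z.2 y.2)) := by
    intro a b x y
    rw [map_sum, rllLeft, Matrix.sum_apply]
    simp only [Matrix.map_apply, hl]
    rw [Finset.sum_comm]
    refine Finset.sum_congr rfl fun k _ => ?_
    rw [Matrix.mul_assoc, Matrix.mul_apply]
    refine Finset.sum_congr rfl fun z _ => ?_
    rw [Matrix.map_apply, hc, ← LOp.mode_apply, ← LOp.mode_apply]
    congr 1
    exact tensorLeft_mul_tensorRight_apply _ _ _ _
  have right : ∀ a b x y, rllRight p d L μ ρ a b x y = extCoeff₂ (e₁ a b) (e₂ a b)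
      (∑ z, γ (r z y) * ((L ρ).map β x.2 z.2 * (L μ).map α x.1 z.1)) := by
    intro a b x y
    rw [map_sum, rllRight, Matrix.sum_apply]
    simp only [Matrix.map_apply, hr]
    rw [Finset.sum_comm]
    refine Finset.sum_congr rfl fun k _ => ?_
    rw [Matrix.mul_apply]
    refine Finset.sum_congr rfl fun z _ => ?_
    rw [Matrix.map_apply, hc, ← LOp.mode_apply, ← LOp.mode_apply, Algebra.commutes]
    congr 1
    exact tensorRight_mul_tensorLeft_apply _ _ _ _
  constructor
  · intro H x y
    refine ext_of_extCoeff₂ fun i j => ?_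
    obtain ⟨a, b, h1, h2⟩ := he i j
    rw [← h1, ← h2, ← left, ← right, H]
  · intro H a b
    ext x y
    rw [left, right, H x y]

end Expansion

/-! ### Invertibility of matrices of power series. -/

section MatrixUnits

variable {ι A : Type*} [Fintype ι] [DecidableEq ι] [Ring A]

/-- Matrices of power series are power series of matrices. -/
noncomputable def matrixSeriesEquiv (ι A : Type*) [Fintype ι] [DecidableEq ι] [Ring A] :
    Matrix ι ι A⟦X⟧ ≃+* (Matrix ι ι A)⟦X⟧ where
  toFun X := PowerSeries.mk fun k => X.map (PowerSeries.coeff k)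
  invFun s := Matrix.of fun i j => PowerSeries.mk fun k => PowerSeries.coeff k s i j
  left_inv X := by ext; simp
  right_inv s := by ext; simp
  map_add' X Y := by ext; simp
  map_mul' X Y := by
    ext k i j
    simp only [PowerSeries.coeff_mk, Matrix.map_apply, Matrix.mul_apply, PowerSeries.coeff_mul,
      map_sum, Matrix.sum_apply]
    exact Finset.sum_comm

/-- Viewed as a power series over the matrix ring, X is a unit as soon as its constant term is one.
-/
theorem isUnit_of_isUnit_map_constantCoeff {X : Matrix ι ι A⟦X⟧}
    (h : IsUnit (X.map PowerSeries.constantCoeff)) : IsUnit X := by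
  rw [← isUnit_map_iff (matrixSeriesEquiv ι A), PowerSeries.isUnit_iff_constantCoeff]
  convert h using 1
  ext
  simp [matrixSeriesEquiv]

/-- A non-zero entry of Z strictly raises the height h from row to column, so a non-zero entry of Z
^ k raises it by at least k. -/
theorem isNilpotent_of_strict {Z : Matrix ι ι A} (h : ι → ℕ)
    (hZ : ∀ i j, h j ≤ h i → Z i j = 0) : IsNilpotent Z := by
  have key : ∀ k i j, h j < h i + k → (Z ^ k) i j = 0 := by
    intro k
    induction k with
    | zero =>
      intro i j hij
      rw [pow_zero, Matrix.one_apply, if_neg]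
      rintro rfl
      omega
    | succ k ih =>
      intro i j hij
      rw [pow_succ, Matrix.mul_apply]
      refine Finset.sum_eq_zero fun l _ => ?_
      rcases le_or_gt (h j) (h l) with hl | hl
      · rw [hZ l j hl, mul_zero]
      · rw [ih i l (by omega), zero_mul]
  -- Any exponent above all heights works; the sum of the heights plus one is a convenient choice.
  refine ⟨∑ j, h j + 1, ?_⟩
  ext i j
  refine key _ i j ?_
  have := Finset.single_le_sum (fun j _ => Nat.zero_le (h j)) (Finset.mem_univ j)
  omega

/-- Y = D (1 + Z) with D the invertible diagonal and Z nilpotent. The height h covers upper and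
lower triangular matrices at once. -/
theorem isUnit_of_triangular {Y : Matrix ι ι A} (h : ι → ℕ)
    (hY : ∀ i j, i ≠ j → h j ≤ h i → Y i j = 0) (hd : ∀ i, IsUnit (Y i i)) : IsUnit Y := by
  choose d hd using hd
  have hD : IsUnit (Matrix.diagonal fun i => (d i : A)) :=
    (Pi.isUnit_iff.2 fun i => (d i).isUnit).map (Matrix.diagonalRingHom ι A)
  have hZ : IsNilpotent (Matrix.of fun i j => if i = j then 0 else (↑(d i)⁻¹ : A) * Y i j) := by
    refine isNilpotent_of_strict h fun i j hij => ?_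
    rw [Matrix.of_apply]
    split_ifs with hne
    · rfl
    · rw [hY i j hne hij, mul_zero]
  convert hD.mul hZ.isUnit_one_add
  ext i j
  rw [Matrix.diagonal_mul, Matrix.add_apply, Matrix.of_apply, Matrix.one_apply]
  split_ifs with hij
  · subst hij; simp [hd]
  · simp

end MatrixUnits

/-! ### Zero modes and RLL relations of the reduced L-operators. -/

section ReducedL

variable {A : Type*} [Ring A] {n : ℕ}

theorem ZeroModes.isUnit_constantCoeff_diag {L : LOp n A} (h : ZeroModes L) (μ : Sgn)
    (i : Fin (2 * n)) : IsUnit (PowerSeries.constantCoeff (L μ i i)) := by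
  cases μ
  · exact ⟨⟨_, _, h.plus_mul_minus i, h.minus_mul_plus i⟩, rfl⟩
  · exact ⟨⟨_, _, h.minus_mul_plus i, h.plus_mul_minus i⟩, rfl⟩

theorem ZeroModes.isUnit_diag {L : LOp n A} (h : ZeroModes L) (μ : Sgn)
    (i : Fin (2 * n)) : IsUnit (L μ i i) :=
  PowerSeries.isUnit_iff_constantCoeff.2 (h.isUnit_constantCoeff_diag μ i)

/-- The zero modes of L^+ are upper and those of L^- lower triangular; after transposition the
heights are 2n - i and i respectively. -/
theorem ZeroModes.isUnit_transpose {L : LOp n A} (h : ZeroModes L) (μ : Sgn) :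
    IsUnit (L μ).transpose := by
  refine isUnit_of_isUnit_map_constantCoeff ?_
  cases μ
  · refine isUnit_of_triangular (fun i => 2 * n - i) (fun i j hij hle => ?_)
      (fun i => h.isUnit_constantCoeff_diag _ i)
    have := Fin.val_ne_of_ne hij
    exact h.plus i j (Fin.lt_def.2 (by omega))
  · refine isUnit_of_triangular (fun i => i) (fun i j hij hle => ?_)
      (fun i => h.isUnit_constantCoeff_diag _ i)
    have := Fin.val_ne_of_ne hij
    exact h.minus j i (Fin.lt_def.2 (by omega))

theorem first_lt_inner (n : ℕ) (i : Fin (2 * n)) : firstIdx n < innerIdx n i := by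
  simp [firstIdx, innerIdx, Fin.lt_def]

/-- In the subtracted term the zero mode of L_{i1} vanishes for the sign + and that of L_{1j} for
the sign -, so M inherits its zero modes unchanged. -/
theorem ZeroModes.constantCoeff_reducedL {L : LOp (n + 1) A} (h : ZeroModes L) (μ : Sgn)
    (i j : Fin (2 * n)) : PowerSeries.constantCoeff (reducedL L μ i j) =
      PowerSeries.constantCoeff (L μ (innerIdx n i) (innerIdx n j)) := by
  rw [reducedL, Matrix.of_apply, map_sub, map_mul, map_mul]
  cases μ
  · rw [h.plus _ _ (first_lt_inner n i), mul_zero, sub_zero]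
  · rw [h.minus _ _ (first_lt_inner n j), zero_mul, zero_mul, sub_zero]

theorem ZeroModes.reducedL {L : LOp (n + 1) A} (h : ZeroModes L) : ZeroModes (reducedL L) where
  plus i j hij := by
    rw [h.constantCoeff_reducedL]
    exact h.plus _ _ (Nat.add_lt_add_right hij 1)
  minus i j hij := by
    rw [h.constantCoeff_reducedL]
    exact h.minus _ _ (Nat.add_lt_add_right hij 1)
  plus_mul_minus i := by
    rw [h.constantCoeff_reducedL, h.constantCoeff_reducedL]
    exact h.plus_mul_minus _
  minus_mul_plus i := by
    rw [h.constantCoeff_reducedL, h.constantCoeff_reducedL]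
    exact h.minus_mul_plus _

theorem reducedL_map {T : Type*} [Ring T] (L : LOp (n + 1) A) (μ : Sgn) (α : A⟦X⟧ →+* T) :
    (TwistedD.reducedL L μ).map α = reducedMat ((L μ).map α)
      (α (Ring.inverse (L μ (firstIdx n) (firstIdx n)))) := by
  ext i j
  simp [TwistedD.reducedL, reducedMat]

theorem isUnit_transpose_map {ι S T : Type*} [Fintype ι] [DecidableEq ι] [Ring S] [Ring T]
    (α : S →+* T) {X : Matrix ι ι S} (h : IsUnit X.transpose) : IsUnit (X.map α).transpose :=
  h.map α.mapMatrix

/-- The reduction of the RLL relations, given the required properties of the R-matrices. -/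
theorem RLL.reducedL {K : Type*} [Field K] [Algebra K A] {p : K} {L : LOp (n + 1) A}
    (hL : ZeroModes L)
    (hR : ∀ d, ∃ (r : Mat2 (n + 1) K⟦X⟧) (s : K⟦X⟧),
      s * r (lastIdx n, firstIdx n) (lastIdx n, firstIdx n) = 1 ∧
      (∀ x y, idxDeg n x.1 + idxDeg n x.2 ≠ idxDeg n y.1 + idxDeg n y.2 → r x y = 0) ∧
      (∀ k x y, RCoeff (n + 1) p d k x y = PowerSeries.coeff k (r x y)) ∧
      (∀ k x y, RCoeff n p d k x y = PowerSeries.coeff k (schurR r s x y)))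
    (h : RLL p L) : RLL p (reducedL L) := by
  intro d μ ρ hd
  obtain ⟨r, s, hs, hdeg, hc, hc'⟩ := hR d
  obtain ⟨γ, α, β, hγ, key⟩ := rll_iff (K := K) (A := A) hd
  rw [key _ _ _ _ hc', reducedL_map, reducedL_map]
  have h1 := (key _ _ _ _ hc).1 (h d μ ρ hd)
  have hu := fun μ => Ring.inverse_mul_cancel _ (hL.isUnit_diag μ (firstIdx n))
  have hu' := fun μ => Ring.mul_inverse_cancel _ (hL.isUnit_diag μ (firstIdx n))
  refine RLLEntries.reduced hγ hs hdeg ?_ ?_ ?_ ?_ ?_ ?_ h1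
  · rw [Matrix.map_apply, ← map_mul, hu, map_one]
  · rw [Matrix.map_apply, ← map_mul, hu', map_one]
  · rw [Matrix.map_apply, ← map_mul, hu, map_one]
  · rw [Matrix.map_apply, ← map_mul, hu', map_one]
  · rw [← reducedL_map]
    exact isUnit_transpose_map _ (hL.reducedL.isUnit_transpose μ)
  · rw [← reducedL_map]
    exact isUnit_transpose_map _ (hL.reducedL.isUnit_transpose ρ)

end ReducedL

/-! ### The middle indices and their behaviour under the change of rank. -/

/-- The involution exchanging the middle indices. -/
def midSwap (n : ℕ) (i : Fin (2 * n)) : Fin (2 * n) := if Mid n i then i.rev else i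

theorem mid_rev {n : ℕ} {i : Fin (2 * n)} : Mid n i.rev ↔ Mid n i := by
  simp only [Mid, Fin.val_rev]; omega

theorem midSwap_of_mid {n : ℕ} {i : Fin (2 * n)} (h : Mid n i) : midSwap n i = i.rev := if_pos h

theorem midSwap_of_not_mid {n : ℕ} {i : Fin (2 * n)} (h : ¬ Mid n i) : midSwap n i = i := if_neg h

theorem mid_midSwap {n : ℕ} {i : Fin (2 * n)} : Mid n (midSwap n i) ↔ Mid n i := by
  unfold midSwap; split_ifs with h
  · exact mid_rev
  · rfl

@[simp] theorem midSwap_midSwap {n : ℕ} (i : Fin (2 * n)) : midSwap n (midSwap n i) = i := by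
  by_cases h : Mid n i
  · rw [midSwap_of_mid (mid_midSwap.2 h), midSwap_of_mid h, Fin.rev_rev]
  · rw [midSwap_of_not_mid h, midSwap_of_not_mid h]

theorem rev_ne_self {n : ℕ} (i : Fin (2 * n)) : i.rev ≠ i := by
  simp only [ne_eq, Fin.ext_iff, Fin.val_rev]; omega

theorem midSwap_eq_comm {n : ℕ} {i j : Fin (2 * n)} : midSwap n i = j ↔ i = midSwap n j :=
  ⟨fun h => by rw [← h, midSwap_midSwap], fun h => by rw [h, midSwap_midSwap]⟩

theorem mid_inner {n : ℕ} {i : Fin (2 * n)} : Mid (n + 1) (innerIdx n i) ↔ Mid n i := by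
  simp only [Mid, innerIdx]; omega

theorem rev_inner {n : ℕ} (i : Fin (2 * n)) : (innerIdx n i).rev = innerIdx n i.rev := by
  simp only [innerIdx, Fin.ext_iff, Fin.val_rev]; omega

theorem rev_first (n : ℕ) : (firstIdx n).rev = lastIdx n := by
  simp only [firstIdx, lastIdx, Fin.ext_iff, Fin.val_rev]; omega

theorem rev_last (n : ℕ) : (lastIdx n).rev = firstIdx n := by
  rw [← rev_first, Fin.rev_rev]

theorem midSwap_inner {n : ℕ} (i : Fin (2 * n)) :
    midSwap (n + 1) (innerIdx n i) = innerIdx n (midSwap n i) := by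
  simp only [midSwap, mid_inner, rev_inner]
  split_ifs <;> rfl

theorem not_mid_first {n : ℕ} (hn : 1 ≤ n) : ¬ Mid (n + 1) (firstIdx n) := by
  simp only [Mid, firstIdx]; omega

theorem not_mid_last {n : ℕ} (hn : 1 ≤ n) : ¬ Mid (n + 1) (lastIdx n) := by
  simp only [Mid, lastIdx]; omega

theorem twoBar_inner {n : ℕ} (i : Fin (2 * n)) : twoBar (n + 1) (innerIdx n i) = twoBar n i := by
  simp only [twoBar, innerIdx]
  split_ifs <;> push_cast <;> omega

theorem twoBar_of_mid {n : ℕ} {i : Fin (2 * n)} (h : Mid n i) : twoBar n i = 0 := by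
  simp only [twoBar, Mid] at *
  split_ifs <;> omega

theorem idxDeg_rev {n : ℕ} (i : Fin (2 * (n + 1))) : idxDeg n i.rev = -idxDeg n i := by
  rcases idx_cases i with rfl | rfl | ⟨a, rfl⟩ <;> simp [rev_first, rev_last, rev_inner]

theorem idxDeg_midSwap {n : ℕ} (hn : 1 ≤ n) (i : Fin (2 * (n + 1))) :
    idxDeg n (midSwap (n + 1) i) = idxDeg n i := by
  rcases idx_cases i with rfl | rfl | ⟨a, rfl⟩
  · rw [midSwap_of_not_mid (not_mid_first hn)]
  · rw [midSwap_of_not_mid (not_mid_last hn)]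
  · rw [midSwap_inner, idxDeg_inner, idxDeg_inner]

/-! ### Matrices acting on the two middle basis vectors. -/

section MidMat

variable {F : Type*} [Field F]

/-- The matrix which is the identity outside of the middle rows and columns, with the middle block
`(α, β; β, α)`. -/
def midMat (n : ℕ) (α β : F) : Matrix (Fin (2 * n)) (Fin (2 * n)) F :=
  Matrix.of fun i j => (if i = j then (if Mid n i then α else 1) else 0) +
    (if midSwap n i = j then (if Mid n i then β else 0) else 0)

/-- On the middle block these matrices are α + β U with U² = 1, hence they commute and are
determined by the eigenvalues α ± β on e_n ± e_{n+1}. The twists, U and `rankTwist` are all of this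
kind. -/
theorem midMat_mul (n : ℕ) (α β α' β' : F) :
    midMat n α β * midMat n α' β' = midMat n (α * α' + β * β') (α * β' + β * α') := by
  ext i j
  simp only [midMat, Matrix.mul_apply, Matrix.of_apply, add_mul, Finset.sum_add_distrib, ite_mul,
    zero_mul, Finset.sum_ite_eq, Finset.mem_univ, if_true, mid_midSwap, midSwap_midSwap]
  by_cases h : Mid n i
  · have hne : midSwap n i ≠ i := by rw [midSwap_of_mid h]; exact rev_ne_self i
    by_cases h1 : i = j
    · subst h1; simp [h, hne]
    · by_cases h2 : midSwap n i = j
      · subst h2; simp [h, hne.symm]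
      · simp [h, h1, h2]
  · simp [h]

theorem midMat_one_zero (n : ℕ) : midMat n (1 : F) 0 = 1 := by
  ext i j
  simp [midMat, Matrix.one_apply]

theorem midMat_apply_swap {n : ℕ} (α β : F) (i j : Fin (2 * n)) : midMat n α β i j =
    (if j = i then (if Mid n j then α else 1) else 0) +
    (if midSwap n j = i then (if Mid n j then β else 0) else 0) := by
  simp only [midMat, Matrix.of_apply]
  congr 1
  · by_cases h : i = j
    · simp [h]
    · simp [h, Ne.symm h]
  · by_cases h : midSwap n i = j
    · subst h; simp [mid_midSwap]
    · rw [if_neg h, if_neg fun h' => h (by rw [← h', midSwap_midSwap])]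

/-- The weights of `i` and of `midSwap n i` in the `i`th column of `midMat n α β`. -/
def midWeight (n : ℕ) (α β : F) (i : Fin (2 * n)) : F × F :=
  if Mid n i then (α, β) else (1, 0)

theorem sum_two_points {ι : Type*} [Fintype ι] [DecidableEq ι] (i j i' j' : ι) (a b a' b' : F)
    (g : ι × ι → F) :
    ∑ z : ι × ι, ((if i = z.1 then a else 0) + (if j = z.1 then b else 0)) *
      ((if i' = z.2 then a' else 0) + (if j' = z.2 then b' else 0)) * g z =
    a * (a' * g (i, i') + b' * g (i, j')) + b * (a' * g (j, i') + b' * g (j, j')) := by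
  simp only [Fintype.sum_prod_type, add_mul, mul_add, ite_mul, mul_ite, zero_mul, mul_zero,
    Finset.sum_add_distrib, Finset.sum_ite_eq,
    Finset.mem_univ, if_true]
  ring

theorem midMat_kron_mul_apply {n : ℕ} (α β : F) (Y : Mat2 n F) (x y : Fin (2 * n) × Fin (2 * n)) :
    ((midMat n α β ⊗ₖ midMat n α β) * Y) x y =
      (midWeight n α β x.1).1 * ((midWeight n α β x.2).1 * Y x y +
        (midWeight n α β x.2).2 * Y (x.1, midSwap n x.2) y) +
      (midWeight n α β x.1).2 * ((midWeight n α β x.2).1 * Y (midSwap n x.1, x.2) y +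
        (midWeight n α β x.2).2 * Y (midSwap n x.1, midSwap n x.2) y) := by
  have h : ∀ i j, midMat n α β i j = (if i = j then (midWeight n α β i).1 else 0) +
      (if midSwap n i = j then (midWeight n α β i).2 else 0) := by
    intro i j
    simp only [midMat, Matrix.of_apply, midWeight]
    split_ifs <;> rfl
  simp only [Matrix.mul_apply, Matrix.kroneckerMap_apply, h]
  exact sum_two_points _ _ _ _ _ _ _ _ fun z => Y z y

theorem mul_midMat_kron_apply {n : ℕ} (α β : F) (Y : Mat2 n F) (x y : Fin (2 * n) × Fin (2 * n)) :
    (Y * (midMat n α β ⊗ₖ midMat n α β)) x y =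
      (midWeight n α β y.1).1 * ((midWeight n α β y.2).1 * Y x y +
        (midWeight n α β y.2).2 * Y x (y.1, midSwap n y.2)) +
      (midWeight n α β y.1).2 * ((midWeight n α β y.2).1 * Y x (midSwap n y.1, y.2) +
        (midWeight n α β y.2).2 * Y x (midSwap n y.1, midSwap n y.2)) := by
  have h : ∀ i j, midMat n α β i j = (if j = i then (midWeight n α β j).1 else 0) +
      (if midSwap n j = i then (midWeight n α β j).2 else 0) := by
    intro i j
    rw [midMat_apply_swap]
    simp only [midWeight]
    split_ifs <;> rfl
  simp only [Matrix.mul_apply, Matrix.kroneckerMap_apply, h, mul_comm (Y x _)]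
  exact sum_two_points _ _ _ _ _ _ _ _ fun z => Y x z

theorem twist_eq_midMat (n : ℕ) (p : F) : twist n p = midMat n (aCoeff n p 1) (aCoeff n p (-1)) := by
  ext i j
  have hr : i = j.rev ↔ i.rev = j := by rw [← Fin.rev_inj, Fin.rev_rev]
  simp only [twist, midMat, Matrix.of_apply, midSwap, hr]
  by_cases h : Mid n i
  · simp only [h, if_true, not_true, false_and, and_false, if_false, true_and, zero_add]
    by_cases h1 : i = j
    · subst h1; simp [h]
    · by_cases h2 : i.rev = j
      · subst h2; simp [h, mid_rev]
      · simp [h1, h2]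
  · by_cases h1 : i = j
    · subst h1; simp [h]
    · simp [h, h1]

theorem UMat_eq (n : ℕ) : UMat n F = midMat n 0 1 := by
  ext i j
  have hr : i = j.rev ↔ i.rev = j := by rw [← Fin.rev_inj, Fin.rev_rev]
  simp only [UMat, midMat, Matrix.of_apply, midSwap, hr]
  by_cases h : Mid n i
  · simp only [h, if_true, not_true, false_and, and_false, if_false, true_and, zero_add, ite_self]
    by_cases h2 : i.rev = j
    · subst h2; simp [h, mid_rev]
    · simp [h2]
  · by_cases h1 : i = j
    · subst h1; simp [h]
    · simp [h, h1]

theorem UMat_apply (n : ℕ) (i j : Fin (2 * n)) :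
    UMat n F i j = if midSwap n i = j then 1 else 0 := by
  rw [UMat_eq, midMat, Matrix.of_apply]
  by_cases h : Mid n i
  · simp [h]
  · simp [h, midSwap_of_not_mid h]

theorem UMat_apply' (n : ℕ) (i j : Fin (2 * n)) :
    UMat n F i j = if midSwap n j = i then 1 else 0 := by
  rw [UMat_apply]
  simp only [midSwap_eq_comm (i := j), eq_comm (a := j)]

theorem UMat_conj_apply {n : ℕ} (Y : Mat2 n F) (x y : Fin (2 * n) × Fin (2 * n)) :
    ((UMat n F ⊗ₖ (1 : Matrix (Fin (2 * n)) (Fin (2 * n)) F)) * Y *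
      (UMat n F ⊗ₖ (1 : Matrix (Fin (2 * n)) (Fin (2 * n)) F))) x y =
      Y (midSwap n x.1, x.2) (midSwap n y.1, y.2) := by
  have h1 : ∀ (Y : Mat2 n F) (x y : Fin (2 * n) × Fin (2 * n)), ((UMat n F ⊗ₖ (1 : Matrix (Fin (2 * n)) (Fin (2 * n)) F)) * Y) x y = Y (midSwap n x.1, x.2) y := by
    intro Y x y
    simp [Matrix.mul_apply, Fintype.sum_prod_type, UMat_apply, Matrix.one_apply]
  have h2 : ∀ (Y : Mat2 n F) (x y : Fin (2 * n) × Fin (2 * n)), (Y *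
      (UMat n F ⊗ₖ (1 : Matrix (Fin (2 * n)) (Fin (2 * n)) F))) x y = Y x (midSwap n y.1, y.2) := by
    intro Y x y
    simp [Matrix.mul_apply, Fintype.sum_prod_type, UMat_apply', Matrix.one_apply]
  rw [h2, h1]

end MidMat

/-! ### Entries of Jimbo's R-matrix in independent parameters u, v, w. -/

section Entries

variable {F : Type*} [Field F]

theorem PMat_apply (n : ℕ) (p u v : F) (x y : Fin (2 * n) × Fin (2 * n)) :
    PMat n p u v x y = if x.1 = y.2 ∧ x.2 = y.1 then pFun (p ^ 4) x.2 x.1 u v else 0 := by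
  simp only [PMat, Matrix.sum_apply, Matrix.smul_apply, Matrix.kroneckerMap_apply,
    Matrix.single_apply, smul_eq_mul]
  rw [Finset.sum_eq_single x.2, Finset.sum_eq_single x.1]
  · by_cases h1 : x.1 = y.2 <;> by_cases h2 : x.2 = y.1 <;> simp [h1, h2]
  · intro b _ hb; simp [hb]
  · simp
  · intro b _ hb; simp [hb]
  · simp

theorem QMat_apply (n : ℕ) (p u v : F) (x y : Fin (2 * n) × Fin (2 * n)) :
    QMat n p u v x y =
      if x.1 = x.2.rev ∧ y.1 = y.2.rev then qFun n p x.2 y.2 u v else 0 := by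
  simp only [QMat, Matrix.sum_apply, Matrix.smul_apply, Matrix.kroneckerMap_apply,
    Matrix.single_apply, smul_eq_mul]
  rw [Finset.sum_eq_single x.2, Finset.sum_eq_single y.2]
  · by_cases h1 : x.1 = x.2.rev <;> by_cases h2 : y.1 = y.2.rev <;>
      simp [h1, h2, eq_comm (b := x.1), eq_comm (b := y.1)]
  · intro b _ hb; simp [hb]
  · simp
  · intro b _ hb; simp [hb]
  · simp

/-- The functions `q_{ij}` with `vξ/u` replaced by a parameter `w`. -/
def qPar (n : ℕ) (p w : F) (i j : Fin (2 * n)) : F :=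
  (p ^ 2) ^ (twoBar n i - twoBar n j) * pFun (p ^ 4) j i w 1 -
    if twoBar n i = twoBar n i.rev ∧ i = j then p ^ 4 - 2 + (p ^ 4)⁻¹ else 0

/-- The entries of Jimbo's R-matrix in terms of `u`, `v` and `w = vξ/u`. -/
def rPar (n : ℕ) (p u v w : F) (x y : Fin (2 * n) × Fin (2 * n)) : F :=
  (if x = y then 1 else 0) +
  (1 / 2) * (if x.1 = y.2 ∧ x.2 = y.1 then pFun (p ^ 4) x.2 x.1 u v else 0) +
  (1 / 2) * (if midSwap n x.1 = y.2 ∧ x.2 = midSwap n y.1 then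
    pFun (p ^ 4) x.2 (midSwap n x.1) (-u) v else 0) +
  (1 / 2) * (if x.1 = x.2.rev ∧ y.1 = y.2.rev then qPar n p w x.2 y.2 else 0) +
  (1 / 2) * (if midSwap n x.1 = x.2.rev ∧ midSwap n y.1 = y.2.rev then
    qPar n p (-w) x.2 y.2 else 0)

theorem pFun_homogeneous {N : ℕ} (q : F) (i j : Fin N) {u : F} (hu : u ≠ 0) (z : F) :
    pFun q i j z u = pFun q i j (z / u) 1 := by
  have h : z / u - 1 = (z - u) / u := by field_simp
  simp only [pFun, fFun, gFun, gtFun, h]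
  -- At the pole z = u both sides agree because division by zero has the value 0.
  rcases eq_or_ne (z - u) 0 with h0 | h0
  · simp [h0]
  · split_ifs <;> field_simp

theorem qFun_eq_qPar (n : ℕ) (p : F) (i j : Fin (2 * n)) {u : F} (hu : u ≠ 0) (v : F) :
    qFun n p i j u v = qPar n p (v * xi n p / u) i j := by
  rw [qFun, qPar, pFun_homogeneous _ _ _ hu]

theorem RJimbo_apply (n : ℕ) (p : F) {u : F} (hu : u ≠ 0) (v : F) (h2 : (2 : F) ≠ 0)
    (x y : Fin (2 * n) × Fin (2 * n)) :
    RJimbo n p u v x y = rPar n p u v (v * xi n p / u) x y := by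
  have h1 : (1 : Mat2 n F) (midSwap n x.1, x.2) (midSwap n y.1, y.2) = (1 : Mat2 n F) x y := by
    simp only [Matrix.one_apply, Prod.ext_iff, midSwap_eq_comm, midSwap_midSwap]
  rw [RJimbo, Matrix.add_apply, Matrix.smul_apply, Matrix.smul_apply, UMat_conj_apply]
  simp only [Matrix.add_apply, h1, PMat_apply, QMat_apply, qFun_eq_qPar n p _ _ hu,
    qFun_eq_qPar n p _ _ (neg_ne_zero.2 hu), div_neg, rPar, smul_eq_mul, Matrix.one_apply]
  have h3 : (1 / 2 : F) + 1 / 2 = 1 := by field_simp; norm_num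
  linear_combination (if x = y then 1 else 0 : F) * h3

/-- The rank enters Jimbo's matrix only through ξ, that is through w, since ī, i' and the middle
indices are compatible with the shift of the indices. With w as a free parameter the inner block is
therefore independent of the rank. -/
theorem rPar_inner (n : ℕ) (p u v w : F) (x y : Fin (2 * n) × Fin (2 * n)) :
    rPar (n + 1) p u v w (innerIdx n x.1, innerIdx n x.2) (innerIdx n y.1, innerIdx n y.2) =
      rPar n p u v w x y := by
  have hp : ∀ i j z t, pFun (p ^ 4) (innerIdx n i) (innerIdx n j) z t = pFun (p ^ 4) i j z t := by
    intro i j z t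
    have hlt : innerIdx n i < innerIdx n j ↔ i < j := Nat.add_lt_add_iff_right
    simp only [pFun, innerIdx_inj, hlt]
  have hq : ∀ i j w, qPar (n + 1) p w (innerIdx n i) (innerIdx n j) = qPar n p w i j := by
    intro i j w
    simp only [qPar, rev_inner, twoBar_inner, hp, innerIdx_inj]
  simp only [rPar, midSwap_inner, rev_inner, innerIdx_inj, hp, hq, Prod.ext_iff]

theorem qPar_inner_first {n : ℕ} (p w : F) (b : Fin (2 * n)) :
    qPar (n + 1) p w (innerIdx n b) (firstIdx n) =
      (p ^ 2) ^ (twoBar n b - twoBar (n + 1) (firstIdx n)) * gtFun (p ^ 4) w 1 := by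
  rw [qPar, if_neg (by simp [inner_ne_first]), twoBar_inner, pFun,
    if_neg (inner_ne_first n b).symm, if_pos (first_lt_inner n b), sub_zero]

theorem qPar_first_inner {n : ℕ} (p w : F) (b : Fin (2 * n)) :
    qPar (n + 1) p w (firstIdx n) (innerIdx n b) =
      (p ^ 2) ^ (twoBar (n + 1) (firstIdx n) - twoBar n b) * gFun (p ^ 4) w 1 := by
  rw [qPar, if_neg (by simp [(inner_ne_first n _).symm]), twoBar_inner, pFun,
    if_neg (inner_ne_first n b), if_neg (first_lt_inner n b).not_gt, sub_zero]

theorem qPar_first_first {n : ℕ} (hn : 1 ≤ n) (p w : F) :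
    qPar (n + 1) p w (firstIdx n) (firstIdx n) = fFun (p ^ 4) w 1 - 1 := by
  have : ¬ (twoBar (n + 1) (firstIdx n) = twoBar (n + 1) (lastIdx n)) := by
    simp only [twoBar, firstIdx, lastIdx]
    split_ifs <;> push_cast <;> omega
  rw [qPar, if_neg (by rw [rev_first]; simp [this]), pFun, if_pos rfl]
  simp

/-- The column of Jimbo's R-matrix which enters its Schur complement. -/
def colPar (n : ℕ) (p w : F) (x : Fin (2 * n) × Fin (2 * n)) : F :=
  (p ^ 2) ^ twoBar n x.2 * ((if x.1 = x.2.rev then gtFun (p ^ 4) w 1 / 2 else 0) +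
    (if midSwap n x.1 = x.2.rev then gtFun (p ^ 4) (-w) 1 / 2 else 0))

/-- The row of Jimbo's R-matrix which enters its Schur complement. -/
def rowPar (n : ℕ) (p w : F) (y : Fin (2 * n) × Fin (2 * n)) : F :=
  (p ^ 2) ^ (-twoBar n y.2) * ((if y.1 = y.2.rev then gFun (p ^ 4) w 1 / 2 else 0) +
    (if midSwap n y.1 = y.2.rev then gFun (p ^ 4) (-w) 1 / 2 else 0))

/-- An inner pair has no index in common with (1', 1), so only the two ℚ-terms contribute. The power
of q belonging to the first index is split off because it cancels against the one in `rPar_row`. -/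
theorem rPar_col {n : ℕ} (hn : 1 ≤ n) {p : F} (hp : p ≠ 0) (u v w : F)
    (x : Fin (2 * n) × Fin (2 * n)) :
    rPar (n + 1) p u v w (innerIdx n x.1, innerIdx n x.2) (lastIdx n, firstIdx n) =
      (p ^ 2) ^ (-twoBar (n + 1) (firstIdx n)) * colPar n p w x := by
  have hl := midSwap_of_not_mid (not_mid_last hn)
  simp only [rPar, colPar, hl, rev_first, midSwap_inner, rev_inner, innerIdx_inj,
    qPar_inner_first, Prod.mk.injEq, inner_ne_first, inner_ne_last, false_and, if_false, and_true,
    zpow_sub₀ (pow_ne_zero 2 hp), zpow_neg]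
  split_ifs <;> ring

theorem rPar_row {n : ℕ} (hn : 1 ≤ n) {p : F} (hp : p ≠ 0) (u v w : F)
    (y : Fin (2 * n) × Fin (2 * n)) :
    rPar (n + 1) p u v w (lastIdx n, firstIdx n) (innerIdx n y.1, innerIdx n y.2) =
      (p ^ 2) ^ (twoBar (n + 1) (firstIdx n)) * rowPar n p w y := by
  have hl := midSwap_of_not_mid (not_mid_last hn)
  simp only [rPar, rowPar, hl, rev_first, midSwap_inner, rev_inner, innerIdx_inj,
    qPar_first_inner, Prod.mk.injEq, (inner_ne_first _ _).symm, (inner_ne_last _ _).symm,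
    false_and, if_false, true_and, zpow_sub₀ (pow_ne_zero 2 hp), zpow_neg]
  split_ifs <;> ring

theorem rPar_corner {n : ℕ} (hn : 1 ≤ n) (p u v w : F) (h2 : (2 : F) ≠ 0) :
    rPar (n + 1) p u v w (lastIdx n, firstIdx n) (lastIdx n, firstIdx n) =
      (fFun (p ^ 4) w 1 + fFun (p ^ 4) (-w) 1) / 2 := by
  have hl := midSwap_of_not_mid (not_mid_last hn)
  simp only [rPar, hl, rev_first, qPar_first_first hn, (first_ne_last n).symm,
    false_and, if_false, true_and, if_true]
  field_simp
  ring

end Entries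

/-! ### The Schur complement of Jimbo's R-matrix, block by block. -/

theorem ne_of_mid {n : ℕ} {i j : Fin (2 * n)} (hi : ¬ Mid n i) (hj : Mid n j) :
    i ≠ j ∧ j ≠ i ∧ i ≠ j.rev ∧ j ≠ i.rev :=
  ⟨fun h => hi (h ▸ hj), fun h => hi (h ▸ hj), fun h => hi (h ▸ mid_rev.2 hj),
    fun h => hi (mid_rev.1 (h ▸ hj))⟩

theorem eq_or_eq_rev_of_mid {n : ℕ} {i j : Fin (2 * n)} (hi : Mid n i) (hj : Mid n j) :
    i = j ∨ i = j.rev := by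
  simp only [Mid, Fin.ext_iff, Fin.val_rev] at *
  omega

theorem twoBar_eq_rev_iff {n : ℕ} (i : Fin (2 * n)) :
    twoBar n i = twoBar n i.rev ↔ Mid n i := by
  have := i.isLt
  simp only [twoBar, Mid, Fin.val_rev]
  split_ifs <;> omega

theorem lt_rev_iff_of_mid {n : ℕ} {i j : Fin (2 * n)} (hi : ¬ Mid n i) (hj : Mid n j) :
    i < j.rev ↔ i < j := by
  simp only [Mid, Fin.lt_def, Fin.val_rev] at *
  omega

theorem rev_lt_iff_of_mid {n : ℕ} {i j : Fin (2 * n)} (hi : ¬ Mid n i) (hj : Mid n j) :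
    j.rev < i ↔ j < i := by
  simp only [Mid, Fin.lt_def, Fin.val_rev] at *
  omega

section Core

variable {F : Type*} [Field F]

/-- Both f and g̃ differ from g by constants, so g alone can be kept as the unknown in the
identities below. -/
theorem fFun_eq (q : F) {u v : F} (h : u - v ≠ 0) : fFun q u v = gFun q u v + q⁻¹ := by
  rw [fFun, gFun]; field_simp; ring

theorem gtFun_eq (q : F) {u v : F} (h : u - v ≠ 0) : gtFun q u v = gFun q u v - (q - q⁻¹) := by
  rw [gtFun, gFun]; field_simp; ring

theorem pFun_self {N : ℕ} (q : F) (i : Fin N) (u v : F) : pFun q i i u v = fFun q u v - 1 :=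
  if_pos rfl

theorem pFun_of_lt {N : ℕ} (q : F) {i j : Fin N} (h : i < j) (u v : F) :
    pFun q i j u v = gtFun q u v := by
  rw [pFun, if_neg h.ne, if_pos h]

theorem pFun_of_gt {N : ℕ} (q : F) {i j : Fin N} (h : j < i) (u v : F) :
    pFun q i j u v = gFun q u v := by
  rw [pFun, if_neg h.ne', if_neg h.not_gt]

/-- The diagonal entry of Jimbo's R-matrix by which one divides. -/
def cornerPar (p w : F) : F := (fFun (p ^ 4) w 1 + fFun (p ^ 4) (-w) 1) / 2

/-- The Schur complement of Jimbo's R-matrix. -/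
def schurPar (n : ℕ) (p u v w : F) : Mat2 n F :=
  Matrix.of fun x y => rPar n p u v w x y - colPar n p w x * rowPar n p w y / cornerPar p w

theorem qPar_eq {n : ℕ} (p w : F) (i j : Fin (2 * n)) :
    qPar n p w i j = (p ^ 2) ^ (twoBar n i - twoBar n j) * pFun (p ^ 4) j i w 1 -
      if Mid n i ∧ i = j then p ^ 4 - 2 + (p ^ 4)⁻¹ else 0 := by
  simp only [qPar, twoBar_eq_rev_iff]

variable {n : ℕ} {p u v w : F}

theorem cornerPar_eq (hp : p ≠ 0) (h2 : (2 : F) ≠ 0) (hw : w - 1 ≠ 0) (hw' : -w - 1 ≠ 0) :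
    cornerPar p w = (p ^ 4 * w ^ 2 - (p ^ 4)⁻¹) / (w ^ 2 - 1) := by
  have h1 : w ^ 2 - 1 ≠ 0 := by
    rw [show w ^ 2 - 1 = -((w - 1) * (-w - 1)) by ring]
    exact neg_ne_zero.2 (mul_ne_zero hw hw')
  rw [cornerPar, fFun, fFun]
  field_simp
  ring

theorem gFun_neg_one (q w : F) : gFun q (-w) 1 = (q - q⁻¹) * w / (w + 1) := by
  rw [gFun, show -w - 1 = -(w + 1) by ring, mul_neg, neg_div_neg_eq]

/-- The matrix relating the twists of consecutive ranks. -/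
def rankTwist (n : ℕ) (p : F) : Matrix (Fin (2 * n)) (Fin (2 * n)) F :=
  midMat n ((1 + (p ^ 2)⁻¹) / 2) ((1 - (p ^ 2)⁻¹) / 2)

set_option maxHeartbeats 2000000 in
-- All sixteen entries of the block of middle pairs are compared. Here T ⊗ T acts on both sides, and
-- the eigenvalue ratio q^{-1/2} of T is what compensates the shift of w to q w.
theorem schurPar_mid_mid (hp : p ≠ 0) (h2 : (2 : F) ≠ 0) (huv : u - v ≠ 0) (huv' : -u - v ≠ 0)
    (hw : w - 1 ≠ 0) (hw' : -w - 1 ≠ 0) (hqw : p ^ 4 * w - 1 ≠ 0) (hqw' : -(p ^ 4 * w) - 1 ≠ 0)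
    {a b c d : Fin (2 * n)} (ha : Mid n a) (hb : Mid n b) (hc : Mid n c) (hd : Mid n d) :
    (schurPar n p u v w * (rankTwist n p ⊗ₖ rankTwist n p)) (a, b) (c, d) =
    ((rankTwist n p ⊗ₖ rankTwist n p) * Matrix.of (rPar n p u v (p ^ 4 * w))) (a, b) (c, d) := by
  -- m is the smaller middle index; every middle index is m or its mirror image.
  obtain ⟨m, hm, hlt⟩ : ∃ m, Mid n m ∧ m < m.rev := by
    rcases lt_or_gt_of_ne (rev_ne_self a) with h | h
    · exact ⟨a.rev, mid_rev.2 ha, by simpa using h⟩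
    · exact ⟨a, ha, h⟩
  have hm' := mid_rev.2 hm
  have e1 := midSwap_of_mid hm
  have e2 := midSwap_of_mid hm'
  have t1 := twoBar_of_mid hm
  have t2 := twoBar_of_mid hm'
  have n1 := hlt.ne
  have n2 := hlt.ne'
  rw [rankTwist, mul_midMat_kron_apply, midMat_kron_mul_apply]
  have hq4 : p ^ 4 = (p ^ 2) ^ 2 := by ring
  have hs := pow_ne_zero 2 hp
  have w1 : 1 - w ≠ 0 := by rwa [← neg_ne_zero, neg_sub]
  have w2 : w + 1 ≠ 0 := by rw [← neg_ne_zero]; convert hw' using 1; ring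
  have w3 : (p ^ 2) ^ 2 * w - 1 ≠ 0 := by rwa [← hq4]
  have w4 : (p ^ 2) ^ 2 * w + 1 ≠ 0 := by rw [← neg_ne_zero, ← hq4]; convert hqw' using 1; ring
  have hcor : cornerPar p w = ((p ^ 2) ^ 2 * w - 1) * ((p ^ 2) ^ 2 * w + 1) /
      ((p ^ 2) ^ 2 * ((w - 1) * (w + 1))) := by
    have : w ^ 2 - 1 ≠ 0 := by
      rw [show w ^ 2 - 1 = (w - 1) * (w + 1) by ring]; exact mul_ne_zero hw w2
    rw [cornerPar_eq hp h2 hw hw']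
    field_simp
    ring
  have g1 := gFun_neg_one (p ^ 4) w
  have g2 := gFun_neg_one (p ^ 4) (p ^ 4 * w)
  rcases eq_or_eq_rev_of_mid ha hm with rfl | rfl <;>
  rcases eq_or_eq_rev_of_mid hb hm with rfl | rfl <;>
  rcases eq_or_eq_rev_of_mid hc hm with rfl | rfl <;>
  rcases eq_or_eq_rev_of_mid hd hm with rfl | rfl <;>
  simp only [schurPar, Matrix.of_apply, midWeight, hm, hm', if_true, rPar, colPar, rowPar, e1, e2,
      Fin.rev_rev, n1, n2, if_false, and_true, and_false, Prod.mk.injEq,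
      qPar_eq, t1, t2, pFun_self, pFun_of_lt _ hlt, pFun_of_gt _ hlt, sub_zero, neg_zero, zpow_zero,
      mul_zero, add_zero, zero_add, one_mul, fFun_eq _ huv, fFun_eq _ huv', fFun_eq _ hw,
      fFun_eq _ hw', fFun_eq _ hqw, fFun_eq _ hqw', gtFun_eq _ huv, gtFun_eq _ huv', gtFun_eq _ hw,
      gtFun_eq _ hw', gtFun_eq _ hqw, gtFun_eq _ hqw', hcor, g1, g2] <;>
  -- The ℙ-part does not involve w, so the identities hold with g(u,v) and g(-u,v) replaced by
  -- arbitrary elements.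
  generalize gFun (p ^ 4) u v = g <;>
  generalize gFun (p ^ 4) (-u) v = g' <;>
  simp only [gFun, hq4] <;>
  generalize p ^ 2 = s at * <;> clear g1 g2 hcor hq4
  all_goals field_simp
  all_goals ring

end Core

section Core

variable {F : Type*} [Field F] {n : ℕ} {p u v w : F}

theorem rPar_eq_zero {a b c d : Fin (2 * n)}
    (h : ¬ ((Mid n a ↔ Mid n b) ↔ (Mid n c ↔ Mid n d))) : rPar n p u v w (a, b) (c, d) = 0 := by
  have h1 : ¬ ((a, b) = (c, d)) := by rintro ⟨⟩; tauto
  have h2 : ¬ (a = d ∧ b = c) := by rintro ⟨rfl, rfl⟩; tauto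
  have h3 : ¬ (midSwap n a = d ∧ b = midSwap n c) := by
    rintro ⟨rfl, rfl⟩; rw [mid_midSwap, mid_midSwap] at h; tauto
  have h4 : ¬ (a = b.rev ∧ c = d.rev) := by
    rintro ⟨rfl, rfl⟩; rw [mid_rev, mid_rev] at h; tauto
  have h5 : ¬ (midSwap n a = b.rev ∧ midSwap n c = d.rev) := by
    rintro ⟨h5, h6⟩
    rw [← mid_midSwap (i := a), ← mid_midSwap (i := c), h5, h6, mid_rev, mid_rev] at h
    tauto
  simp only [rPar, h1, h2, h3, h4, h5, if_false, mul_zero, add_zero]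

theorem colPar_eq_zero {a b : Fin (2 * n)} (h : ¬ (Mid n a ↔ Mid n b)) :
    colPar n p w (a, b) = 0 := by
  have h4 : a ≠ b.rev := by rintro rfl; exact h mid_rev
  have h5 : midSwap n a ≠ b.rev := by
    intro h5; apply h; rw [← mid_midSwap, h5, mid_rev]
  simp only [colPar, h4, h5, if_false, mul_zero, add_zero]

theorem rowPar_eq_zero {a b : Fin (2 * n)} (h : ¬ (Mid n a ↔ Mid n b)) :
    rowPar n p w (a, b) = 0 := by
  have h4 : a ≠ b.rev := by rintro rfl; exact h mid_rev
  have h5 : midSwap n a ≠ b.rev := by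
    intro h5; apply h; rw [← mid_midSwap, h5, mid_rev]
  simp only [rowPar, h4, h5, if_false, mul_zero, add_zero]

/-- No term of Jimbo's matrix connects a pair having exactly one middle index with a pair having
none or two, and T ⊗ T preserves this distinction; both sides are zero. -/
theorem schurPar_parity {a b c d : Fin (2 * n)}
    (h : ¬ ((Mid n a ↔ Mid n b) ↔ (Mid n c ↔ Mid n d))) :
    (schurPar n p u v w * (rankTwist n p ⊗ₖ rankTwist n p)) (a, b) (c, d) =
    ((rankTwist n p ⊗ₖ rankTwist n p) * Matrix.of (rPar n p u v (p ^ 4 * w))) (a, b) (c, d) := by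
  have h0 : ∀ c' d', (Mid n c' ↔ Mid n c) → (Mid n d' ↔ Mid n d) →
      schurPar n p u v w (a, b) (c', d') = 0 := by
    intro c' d' h1 h2
    rw [schurPar, Matrix.of_apply, rPar_eq_zero (by rwa [h1, h2])]
    by_cases h3 : Mid n a ↔ Mid n b
    · rw [rowPar_eq_zero (by rw [h1, h2]; tauto)]; simp
    · rw [colPar_eq_zero h3]; simp
  have h0' : ∀ a' b', (Mid n a' ↔ Mid n a) → (Mid n b' ↔ Mid n b) →
      Matrix.of (rPar n p u v (p ^ 4 * w)) (a', b') (c, d) = 0 := fun a' b' h1 h2 => by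
    rw [Matrix.of_apply, rPar_eq_zero (by rwa [h1, h2])]
  rw [rankTwist, mul_midMat_kron_apply, midMat_kron_mul_apply, h0 _ _ Iff.rfl Iff.rfl,
    h0 _ _ Iff.rfl mid_midSwap, h0 _ _ mid_midSwap Iff.rfl, h0 _ _ mid_midSwap mid_midSwap,
    h0' _ _ Iff.rfl Iff.rfl,
    h0' _ _ Iff.rfl mid_midSwap, h0' _ _ mid_midSwap Iff.rfl, h0' _ _ mid_midSwap mid_midSwap]
  simp

theorem pFun_rev_left {i j : Fin (2 * n)} (hi : ¬ Mid n i) (hj : Mid n j) (q z t : F) :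
    pFun q j.rev i z t = pFun q j i z t := by
  obtain ⟨-, h1, -, -⟩ := ne_of_mid hi hj
  obtain ⟨-, h2, -, -⟩ := ne_of_mid hi (mid_rev.2 hj)
  simp only [pFun, h1, h2, rev_lt_iff_of_mid hi hj, if_false]

theorem pFun_rev_right {i j : Fin (2 * n)} (hi : ¬ Mid n i) (hj : Mid n j) (q z t : F) :
    pFun q i j.rev z t = pFun q i j z t := by
  obtain ⟨h1, -, -, -⟩ := ne_of_mid hi hj
  obtain ⟨h2, -, -, -⟩ := ne_of_mid hi (mid_rev.2 hj)
  simp only [pFun, h1, h2, lt_rev_iff_of_mid hi hj, if_false]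

theorem eq_false_of_not_mid {i j : Fin (2 * n)} (hi : ¬ Mid n i) (hj : Mid n j) :
    (i = j) = False := eq_false (ne_of_mid hi hj).1

theorem eq_false_of_mid {i j : Fin (2 * n)} (hi : Mid n i) (hj : ¬ Mid n j) :
    (i = j) = False := eq_false (ne_of_mid hj hi).2.1

set_option linter.unusedSimpArgs false in
-- With exactly one middle index in each pair, ℚ and the correction term vanish. What remains does
-- not depend on w and does not distinguish the two middle indices, so T ⊗ T commutes with it.
theorem schurPar_odd {a b c d : Fin (2 * n)}
    (h : ¬ (Mid n a ↔ Mid n b)) (h' : ¬ (Mid n c ↔ Mid n d)) :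
    (schurPar n p u v w * (rankTwist n p ⊗ₖ rankTwist n p)) (a, b) (c, d) =
    ((rankTwist n p ⊗ₖ rankTwist n p) * Matrix.of (rPar n p u v (p ^ 4 * w))) (a, b) (c, d) := by
  rw [rankTwist, mul_midMat_kron_apply, midMat_kron_mul_apply]
  simp only [schurPar, colPar_eq_zero h, zero_mul, zero_div, sub_zero, Matrix.of_apply]
  by_cases ha : Mid n a <;> by_cases hc : Mid n c
  · have hb : ¬ Mid n b := by simpa [ha] using h
    have hd : ¬ Mid n d := by simpa [hc] using h'
    by_cases h0 : b = d
    · subst h0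
      rcases eq_or_eq_rev_of_mid hc ha with rfl | rfl <;>
      simp only [midWeight, ha, hb, hc, hd, if_true, if_false, rPar, mid_rev, midSwap_of_mid,
      midSwap_of_not_mid, eq_false_of_not_mid, eq_false_of_mid, not_true_eq_false,
      not_false_eq_true, false_and, and_false, true_and, and_true, Prod.mk.injEq, mul_zero, add_zero,
      zero_mul, zero_add, one_mul, Fin.rev_rev, Fin.rev_inj, rev_ne_self, (rev_ne_self _).symm,
      pFun_rev_left, pFun_rev_right]
    · simp only [midWeight, ha, hb, hc, hd, if_true, if_false, rPar, mid_rev, midSwap_of_mid,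
      midSwap_of_not_mid, eq_false_of_not_mid, eq_false_of_mid, not_true_eq_false,
      not_false_eq_true, false_and, and_false, true_and, and_true, Prod.mk.injEq, mul_zero, add_zero,
      zero_mul, zero_add, one_mul, Fin.rev_rev, Fin.rev_inj, rev_ne_self, (rev_ne_self _).symm,
      pFun_rev_left, pFun_rev_right, h0, Ne.symm h0]
  · have hb : ¬ Mid n b := by simpa [ha] using h
    have hd : Mid n d := by simpa [hc] using h'
    by_cases h0 : b = c
    · subst h0
      rcases eq_or_eq_rev_of_mid hd ha with rfl | rfl <;>
      simp only [midWeight, ha, hb, hc, hd, if_true, if_false, rPar, mid_rev, midSwap_of_mid,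
      midSwap_of_not_mid, eq_false_of_not_mid, eq_false_of_mid, not_true_eq_false,
      not_false_eq_true, false_and, and_false, true_and, and_true, Prod.mk.injEq, mul_zero, add_zero,
      zero_mul, zero_add, one_mul, Fin.rev_rev, Fin.rev_inj, rev_ne_self, (rev_ne_self _).symm,
      pFun_rev_left, pFun_rev_right]
    · simp only [midWeight, ha, hb, hc, hd, if_true, if_false, rPar, mid_rev, midSwap_of_mid,
      midSwap_of_not_mid, eq_false_of_not_mid, eq_false_of_mid, not_true_eq_false,
      not_false_eq_true, false_and, and_false, true_and, and_true, Prod.mk.injEq, mul_zero, add_zero,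
      zero_mul, zero_add, one_mul, Fin.rev_rev, Fin.rev_inj, rev_ne_self, (rev_ne_self _).symm,
      pFun_rev_left, pFun_rev_right, h0, Ne.symm h0]
  · have hb : Mid n b := by simpa [ha] using h
    have hd : ¬ Mid n d := by simpa [hc] using h'
    by_cases h0 : a = d
    · subst h0
      rcases eq_or_eq_rev_of_mid hc hb with rfl | rfl <;>
      simp only [midWeight, ha, hb, hc, hd, if_true, if_false, rPar, mid_rev, midSwap_of_mid,
      midSwap_of_not_mid, eq_false_of_not_mid, eq_false_of_mid, not_true_eq_false,
      not_false_eq_true, false_and, and_false, true_and, and_true, Prod.mk.injEq, mul_zero, add_zero,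
      zero_mul, zero_add, one_mul, Fin.rev_rev, Fin.rev_inj, rev_ne_self, (rev_ne_self _).symm,
      pFun_rev_left, pFun_rev_right]
    · simp only [midWeight, ha, hb, hc, hd, if_true, if_false, rPar, mid_rev, midSwap_of_mid,
      midSwap_of_not_mid, eq_false_of_not_mid, eq_false_of_mid, not_true_eq_false,
      not_false_eq_true, false_and, and_false, true_and, and_true, Prod.mk.injEq, mul_zero, add_zero,
      zero_mul, zero_add, one_mul, Fin.rev_rev, Fin.rev_inj, rev_ne_self, (rev_ne_self _).symm,
      pFun_rev_left, pFun_rev_right, h0, Ne.symm h0]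
  · have hb : Mid n b := by simpa [ha] using h
    have hd : Mid n d := by simpa [hc] using h'
    by_cases h0 : a = c
    · subst h0
      rcases eq_or_eq_rev_of_mid hd hb with rfl | rfl <;>
      simp only [midWeight, ha, hb, hc, hd, if_true, if_false, rPar, mid_rev, midSwap_of_mid,
      midSwap_of_not_mid, eq_false_of_not_mid, eq_false_of_mid, not_true_eq_false,
      not_false_eq_true, false_and, and_false, true_and, and_true, Prod.mk.injEq, mul_zero, add_zero,
      zero_mul, zero_add, one_mul, Fin.rev_rev, Fin.rev_inj, rev_ne_self, (rev_ne_self _).symm,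
      pFun_rev_left, pFun_rev_right]
    · simp only [midWeight, ha, hb, hc, hd, if_true, if_false, rPar, mid_rev, midSwap_of_mid,
      midSwap_of_not_mid, eq_false_of_not_mid, eq_false_of_mid, not_true_eq_false,
      not_false_eq_true, false_and, and_false, true_and, and_true, Prod.mk.injEq, mul_zero, add_zero,
      zero_mul, zero_add, one_mul, Fin.rev_rev, Fin.rev_inj, rev_ne_self, (rev_ne_self _).symm,
      pFun_rev_left, pFun_rev_right, h0, Ne.symm h0]

/-- The non-vanishing conditions under which the Schur complement of Jimbo's R-matrix is computed. -/
structure Generic (p u v w : F) : Prop where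
  p_ne : p ≠ 0
  two_ne : (2 : F) ≠ 0
  uv : u - v ≠ 0
  uv' : -u - v ≠ 0
  w_ne : w - 1 ≠ 0
  w_ne' : -w - 1 ≠ 0
  qw : p ^ 4 * w - 1 ≠ 0
  qw' : -(p ^ 4 * w) - 1 ≠ 0

theorem Generic.corner (h : Generic p u v w) : cornerPar p w =
    (p ^ 4 * w - 1) * (p ^ 4 * w + 1) / (p ^ 4 * ((w - 1) * (w + 1))) := by
  have hp := h.p_ne
  have hw := h.w_ne
  have w2 : w + 1 ≠ 0 := by rw [← neg_ne_zero]; convert h.w_ne' using 1; ring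
  have : w ^ 2 - 1 ≠ 0 := by
    rw [show w ^ 2 - 1 = (w - 1) * (w + 1) by ring]; exact mul_ne_zero hw w2
  rw [cornerPar_eq hp h.two_ne hw h.w_ne']
  field_simp
  ring

theorem gtFun_neg_one (q w : F) : gtFun q (-w) 1 = -((q - q⁻¹) / (w + 1)) := by
  rw [gtFun, show -w - 1 = -(w + 1) by ring, mul_one, div_neg]

/-- Off the middle the terms at w and at -w fall on the same positions, so only their average
matters. Subtracting the rank-one correction from this average amounts to replacing w by q w. -/
theorem qPar_even (h : Generic p u v w) {b d : Fin (2 * n)} (hb : ¬ Mid n b) :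
    1 / 2 * qPar n p w b d + 1 / 2 * qPar n p (-w) b d -
      (p ^ 2) ^ twoBar n b * (gtFun (p ^ 4) w 1 / 2 + gtFun (p ^ 4) (-w) 1 / 2) *
      ((p ^ 2) ^ (-twoBar n d) * (gFun (p ^ 4) w 1 / 2 + gFun (p ^ 4) (-w) 1 / 2)) /
      cornerPar p w =
    1 / 2 * qPar n p (p ^ 4 * w) b d + 1 / 2 * qPar n p (-(p ^ 4 * w)) b d := by
  have hp := h.p_ne
  have h2 := h.two_ne
  have hcor := h.corner
  have w1 := h.w_ne
  have w2 : w + 1 ≠ 0 := by rw [← neg_ne_zero]; convert h.w_ne' using 1; ring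
  have w3 := h.qw
  have w4 : p ^ 4 * w + 1 ≠ 0 := by rw [← neg_ne_zero]; convert h.qw' using 1; ring
  have hq := pow_ne_zero 4 hp
  have hs : (p ^ 2) ^ twoBar n b ≠ 0 := zpow_ne_zero _ (pow_ne_zero 2 hp)
  simp only [qPar_eq, hb, false_and, if_false, sub_zero, sub_eq_add_neg (twoBar n b),
    zpow_add₀ (pow_ne_zero 2 hp)]
  rcases lt_trichotomy b d with hbd | rfl | hbd
  · simp only [pFun_of_gt _ hbd]
    generalize (p ^ 2) ^ twoBar n b = s
    generalize (p ^ 2) ^ (-twoBar n d) = t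
    simp only [hcor, gFun_neg_one, gtFun_neg_one]
    simp only [gFun, gtFun]
    generalize p ^ 4 = q at *
    field_simp
    ring
  · simp only [pFun_self, zpow_neg, fFun_eq _ h.w_ne, fFun_eq _ h.w_ne', fFun_eq _ h.qw,
      fFun_eq _ h.qw']
    generalize (p ^ 2) ^ twoBar n b = s at *
    simp only [hcor, gFun_neg_one, gtFun_neg_one]
    simp only [gFun, gtFun]
    generalize p ^ 4 = q at *
    field_simp
    ring
  · simp only [pFun_of_lt _ hbd]
    generalize (p ^ 2) ^ twoBar n b = s
    generalize (p ^ 2) ^ (-twoBar n d) = t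
    simp only [hcor, gFun_neg_one, gtFun_neg_one]
    simp only [gFun, gtFun]
    generalize p ^ 4 = q at *
    field_simp
    ring

set_option linter.unusedSimpArgs false in
-- T is trivial on these pairs, so the claim reduces to the scalar identity `qPar_even`.
theorem schurPar_not_mid (h : Generic p u v w) {a b c d : Fin (2 * n)}
    (ha : ¬ Mid n a) (hb : ¬ Mid n b) (hc : ¬ Mid n c) (hd : ¬ Mid n d) :
    (schurPar n p u v w * (rankTwist n p ⊗ₖ rankTwist n p)) (a, b) (c, d) =
    ((rankTwist n p ⊗ₖ rankTwist n p) * Matrix.of (rPar n p u v (p ^ 4 * w))) (a, b) (c, d) := by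
  have key := qPar_even (n := n) h (d := d) hb
  rw [rankTwist, mul_midMat_kron_apply, midMat_kron_mul_apply]
  simp only [midWeight, ha, hb, hc, hd, if_true, if_false, rPar, mid_rev, midSwap_of_mid,
      midSwap_of_not_mid, eq_false_of_not_mid, eq_false_of_mid, not_true_eq_false,
      not_false_eq_true, false_and, and_false, true_and, and_true, Prod.mk.injEq, mul_zero, add_zero,
      zero_mul, zero_add, one_mul, Fin.rev_rev, Fin.rev_inj, rev_ne_self, (rev_ne_self _).symm,
      schurPar, colPar, rowPar, Matrix.of_apply,
      sub_zero, zero_div, zero_sub, neg_zero, zpow_zero, twoBar_of_mid]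
  by_cases h1 : a = b.rev <;> by_cases h2 : c = d.rev <;>
    simp only [h1, h2, if_true, if_false, true_and, false_and, and_true, and_false, mul_zero,
      add_zero, zero_mul, zero_div, sub_zero]
  linear_combination key

set_option linter.unusedSimpArgs false in
-- Only ℚ connects these blocks, and T ⊗ T acts non-trivially on the column side alone. The
-- transposed block below is handled in the same way, with T ⊗ T on the row side.
theorem schurPar_not_mid_mid (h : Generic p u v w) {a b c d : Fin (2 * n)}
    (ha : ¬ Mid n a) (hb : ¬ Mid n b) (hc : Mid n c) (hd : Mid n d) :
    (schurPar n p u v w * (rankTwist n p ⊗ₖ rankTwist n p)) (a, b) (c, d) =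
    ((rankTwist n p ⊗ₖ rankTwist n p) * Matrix.of (rPar n p u v (p ^ 4 * w))) (a, b) (c, d) := by
  have hp := h.p_ne
  have h2 := h.two_ne
  have hcor := h.corner
  have w1 := h.w_ne
  have w2 : w + 1 ≠ 0 := by rw [← neg_ne_zero]; convert h.w_ne' using 1; ring
  have w3 := h.qw
  have w4 : p ^ 4 * w + 1 ≠ 0 := by rw [← neg_ne_zero]; convert h.qw' using 1; ring
  have hq := pow_ne_zero 4 hp
  have hq4 : p ^ 4 = (p ^ 2) ^ 2 := by ring
  rw [hq4] at hcor w3 w4 hq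
  have hs := pow_ne_zero 2 hp
  rw [rankTwist, mul_midMat_kron_apply, midMat_kron_mul_apply]
  by_cases h1 : a = b.rev
  · have hbd := (ne_of_mid hb hd).1
    rcases eq_or_eq_rev_of_mid hc hd with rfl | rfl <;>
    rcases lt_or_gt_of_ne hbd with hbd | hbd <;>
    simp only [midWeight, ha, hb, hc, hd, if_true, if_false, rPar, mid_rev, midSwap_of_mid,
      midSwap_of_not_mid, eq_false_of_not_mid, eq_false_of_mid, not_true_eq_false,
      not_false_eq_true, false_and, and_false, true_and, and_true, Prod.mk.injEq, mul_zero, add_zero,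
      zero_mul, zero_add, one_mul, Fin.rev_rev, Fin.rev_inj, rev_ne_self, (rev_ne_self _).symm,
      pFun_rev_left, pFun_rev_right, schurPar, colPar, rowPar, Matrix.of_apply, qPar_eq,
      sub_zero, zero_div, zero_sub, neg_zero, zpow_zero, twoBar_of_mid, h1, pFun_of_gt _ hbd, pFun_of_lt _ hbd] <;>
    generalize (p ^ 2) ^ twoBar n b = s <;>
    simp only [hcor, gFun_neg_one, gtFun_neg_one] <;>
    simp only [gFun, gtFun, hq4] <;>
    generalize p ^ 2 = r at * <;>
    field_simp <;> ring
  · simp only [midWeight, ha, hb, hc, hd, if_true, if_false, rPar, mid_rev, midSwap_of_mid,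
      midSwap_of_not_mid, eq_false_of_not_mid, eq_false_of_mid, not_true_eq_false,
      not_false_eq_true, false_and, and_false, true_and, and_true, Prod.mk.injEq, mul_zero, add_zero,
      zero_mul, zero_add, one_mul, Fin.rev_rev, Fin.rev_inj, rev_ne_self, (rev_ne_self _).symm,
      pFun_rev_left, pFun_rev_right, schurPar, colPar, rowPar, Matrix.of_apply, qPar_eq,
      sub_zero, zero_div, zero_sub, neg_zero, zpow_zero, twoBar_of_mid, h1]

set_option linter.unusedSimpArgs false in
theorem schurPar_mid_not_mid (h : Generic p u v w) {a b c d : Fin (2 * n)}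
    (ha : Mid n a) (hb : Mid n b) (hc : ¬ Mid n c) (hd : ¬ Mid n d) :
    (schurPar n p u v w * (rankTwist n p ⊗ₖ rankTwist n p)) (a, b) (c, d) =
    ((rankTwist n p ⊗ₖ rankTwist n p) * Matrix.of (rPar n p u v (p ^ 4 * w))) (a, b) (c, d) := by
  have hp := h.p_ne
  have h2 := h.two_ne
  have hcor := h.corner
  have w1 := h.w_ne
  have w2 : w + 1 ≠ 0 := by rw [← neg_ne_zero]; convert h.w_ne' using 1; ring
  have w3 := h.qw
  have w4 : p ^ 4 * w + 1 ≠ 0 := by rw [← neg_ne_zero]; convert h.qw' using 1; ring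
  have hq := pow_ne_zero 4 hp
  have hq4 : p ^ 4 = (p ^ 2) ^ 2 := by ring
  rw [hq4] at hcor w3 w4 hq
  have hs := pow_ne_zero 2 hp
  rw [rankTwist, mul_midMat_kron_apply, midMat_kron_mul_apply]
  by_cases h1 : c = d.rev
  · have hbd := (ne_of_mid hd hb).1
    rcases eq_or_eq_rev_of_mid ha hb with rfl | rfl <;>
    rcases lt_or_gt_of_ne hbd with hbd | hbd <;>
    simp only [midWeight, ha, hb, hc, hd, if_true, if_false, rPar, mid_rev, midSwap_of_mid,
      midSwap_of_not_mid, eq_false_of_not_mid, eq_false_of_mid, not_true_eq_false,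
      not_false_eq_true, false_and, and_false, true_and, and_true, Prod.mk.injEq, mul_zero, add_zero,
      zero_mul, zero_add, one_mul, Fin.rev_rev, Fin.rev_inj, rev_ne_self, (rev_ne_self _).symm,
      pFun_rev_left, pFun_rev_right, schurPar, colPar, rowPar, Matrix.of_apply, qPar_eq,
      sub_zero, zero_div, zero_sub, neg_zero, zpow_zero, twoBar_of_mid, h1, pFun_of_gt _ hbd, pFun_of_lt _ hbd] <;>
    generalize (p ^ 2) ^ (-twoBar n d) = s <;>
    simp only [hcor, gFun_neg_one, gtFun_neg_one] <;>
    simp only [gFun, gtFun, hq4] <;>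
    generalize p ^ 2 = r at * <;>
    field_simp <;> ring
  · simp only [midWeight, ha, hb, hc, hd, if_true, if_false, rPar, mid_rev, midSwap_of_mid,
      midSwap_of_not_mid, eq_false_of_not_mid, eq_false_of_mid, not_true_eq_false,
      not_false_eq_true, false_and, and_false, true_and, and_true, Prod.mk.injEq, mul_zero, add_zero,
      zero_mul, zero_add, one_mul, Fin.rev_rev, Fin.rev_inj, rev_ne_self, (rev_ne_self _).symm,
      pFun_rev_left, pFun_rev_right, schurPar, colPar, rowPar, Matrix.of_apply, qPar_eq,
      sub_zero, zero_div, zero_sub, neg_zero, zpow_zero, twoBar_of_mid, h1]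

end Core

/-! ### The twisted R-matrices of consecutive ranks. -/

section Rational

variable {F : Type*} [Field F] {n : ℕ} {p u v w : F}

theorem schurPar_mul (h : Generic p u v w) :
    schurPar n p u v w * (rankTwist n p ⊗ₖ rankTwist n p) =
      (rankTwist n p ⊗ₖ rankTwist n p) * (Matrix.of (rPar n p u v (p ^ 4 * w)) : Mat2 n F) := by
  ext ⟨a, b⟩ ⟨c, d⟩
  by_cases h0 : (Mid n a ↔ Mid n b) ↔ (Mid n c ↔ Mid n d)
  · by_cases h1 : Mid n a ↔ Mid n b
    · have h2 := h0.1 h1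
      by_cases ha : Mid n a <;> by_cases hc : Mid n c
      · exact schurPar_mid_mid h.p_ne h.two_ne h.uv h.uv' h.w_ne h.w_ne' h.qw h.qw' ha (h1.1 ha) hc
          (h2.1 hc)
      · exact schurPar_mid_not_mid h ha (h1.1 ha) hc fun hd => hc (h2.2 hd)
      · exact schurPar_not_mid_mid h ha (fun hb => ha (h1.2 hb)) hc (h2.1 hc)
      · exact schurPar_not_mid h ha (fun hb => ha (h1.2 hb)) hc fun hd => hc (h2.2 hd)
    · exact schurPar_odd h1 fun h2 => h1 (h0.2 h2)
  · exact schurPar_parity h0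

theorem midWeight_inner (α β : F) (i : Fin (2 * n)) :
    midWeight (n + 1) α β (innerIdx n i) = midWeight n α β i := by
  simp only [midWeight, mid_inner]

/-- The twisting matrices fix the first and the last basis vectors, so conjugation by them leaves
the pivot alone and commutes with taking the Schur complement. -/
theorem schurR_midMat_conj (hn : 1 ≤ n) (α β α' β' s : F)
    (Y : Matrix (Fin (2 * (n + 1)) × Fin (2 * (n + 1))) (Fin (2 * (n + 1)) × Fin (2 * (n + 1))) F) :
    schurR ((midMat (n + 1) α β ⊗ₖ midMat (n + 1) α β) * Y *
      (midMat (n + 1) α' β' ⊗ₖ midMat (n + 1) α' β')) s =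
    (midMat n α β ⊗ₖ midMat n α β) * schurR Y s * (midMat n α' β' ⊗ₖ midMat n α' β') := by
  have wf : ∀ α β : F, midWeight (n + 1) α β (firstIdx n) = (1, 0) := fun _ _ =>
    if_neg (not_mid_first hn)
  have wl : ∀ α β : F, midWeight (n + 1) α β (lastIdx n) = (1, 0) := fun _ _ =>
    if_neg (not_mid_last hn)
  ext x y
  simp only [schurR, Matrix.of_apply, mul_midMat_kron_apply, midMat_kron_mul_apply,
    midWeight_inner, midSwap_inner, wf, wl, one_mul, zero_mul, add_zero]
  ring

theorem midMat_conj_corner (hn : 1 ≤ n) (α β α' β' : F)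
    (Y : Matrix (Fin (2 * (n + 1)) × Fin (2 * (n + 1))) (Fin (2 * (n + 1)) × Fin (2 * (n + 1))) F) :
    ((midMat (n + 1) α β ⊗ₖ midMat (n + 1) α β) * Y *
      (midMat (n + 1) α' β' ⊗ₖ midMat (n + 1) α' β')) (lastIdx n, firstIdx n)
      (lastIdx n, firstIdx n) = Y (lastIdx n, firstIdx n) (lastIdx n, firstIdx n) := by
  have wf : ∀ α β : F, midWeight (n + 1) α β (firstIdx n) = (1, 0) := fun _ _ =>
    if_neg (not_mid_first hn)
  have wl : ∀ α β : F, midWeight (n + 1) α β (lastIdx n) = (1, 0) := fun _ _ =>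
    if_neg (not_mid_last hn)
  simp only [mul_midMat_kron_apply, midMat_kron_mul_apply, wf, wl, one_mul, zero_mul, add_zero]

/-- The entries of the inverse of the twisting matrix. -/
def invCoeff (n : ℕ) (p ε : F) : F := ε * aCoeff n p ε * (p ^ 2 * ((p ^ 2) ^ (n - 1 : ℤ))⁻¹)

/-- The eigenvalues of the middle block of 𝕌 are a_+ ± a_- = q^{-1/4} and ξ^{-1/2} q^{-1/4}; the
coefficients `invCoeff` are those with the inverse eigenvalues. -/
theorem aCoeff_det (n : ℕ) (hp : p ≠ 0) (h2 : (2 : F) ≠ 0) :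
    aCoeff n p 1 * invCoeff n p 1 + aCoeff n p (-1) * invCoeff n p (-1) = 1 := by
  have he : (p ^ 2) ^ (n - 1 : ℤ) ≠ 0 := zpow_ne_zero _ (pow_ne_zero 2 hp)
  simp only [invCoeff, aCoeff]
  generalize (p ^ 2) ^ (n - 1 : ℤ) = e at *
  field_simp
  ring

theorem midMat_mul_invCoeff (m n : ℕ) (hp : p ≠ 0) (h2 : (2 : F) ≠ 0) :
    midMat m (aCoeff n p 1) (aCoeff n p (-1)) *
      midMat m (invCoeff n p 1) (invCoeff n p (-1)) = 1 := by
  rw [midMat_mul, aCoeff_det n hp h2, ← midMat_one_zero]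
  congr 1
  simp only [invCoeff]
  ring

theorem twist_mul_inv (n : ℕ) (hp : p ≠ 0) (h2 : (2 : F) ≠ 0) :
    twist n p * midMat n (invCoeff n p 1) (invCoeff n p (-1)) = 1 := by
  rw [twist_eq_midMat, midMat_mul_invCoeff n n hp h2]

theorem twist_inv (n : ℕ) (hp : p ≠ 0) (h2 : (2 : F) ≠ 0) :
    (twist n p)⁻¹ = midMat n (invCoeff n p 1) (invCoeff n p (-1)) :=
  Matrix.inv_eq_right_inv (twist_mul_inv n hp h2)

theorem RMat_eq (n : ℕ) (hp : p ≠ 0) (h2 : (2 : F) ≠ 0) (u v : F) : RMat n p u v =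
    (midMat n (aCoeff n p 1) (aCoeff n p (-1)) ⊗ₖ midMat n (aCoeff n p 1) (aCoeff n p (-1))) *
      RJimbo n p u v * (midMat n (invCoeff n p 1) (invCoeff n p (-1)) ⊗ₖ
        midMat n (invCoeff n p 1) (invCoeff n p (-1))) := by
  rw [RMat, twist_inv n hp h2, twist_eq_midMat]

/-- Raising the rank by one multiplies the second eigenvalue of the middle block of 𝕌 by q^{1/2},
and `rankTwist` takes this factor away. -/
theorem midMat_mul_rankTwist (n : ℕ) (hp : p ≠ 0) (h2 : (2 : F) ≠ 0) :
    midMat n (aCoeff (n + 1) p 1) (aCoeff (n + 1) p (-1)) * rankTwist n p = twist n p := by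
  rw [rankTwist, midMat_mul, twist_eq_midMat]
  have he : (p ^ 2) ^ ((n : ℤ) - 1) = (p ^ 2) ^ (n : ℤ) * (p ^ 2)⁻¹ :=
    zpow_sub_one₀ (pow_ne_zero 2 hp) _
  simp only [aCoeff, Nat.cast_add, Nat.cast_one, add_sub_cancel_right, he]
  generalize (p ^ 2) ^ (n : ℤ) = e
  congr 1 <;> field_simp <;> ring

theorem xi_eq (n : ℕ) (hp : p ≠ 0) : xi n p = p ^ 4 * xi (n + 1) p := by
  rw [xi, xi, ← zpow_one_add₀ (pow_ne_zero 4 hp)]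
  congr 1
  push_cast
  ring

theorem schurR_RJimbo (hn : 1 ≤ n) (hp : p ≠ 0) (h2 : (2 : F) ≠ 0) (hu : u ≠ 0) :
    schurR (RJimbo (n + 1) p u v) (cornerPar p (v * xi (n + 1) p / u))⁻¹ =
      schurPar n p u v (v * xi (n + 1) p / u) := by
  ext x y
  have ht : (p ^ 2) ^ (-twoBar (n + 1) (firstIdx n)) * (p ^ 2) ^ twoBar (n + 1) (firstIdx n) = 1 := by
    rw [zpow_neg]
    exact inv_mul_cancel₀ (zpow_ne_zero _ (pow_ne_zero 2 hp))
  simp only [schurR, schurPar, Matrix.of_apply, RJimbo_apply _ _ hu _ h2, rPar_inner,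
    rPar_col hn hp, rPar_row hn hp]
  generalize v * xi (n + 1) p / u = w
  rw [div_eq_mul_inv]
  linear_combination (-(colPar n p w x * rowPar n p w y * (cornerPar p w)⁻¹)) * ht

/-- The R-matrix of rank `n` is a Schur complement of the R-matrix of rank `n + 1`. -/
theorem schurR_RMat (hn : 1 ≤ n) (hu : u ≠ 0) (h : Generic p u v (v * xi (n + 1) p / u)) :
    schurR (RMat (n + 1) p u v) (cornerPar p (v * xi (n + 1) p / u))⁻¹ = RMat n p u v := by
  have hp := h.p_ne
  have h2 := h.two_ne
  rw [RMat_eq (n + 1) hp h2, schurR_midMat_conj hn, schurR_RJimbo hn hp h2 hu]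
  have hw : p ^ 4 * (v * xi (n + 1) p / u) = v * xi n p / u := by rw [xi_eq n hp]; ring
  have key := schurPar_mul (n := n) h
  have hJ : (Matrix.of (rPar n p u v (v * xi n p / u)) : Mat2 n F) = RJimbo n p u v := by
    ext x y
    rw [RJimbo_apply n p hu v h2, Matrix.of_apply]
  rw [hw, hJ] at key
  -- The inverse of the larger twist, restricted to the inner indices, is T times the inverse of the
  -- smaller one. Thus T stands to the right of the Schur complement, moves across it by `key`, and
  -- is absorbed into the twist on the left.
  have hinv : midMat n (invCoeff (n + 1) p 1) (invCoeff (n + 1) p (-1)) =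
      rankTwist n p * (twist n p)⁻¹ := by
    have h1 : midMat n (invCoeff (n + 1) p 1) (invCoeff (n + 1) p (-1)) *
        midMat n (aCoeff (n + 1) p 1) (aCoeff (n + 1) p (-1)) = 1 :=
      mul_eq_one_comm.1 (midMat_mul_invCoeff n (n + 1) hp h2)
    have h3 : twist n p * (twist n p)⁻¹ = 1 := by rw [twist_inv n hp h2, twist_mul_inv n hp h2]
    rw [← midMat_mul_rankTwist n hp h2, Matrix.mul_assoc] at h3
    rw [← Matrix.mul_one (midMat n (invCoeff (n + 1) p 1) _), ← h3, ← Matrix.mul_assoc, h1,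
      Matrix.one_mul, midMat_mul_rankTwist n hp h2]
  rw [hinv, Matrix.mul_kronecker_mul, Matrix.mul_assoc, ← Matrix.mul_assoc (schurPar _ _ _ _ _), key,
    RMat, ← midMat_mul_rankTwist n hp h2, Matrix.mul_kronecker_mul]
  simp only [Matrix.mul_assoc]

theorem RMat_corner (hn : 1 ≤ n) (hp : p ≠ 0) (h2 : (2 : F) ≠ 0) (hu : u ≠ 0) :
    RMat (n + 1) p u v (lastIdx n, firstIdx n) (lastIdx n, firstIdx n) =
      cornerPar p (v * xi (n + 1) p / u) := by
  rw [RMat_eq (n + 1) hp h2, midMat_conj_corner hn, RJimbo_apply _ _ hu _ h2, rPar_corner hn _ _ _ _ h2,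
    cornerPar]

theorem rPar_of_degree_ne (hn : 1 ≤ n) {x y : Fin (2 * (n + 1)) × Fin (2 * (n + 1))}
    (h : idxDeg n x.1 + idxDeg n x.2 ≠ idxDeg n y.1 + idxDeg n y.2) :
    rPar (n + 1) p u v w x y = 0 := by
  have h1 : x ≠ y := by rintro rfl; exact h rfl
  have h2 : ¬ (x.1 = y.2 ∧ x.2 = y.1) := by
    rintro ⟨h1, h2⟩; rw [h1, h2, add_comm] at h; exact h rfl
  have h3 : ¬ (midSwap (n + 1) x.1 = y.2 ∧ x.2 = midSwap (n + 1) y.1) := by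
    rintro ⟨h1, h2⟩
    rw [h2, ← idxDeg_midSwap hn x.1, h1, idxDeg_midSwap hn, add_comm] at h; exact h rfl
  have h4 : ¬ (x.1 = x.2.rev ∧ y.1 = y.2.rev) := by
    rintro ⟨h1, h2⟩; rw [h1, h2, idxDeg_rev, idxDeg_rev] at h; simp at h
  have h5 : ¬ (midSwap (n + 1) x.1 = x.2.rev ∧ midSwap (n + 1) y.1 = y.2.rev) := by
    rintro ⟨h1, h2⟩
    rw [← idxDeg_midSwap hn x.1, ← idxDeg_midSwap hn y.1, h1, h2, idxDeg_rev, idxDeg_rev] at h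
    simp at h
  simp only [rPar, h1, h2, h3, h4, h5, if_false, mul_zero, add_zero]

/-- Each term of Jimbo's matrix preserves the total degree: ℙ permutes the degrees, ℚ lives in
degree zero, and exchanging the middle indices does not affect degrees. The same reason covers the
twist. -/
theorem RMat_of_degree_ne (hn : 1 ≤ n) (hp : p ≠ 0) (h2 : (2 : F) ≠ 0) (hu : u ≠ 0)
    {x y : Fin (2 * (n + 1)) × Fin (2 * (n + 1))}
    (h : idxDeg n x.1 + idxDeg n x.2 ≠ idxDeg n y.1 + idxDeg n y.2) :
    RMat (n + 1) p u v x y = 0 := by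
  have h0 : ∀ x' y' : Fin (2 * (n + 1)) × Fin (2 * (n + 1)), idxDeg n x'.1 = idxDeg n x.1 →
      idxDeg n x'.2 = idxDeg n x.2 → idxDeg n y'.1 = idxDeg n y.1 → idxDeg n y'.2 = idxDeg n y.2 →
      RJimbo (n + 1) p u v x' y' = 0 := by
    intro x' y' e1 e2 e3 e4
    rw [RJimbo_apply _ _ hu _ h2, rPar_of_degree_ne hn (by rwa [e1, e2, e3, e4])]
  rw [RMat_eq (n + 1) hp h2, mul_midMat_kron_apply]
  simp only [midMat_kron_mul_apply]
  simp (discharger := simp [idxDeg_midSwap hn]) only [h0]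
  simp

end Rational

/-! ### Entries of the R-matrix in a subring. -/

section Regular

variable {F : Type*} [Field F] {O : Subring F} {p u v : F}

theorem zpow_mem_of_inv_mem {a : F} (h : a ∈ O) (h' : a⁻¹ ∈ O) (z : ℤ) : a ^ z ∈ O := by
  cases z with
  | ofNat m => simpa using O.pow_mem h m
  | negSucc m => rw [zpow_negSucc, ← inv_pow]; exact O.pow_mem h' _

theorem pFun_mem {N : ℕ} {q : F} (hq : q ∈ O) (hq' : q⁻¹ ∈ O) (hu : u ∈ O) (hv : v ∈ O)
    (h : (u - v)⁻¹ ∈ O) (i j : Fin N) : pFun q i j u v ∈ O := by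
  simp only [pFun, fFun, gFun, gtFun, div_eq_mul_inv]
  split_ifs
  · exact O.sub_mem (O.mul_mem (O.sub_mem (O.mul_mem hu hq) (O.mul_mem hv hq')) h) O.one_mem
  · exact O.mul_mem (O.mul_mem (O.sub_mem hq hq') hv) h
  · exact O.mul_mem (O.mul_mem (O.sub_mem hq hq') hu) h

/-- The conditions under which the entries of the R-matrix belong to a subring. -/
structure RegularAt (O : Subring F) (n : ℕ) (p u v : F) : Prop where
  p_ne : p ≠ 0
  two_ne : (2 : F) ≠ 0
  p_mem : p ∈ O
  p_inv : p⁻¹ ∈ O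
  two_inv : (2 : F)⁻¹ ∈ O
  u_mem : u ∈ O
  v_mem : v ∈ O
  sub : (u - v)⁻¹ ∈ O
  add : (-u - v)⁻¹ ∈ O
  xi_sub : (v * xi n p - u)⁻¹ ∈ O
  xi_add : (v * xi n p + u)⁻¹ ∈ O

namespace RegularAt

variable {n : ℕ}

theorem pow_mem (h : RegularAt O n p u v) (k : ℕ) (z : ℤ) : (p ^ k) ^ z ∈ O :=
  zpow_mem_of_inv_mem (O.pow_mem h.p_mem k) (by rw [← inv_pow]; exact O.pow_mem h.p_inv k) z

theorem pow_inv_mem (h : RegularAt O n p u v) (k : ℕ) : (p ^ k)⁻¹ ∈ O := by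
  rw [← inv_pow]; exact O.pow_mem h.p_inv k

theorem xi_mem (h : RegularAt O n p u v) : xi n p ∈ O := h.pow_mem 4 _

theorem qFun_mem (h : RegularAt O n p u v) {u' : F} (hu : u' ∈ O)
    (h' : (v * xi n p - u')⁻¹ ∈ O) (i j : Fin (2 * n)) : qFun n p i j u' v ∈ O := by
  refine O.sub_mem (O.mul_mem (h.pow_mem 2 _) (pFun_mem (O.pow_mem h.p_mem 4) (h.pow_inv_mem 4)
    (O.mul_mem h.v_mem h.xi_mem) hu h' _ _)) ?_
  split_ifs
  · exact O.add_mem (O.sub_mem (O.pow_mem h.p_mem 4) (ofNat_mem O 2)) (h.pow_inv_mem 4)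
  · exact O.zero_mem

theorem RJimbo_mem (h : RegularAt O n p u v) (x y : Fin (2 * n) × Fin (2 * n)) :
    RJimbo n p u v x y ∈ O := by
  have key : ∀ u', u' ∈ O → (u' - v)⁻¹ ∈ O → (v * xi n p - u')⁻¹ ∈ O →
      ∀ x y, (1 + PMat n p u' v + QMat n p u' v) x y ∈ O := by
    intro u' h1 h2 h3 x y
    rw [Matrix.add_apply, Matrix.add_apply, PMat_apply, QMat_apply, Matrix.one_apply]
    refine O.add_mem (O.add_mem ?_ ?_) ?_ <;> split_ifs
    · exact O.one_mem
    · exact O.zero_mem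
    · exact pFun_mem (O.pow_mem h.p_mem 4) (h.pow_inv_mem 4) h1 h.v_mem h2 _ _
    · exact O.zero_mem
    · exact h.qFun_mem h1 h3 _ _
    · exact O.zero_mem
  have h2 : (1 / 2 : F) ∈ O := by rw [one_div]; exact h.two_inv
  rw [RJimbo, Matrix.add_apply, Matrix.smul_apply, Matrix.smul_apply, UMat_conj_apply]
  refine O.add_mem (O.mul_mem h2 (key _ h.u_mem h.sub h.xi_sub _ _))
    (O.mul_mem h2 (key _ (O.neg_mem h.u_mem) h.add ?_ _ _))
  rw [sub_neg_eq_add]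
  exact h.xi_add

theorem aCoeff_mem (h : RegularAt O n p u v) {ε : F} (hε : ε ∈ O) : aCoeff n p ε ∈ O := by
  rw [aCoeff, div_eq_mul_inv, mul_inv]
  exact O.mul_mem (O.add_mem O.one_mem (O.mul_mem hε (h.pow_mem 2 _)))
    (O.mul_mem h.two_inv h.p_inv)

theorem invCoeff_mem (h : RegularAt O n p u v) {ε : F} (hε : ε ∈ O) : invCoeff n p ε ∈ O := by
  refine O.mul_mem (O.mul_mem hε (h.aCoeff_mem hε)) (O.mul_mem (O.pow_mem h.p_mem 2) ?_)
  rw [← zpow_neg]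
  exact h.pow_mem 2 _

theorem RMat_mem (h : RegularAt O n p u v) (x y : Fin (2 * n) × Fin (2 * n)) :
    RMat n p u v x y ∈ O := by
  have hw : ∀ α β : F, α ∈ O → β ∈ O → ∀ i : Fin (2 * n),
      (midWeight n α β i).1 ∈ O ∧ (midWeight n α β i).2 ∈ O := by
    intro α β hα hβ i
    unfold midWeight
    split_ifs
    · exact ⟨hα, hβ⟩
    · exact ⟨O.one_mem, O.zero_mem⟩
  have h1 := O.one_mem
  have h2 := O.neg_mem h1
  have ha := hw _ _ (h.aCoeff_mem h1) (h.aCoeff_mem h2)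
  have hb := hw _ _ (h.invCoeff_mem h1) (h.invCoeff_mem h2)
  have comb : ∀ {a b c d r s t w : F}, a ∈ O ∧ b ∈ O → c ∈ O ∧ d ∈ O → r ∈ O → s ∈ O → t ∈ O →
      w ∈ O → a * (c * r + d * s) + b * (c * t + d * w) ∈ O := fun h1 h2 h3 h4 h5 h6 =>
    O.add_mem (O.mul_mem h1.1 (O.add_mem (O.mul_mem h2.1 h3) (O.mul_mem h2.2 h4)))
      (O.mul_mem h1.2 (O.add_mem (O.mul_mem h2.1 h5) (O.mul_mem h2.2 h6)))
  rw [RMat_eq n h.p_ne h.two_ne, mul_midMat_kron_apply]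
  simp only [midMat_kron_mul_apply]
  have hJ := h.RJimbo_mem
  exact comb (hb _) (hb _) (comb (ha _) (ha _) (hJ _ _) (hJ _ _) (hJ _ _) (hJ _ _))
    (comb (ha _) (ha _) (hJ _ _) (hJ _ _) (hJ _ _) (hJ _ _))
    (comb (ha _) (ha _) (hJ _ _) (hJ _ _) (hJ _ _) (hJ _ _))
    (comb (ha _) (ha _) (hJ _ _) (hJ _ _) (hJ _ _) (hJ _ _))

end RegularAt

end Regular

/-! ### The expansions as power series inside the Laurent series. -/

section Laurent

variable {K : Type*} [Field K]

theorem ofPowerSeries_ne_zero_and_inv_mem {f : K⟦X⟧} (hf : PowerSeries.constantCoeff f ≠ 0) :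
    HahnSeries.ofPowerSeries ℤ K f ≠ 0 ∧
      (HahnSeries.ofPowerSeries ℤ K f)⁻¹ ∈ (HahnSeries.ofPowerSeries ℤ K).range := by
  have h : HahnSeries.ofPowerSeries ℤ K f * HahnSeries.ofPowerSeries ℤ K f⁻¹ = 1 := by
    rw [← map_mul, PowerSeries.mul_inv_cancel f hf, map_one]
  exact ⟨left_ne_zero_of_mul_eq_one h, ⟨f⁻¹, eq_inv_of_mul_eq_one_right h⟩⟩

/-- The values of `u` in the two expansions. -/
noncomputable def Dir.u (K : Type*) [Field K] : Dir → LaurentSeries K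
  | .vOverU => 1
  | .uOverV => HahnSeries.single 1 1

/-- The values of `v` in the two expansions. -/
noncomputable def Dir.v (K : Type*) [Field K] : Dir → LaurentSeries K
  | .vOverU => HahnSeries.single 1 1
  | .uOverV => 1

/-- In either expansion one of u, v is 1 and the other is x, so the constant term is one of the two
non-zero coefficients. All denominators of the R-matrix are linear forms of this type. -/
theorem Dir.linear_regular (d : Dir) {a b : K} (ha : a ≠ 0) (hb : b ≠ 0) :
    HahnSeries.C a * d.u K + HahnSeries.C b * d.v K ≠ 0 ∧
      (HahnSeries.C a * d.u K + HahnSeries.C b * d.v K)⁻¹ ∈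
        (HahnSeries.ofPowerSeries ℤ K).range := by
  cases d
  · have := ofPowerSeries_ne_zero_and_inv_mem (f := PowerSeries.C a + PowerSeries.C b * PowerSeries.X)
      (by simpa using ha)
    simpa [Dir.u, Dir.v, HahnSeries.ofPowerSeries_C, HahnSeries.ofPowerSeries_X] using this
  · have := ofPowerSeries_ne_zero_and_inv_mem (f := PowerSeries.C a * PowerSeries.X + PowerSeries.C b)
      (by simpa using hb)
    simpa [Dir.u, Dir.v, HahnSeries.ofPowerSeries_C, HahnSeries.ofPowerSeries_X] using this

theorem xi_C (n : ℕ) (p : K) : xi n (HahnSeries.C p : LaurentSeries K) = HahnSeries.C (xi n p) := by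
  simp only [xi, map_zpow₀, map_pow]

theorem Dir.u_ne_zero (d : Dir) : d.u K ≠ 0 := by
  cases d <;> simp [Dir.u]

theorem C_mem (a : K) : (HahnSeries.C a : LaurentSeries K) ∈ (HahnSeries.ofPowerSeries ℤ K).range :=
  ⟨PowerSeries.C a, HahnSeries.ofPowerSeries_C a⟩

theorem single_mem : (HahnSeries.single 1 1 : LaurentSeries K) ∈
    (HahnSeries.ofPowerSeries ℤ K).range :=
  ⟨PowerSeries.X, HahnSeries.ofPowerSeries_X⟩

theorem Dir.xi_regular (d : Dir) (n : ℕ) {p : K} (hp : p ≠ 0) {a : K} (ha : a ≠ 0) :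
    d.v K * xi n (HahnSeries.C p) + HahnSeries.C a * d.u K ≠ 0 ∧
      (d.v K * xi n (HahnSeries.C p) + HahnSeries.C a * d.u K)⁻¹ ∈
        (HahnSeries.ofPowerSeries ℤ K).range := by
  have h : xi n p ≠ 0 := zpow_ne_zero _ (pow_ne_zero _ hp)
  have := d.linear_regular ha h
  rwa [xi_C, mul_comm, add_comm]

theorem RCoeff_apply (n : ℕ) (p : K) (d : Dir) (k : ℕ) (x y : Fin (2 * n) × Fin (2 * n)) :
    RCoeff n p d k x y = (RMat n (HahnSeries.C p) (d.u K) (d.v K) x y).coeff k := by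
  cases d <;> rfl

variable [CharZero K]

theorem laurentSeries_two_ne_zero : (2 : LaurentSeries K) ≠ 0 := by
  rw [← map_ofNat (HahnSeries.C (Γ := ℤ) (R := K)) 2]
  simp

theorem Dir.regularAt (d : Dir) (n : ℕ) {p : K} (hp : p ≠ 0) :
    RegularAt (HahnSeries.ofPowerSeries ℤ K).range n (HahnSeries.C p) (d.u K) (d.v K) where
  p_ne := by simpa using hp
  two_ne := laurentSeries_two_ne_zero
  p_mem := C_mem p
  p_inv := by rw [← map_inv₀]; exact C_mem _
  two_inv := by
    rw [← map_ofNat (HahnSeries.C (Γ := ℤ) (R := K)) 2, ← map_inv₀]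
    exact C_mem _
  u_mem := by cases d; exacts [one_mem _, single_mem]
  v_mem := by cases d; exacts [single_mem, one_mem _]
  sub := by
    have := (d.linear_regular (K := K) one_ne_zero (neg_ne_zero.2 one_ne_zero)).2
    simpa [sub_eq_add_neg] using this
  add := by
    have := (d.linear_regular (K := K) (neg_ne_zero.2 one_ne_zero) (neg_ne_zero.2 one_ne_zero)).2
    simpa [sub_eq_add_neg] using this
  xi_sub := by
    have := (d.xi_regular n hp (neg_ne_zero.2 one_ne_zero)).2
    simpa [sub_eq_add_neg] using this
  xi_add := by
    have := (d.xi_regular n hp one_ne_zero).2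
    simpa using this

theorem Dir.generic (d : Dir) (n : ℕ) {p : K} (hp : p ≠ 0) :
    Generic (HahnSeries.C p) (d.u K) (d.v K) (d.v K * xi (n + 1) (HahnSeries.C p) / d.u K) := by
  have hu := d.u_ne_zero (K := K)
  have hp' : (HahnSeries.C p : LaurentSeries K) ≠ 0 := by simpa using hp
  have hw : HahnSeries.C p ^ 4 * (d.v K * xi (n + 1) (HahnSeries.C p) / d.u K) =
      d.v K * xi n (HahnSeries.C p) / d.u K := by rw [xi_eq n hp']; ring
  have h1 : ∀ m, d.v K * xi m (HahnSeries.C p) / d.u K - 1 ≠ 0 := by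
    intro m
    have := (d.xi_regular m hp (neg_ne_zero.2 one_ne_zero)).1
    rw [div_sub_one hu]
    exact div_ne_zero (by simpa [sub_eq_add_neg] using this) hu
  have h2 : ∀ m, -(d.v K * xi m (HahnSeries.C p) / d.u K) - 1 ≠ 0 := by
    intro m
    have := (d.xi_regular m hp one_ne_zero).1
    rw [← neg_add', neg_ne_zero, div_add_one hu]
    exact div_ne_zero (by simpa using this) hu
  refine ⟨hp', laurentSeries_two_ne_zero, ?_, ?_, h1 _, h2 _, by rw [hw]; exact h1 n, by rw [hw]; exact h2 n⟩
  · have := (d.linear_regular (K := K) one_ne_zero (neg_ne_zero.2 one_ne_zero)).1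
    simpa [sub_eq_add_neg] using this
  · have := (d.linear_regular (K := K) (neg_ne_zero.2 one_ne_zero) (neg_ne_zero.2 one_ne_zero)).1
    simpa [sub_eq_add_neg] using this

/-- The pivot is (q²w² - 1) / (q (w² - 1)). Since q w is the parameter of rank n, the denominators
of its inverse are the linear forms vξ ± u of rank n, which are invertible as power series. -/
theorem Dir.corner_inv_mem (d : Dir) (n : ℕ) {p : K} (hp : p ≠ 0) :
    cornerPar (HahnSeries.C p) (d.v K * xi (n + 1) (HahnSeries.C p) / d.u K) ≠ 0 ∧
    (cornerPar (HahnSeries.C p) (d.v K * xi (n + 1) (HahnSeries.C p) / d.u K))⁻¹ ∈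
      (HahnSeries.ofPowerSeries ℤ K).range := by
  have h := d.generic n hp
  have hu := d.u_ne_zero (K := K)
  have r1 := d.regularAt n hp
  have r2 := d.regularAt (n + 1) hp
  have h1 := (d.xi_regular n hp (neg_ne_zero.2 one_ne_zero)).1
  have h2 := (d.xi_regular n hp one_ne_zero).1
  have h3 := (d.xi_regular (n + 1) hp (neg_ne_zero.2 one_ne_zero)).1
  have h4 := (d.xi_regular (n + 1) hp one_ne_zero).1
  rw [map_neg, map_one, neg_one_mul, ← sub_eq_add_neg] at h1 h3
  rw [map_one, one_mul] at h2 h4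
  have e : cornerPar (HahnSeries.C p) (d.v K * xi (n + 1) (HahnSeries.C p) / d.u K) =
      (d.v K * xi n (HahnSeries.C p) - d.u K) * (d.v K * xi n (HahnSeries.C p) + d.u K) /
      (HahnSeries.C p ^ 4 * ((d.v K * xi (n + 1) (HahnSeries.C p) - d.u K) *
        (d.v K * xi (n + 1) (HahnSeries.C p) + d.u K))) := by
    have hp' := r1.p_ne
    rw [h.corner, xi_eq n hp']
    rw [mul_left_comm (d.v K)]
    generalize d.v K * xi (n + 1) (HahnSeries.C p) = z
    generalize (HahnSeries.C p : LaurentSeries K) = p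
    generalize d.u K = u at hu
    rw [mul_div_assoc', div_sub_one hu, div_add_one hu, div_sub_one hu, div_add_one hu,
      div_mul_div_comm, div_mul_div_comm, mul_div_assoc',
      div_div_div_cancel_right₀ (mul_ne_zero hu hu)]
  rw [e]
  refine ⟨div_ne_zero (mul_ne_zero h1 h2) (mul_ne_zero (pow_ne_zero 4 r1.p_ne) (mul_ne_zero h3 h4)), ?_⟩
  rw [inv_div, div_eq_mul_inv, mul_inv]
  have hz := mul_mem r2.v_mem r2.xi_mem
  exact mul_mem (mul_mem (pow_mem r1.p_mem 4) (mul_mem (sub_mem hz r1.u_mem) (add_mem hz r1.u_mem)))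
    (mul_mem r1.xi_sub r1.xi_add)

/-- The identities are proved in the field K((x)), where they are identities between rational
functions, and pulled back along the injection of power series. -/
theorem exists_series (d : Dir) {n : ℕ} (hn : 1 ≤ n) {p : K} (hp : p ≠ 0) :
    ∃ (r : Mat2 (n + 1) K⟦X⟧) (s : K⟦X⟧),
      s * r (lastIdx n, firstIdx n) (lastIdx n, firstIdx n) = 1 ∧
      (∀ x y, idxDeg n x.1 + idxDeg n x.2 ≠ idxDeg n y.1 + idxDeg n y.2 → r x y = 0) ∧
      (∀ k x y, RCoeff (n + 1) p d k x y = PowerSeries.coeff k (r x y)) ∧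
      (∀ k x y, RCoeff n p d k x y = PowerSeries.coeff k (schurR r s x y)) := by
  have hreg := d.regularAt (n + 1) hp
  have hu := d.u_ne_zero (K := K)
  obtain ⟨hc, s, hs⟩ := d.corner_inv_mem n hp
  choose r hr using hreg.RMat_mem
  have hinj : Function.Injective (HahnSeries.ofPowerSeries ℤ K) :=
    HahnSeries.ofPowerSeries_injective (Γ := ℤ) (R := K)
  refine ⟨Matrix.of r, s, hinj ?_, fun x y hxy => hinj ?_, fun k x y => ?_, fun k x y => ?_⟩
  · rw [map_mul, hs, map_one, Matrix.of_apply, hr, RMat_corner hn hreg.p_ne hreg.two_ne hu,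
      inv_mul_cancel₀ hc]
  · rw [Matrix.of_apply, hr, RMat_of_degree_ne hn hreg.p_ne hreg.two_ne hu hxy, map_zero]
  · rw [RCoeff_apply, Matrix.of_apply, ← hr, HahnSeries.ofPowerSeries_apply_coeff]
  · rw [RCoeff_apply, ← schurR_RMat hn hu (d.generic n hp), ← hs,
      ← HahnSeries.ofPowerSeries_apply_coeff (Γ := ℤ)]
    refine congrArg (fun f : LaurentSeries K => f.coeff (k : ℤ)) ?_
    simp only [schurR, Matrix.of_apply, map_sub, map_mul, hr]

end Laurent

/-! ### The universal property of the algebra. -/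

section Universal

variable {K : Type*} [Field K] {A B : Type*} [Ring A] [Algebra K A] [Ring B] [Algebra K B] {n : ℕ}

/-- The image of an L-operator under an algebra homomorphism. -/
noncomputable def LOp.mapHom (φ : A →ₐ[K] B) (L : LOp n A) : LOp n B :=
  fun μ => (L μ).map (PowerSeries.map (φ : A →+* B))

theorem LOp.mode_mapHom (φ : A →ₐ[K] B) (L : LOp n A) (μ : Sgn) (a : ℤ) :
    (L.mapHom φ).mode μ a = φ.mapMatrix (L.mode μ a) := by
  ext i j
  rw [AlgHom.mapMatrix_apply, Matrix.map_apply, LOp.mode_apply, LOp.mode_apply, extCoeff_apply,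
    extCoeff_apply]
  split_ifs
  · simp [LOp.mapHom]
  · simp

theorem kron_one_mapMatrix {ι : Type*} [Fintype ι] [DecidableEq ι] (φ : A →ₐ[K] B)
    (X : Matrix ι ι A) : (φ.mapMatrix X) ⊗ₖ (1 : Matrix ι ι B) =
      φ.mapMatrix (X ⊗ₖ (1 : Matrix ι ι A)) := by
  ext x y
  simp [Matrix.one_apply, apply_ite φ]

theorem one_kron_mapMatrix {ι : Type*} [Fintype ι] [DecidableEq ι] (φ : A →ₐ[K] B)
    (X : Matrix ι ι A) : (1 : Matrix ι ι B) ⊗ₖ (φ.mapMatrix X) =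
      φ.mapMatrix ((1 : Matrix ι ι A) ⊗ₖ X) := by
  ext x y
  simp [Matrix.one_apply, apply_ite φ]

theorem map_algebraMap_eq {ι : Type*} [Fintype ι] [DecidableEq ι] (φ : A →ₐ[K] B)
    (X : Matrix ι ι K) : X.map (algebraMap K B) = φ.mapMatrix (X.map (algebraMap K A)) := by
  ext x y
  simp

/-- The R-matrix has scalar coefficients, so both sides of RLL are natural in the algebra. -/
theorem rllLeft_mapHom (φ : A →ₐ[K] B) (p : K) (d : Dir) (L : LOp n A) (μ ρ : Sgn) (a b : ℤ) :
    rllLeft p d (L.mapHom φ) μ ρ a b = φ.mapMatrix (rllLeft p d L μ ρ a b) := by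
  rw [rllLeft, rllLeft, map_sum]
  refine Finset.sum_congr rfl fun k _ => ?_
  rw [LOp.mode_mapHom, LOp.mode_mapHom, kron_one_mapMatrix, one_kron_mapMatrix,
    map_algebraMap_eq φ, map_mul, map_mul]

theorem rllRight_mapHom (φ : A →ₐ[K] B) (p : K) (d : Dir) (L : LOp n A) (μ ρ : Sgn) (a b : ℤ) :
    rllRight p d (L.mapHom φ) μ ρ a b = φ.mapMatrix (rllRight p d L μ ρ a b) := by
  rw [rllRight, rllRight, map_sum]
  refine Finset.sum_congr rfl fun k _ => ?_
  rw [LOp.mode_mapHom, LOp.mode_mapHom, kron_one_mapMatrix, one_kron_mapMatrix,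
    map_algebraMap_eq φ, map_mul, map_mul]

theorem Uq.L_eq (n : ℕ) (p : K) :
    Uq.L n p = (freeL K n).mapHom (RingQuot.mkAlgHom K (Rel n p)) := by
  funext μ
  ext i j m
  simp only [Uq.L, freeL, LOp.mapHom, Matrix.of_apply, Matrix.map_apply, PowerSeries.coeff_mk,
    PowerSeries.coeff_map]
  rfl

theorem Uq.rll (n : ℕ) (p : K) : RLL p (Uq.L n p) := by
  intro d μ ρ h a b
  rw [Uq.L_eq, rllLeft_mapHom, rllRight_mapHom]
  ext r s
  exact RingQuot.mkAlgHom_rel K (Rel.rll d μ ρ h a b r s)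

theorem Uq.zeroModes (n : ℕ) (p : K) : ZeroModes (Uq.L n p) := by
  have hc : ∀ μ i j, PowerSeries.constantCoeff (Uq.L n p μ i j) =
      RingQuot.mkAlgHom K (Rel n p) (FreeAlgebra.ι K (μ, i, j, 0)) := by
    intro μ i j
    rw [← PowerSeries.coeff_zero_eq_constantCoeff_apply, Uq.L, Matrix.of_apply,
      PowerSeries.coeff_mk]
  refine ⟨fun i j h => ?_, fun i j h => ?_, fun i => ?_, fun i => ?_⟩ <;> simp only [hc]
  · rw [RingQuot.mkAlgHom_rel K (Rel.plus i j h), map_zero]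
  · rw [RingQuot.mkAlgHom_rel K (Rel.minus i j h), map_zero]
  · rw [← map_mul, RingQuot.mkAlgHom_rel K (Rel.plus_mul_minus i), map_one]
  · rw [← map_mul, RingQuot.mkAlgHom_rel K (Rel.minus_mul_plus i), map_one]

/-- The universal property of `U_q(D_n^{(2)})`. -/
theorem Uq.existsUnique_lift {p : K} {L : LOp n A} (h0 : ZeroModes L) (h : RLL p L) :
    ∃! φ : Uq n p →ₐ[K] A, ∀ μ i j,
      PowerSeries.map (φ : Uq n p →+* A) (Uq.L n p μ i j) = L μ i j := by
  set Φ : FreeAlgebra K (Gen n) →ₐ[K] A :=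
    FreeAlgebra.lift K fun g => PowerSeries.coeff g.2.2.2 (L g.1 g.2.1 g.2.2.1) with hΦ
  have hι : ∀ μ i j m, Φ (FreeAlgebra.ι K (μ, i, j, m)) = PowerSeries.coeff m (L μ i j) := by
    intro μ i j m
    rw [hΦ, FreeAlgebra.lift_ι_apply]
  have hι0 : ∀ μ i j, Φ (FreeAlgebra.ι K (μ, i, j, 0)) =
      PowerSeries.constantCoeff (L μ i j) := by
    intro μ i j
    rw [hι, PowerSeries.coeff_zero_eq_constantCoeff_apply]
  have hL : L = (freeL K n).mapHom Φ := by
    funext μ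
    ext i j m
    simp [freeL, LOp.mapHom, hι]
  have hrel : ∀ ⦃x y⦄, Rel n p x y → Φ x = Φ y := by
    intro x y hxy
    cases hxy with
    | plus i j hij => rw [hι0, h0.plus i j hij, map_zero]
    | minus i j hij => rw [hι0, h0.minus i j hij, map_zero]
    | plus_mul_minus i => rw [map_mul, hι0, hι0, h0.plus_mul_minus, map_one]
    | minus_mul_plus i => rw [map_mul, hι0, hι0, h0.minus_mul_plus, map_one]
    | rll d μ ρ hd a b r s =>
      have := h d μ ρ hd a b
      rw [hL, rllLeft_mapHom, rllRight_mapHom] at this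
      exact congrFun (congrFun this r) s
  have hcoeff : ∀ (φ : Uq n p →ₐ[K] A) μ i j m,
      PowerSeries.coeff m (PowerSeries.map (φ : Uq n p →+* A) (Uq.L n p μ i j)) =
        φ (RingQuot.mkAlgHom K (Rel n p) (FreeAlgebra.ι K (μ, i, j, m))) := by
    intro φ μ i j m
    rw [PowerSeries.coeff_map, Uq.L, Matrix.of_apply, PowerSeries.coeff_mk]
    rfl
  refine ⟨RingQuot.liftAlgHom K ⟨Φ, hrel⟩, fun μ i j => ?_, fun φ hφ => ?_⟩
  · ext m
    rw [hcoeff, RingQuot.liftAlgHom_mkAlgHom_apply, hι]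
  · refine RingQuot.ringQuot_ext' K _ _ (FreeAlgebra.hom_ext (funext fun ⟨μ, i, j, m⟩ => ?_))
    simp only [Function.comp_apply, AlgHom.comp_apply]
    rw [RingQuot.liftAlgHom_mkAlgHom_apply, hι, ← hcoeff, hφ]

end Universal

end TwistedD

theorem theorem4p1 {K : Type*} [Field K] [CharZero K] (p : K) (hp : p ≠ 0)
    (hq : ∀ m : ℕ, 0 < m → (p ^ 4) ^ m ≠ 1) (n : ℕ) (hn : 1 ≤ n) :
    (∀ (A : Type*) [Ring A] [Algebra K A] (L : LOp (n + 1) A), ZeroModes L → RLL p L →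
      (∀ μ, IsUnit (L μ (firstIdx n) (firstIdx n))) ∧
        ZeroModes (reducedL L) ∧ RLL p (reducedL L)) ∧
    (∃! φ : Uq n p →ₐ[K] Uq (n + 1) p, ∀ μ i j,
      PowerSeries.map (φ : Uq n p →+* Uq (n + 1) p) (Uq.L n p μ i j) =
        reducedL (Uq.L (n + 1) p) μ i j) := by
  -- Here n is the rank of the reduced algebra. The bound 1 ≤ n keeps the first and last indices of
  -- the larger rank away from the middle ones.
  refine ⟨fun A _ _ L h0 h => ⟨fun μ => h0.isUnit_diag μ _, h0.reducedL,
    h.reducedL h0 fun d => exists_series d hn hp⟩, ?_⟩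
  have h0 := Uq.zeroModes (n + 1) p
  exact Uq.existsUnique_lift h0.reducedL
    ((Uq.rll (n + 1) p).reducedL h0 fun d => exists_series d hn hp)
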